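/- Theorem 5.3. Let $m\ge 1$ and, for $a=(a_1,\dots,a_m)\in\mathbb C^m$, let $P_m(x,a)=x^m+a_1x^{m-1}+\dots+a_m$. Consider the equation $$\Phi''(x)=\frac{P_m(x,a)}{x^2}\,\Phi(x)\qquad(1)$$ on the universal covering of $\mathbb C^*$ (with $\arg x\in\mathbb R$, $x^\alpha=e^{\alpha\ln x}$, $\ln x$ real for $\arg x=0$). Put $\omega=e^{2i\pi/m}$, $\omega^z=e^{2i\pi z/m}$ for $z\in\mathbb C$, let $x\mapsto\omega^k x$ act on the covering by $\ln x\mapsto \ln x+2i\pi k/m$, and put $\tau\cdot(a_1,a_2,\dots)=(\tau a_1,\tau^2a_2,\dots)$ for $\tau\in\mathbb C$. Let $b_{m/2-k}(a)$ be the coefficient of $u^k$ in $\sqrt{1+a_1u+\dots+a_mu^m}$ (with $\sqrt1=1$), and let $$S(x,a)=\tfrac2m x^{m/2}+\sum_{1\le k<m/2}\frac{b_{m/2-k}(a)}{m/2-k}\,x^{m/2-k},\qquad r(a)=\begin{cases}\frac12-\frac m4-b_0(a),& m\text{ even},\\ \frac12-\frac m4,& m\text{ odd}.\end{cases}$$ *Solutions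 at infinity.* $\Phi_0(x,a)$ denotes the unique family of solutions of (1) which, in every strict sub-sector of $\{|\arg x|<3\pi/m\}$ and uniformly for $a$ in compact sets, has at infinity an asymptotic expansion $x^{r(a)}e^{-S(x,a)}\phi_0(x,a)$, where $\phi_0\in\mathbb C[a][[x^{-1/2}]]$ ($\phi_0\in\mathbb C[a][[x^{-1}]]$ if $m$ is even) has constant term $1$. For $k\in\mathbb Z$, $\Phi_k(x,a)=\Phi_0(\omega^kx,\omega^k\cdot a)$. *Solutions at the origin.* Put $a'=(a_1,\dots,a_{m-1})$, $a_m=(p^2-1)/4$ (so $p^2=1+4a_m$), $a=(a',a_m)$ and $s(p)=\frac{1+p}2$, where $p\in\mathbb C\setminus\{-1,-2,\dots\}$. Then $(f_1,f_2)(x,a',p)$ denotes the unique pair of linearly independent solutions of (1) of the form $$f_1=x^{s(p)}g_1(x),\qquad f_2=\lambda f_1\ln x+x^{s(-p)}g_2(x),$$ with $g_1,g_2$ entire in $x$, $g_1(0)=1$, $\lambda=\lambda(a',p)\in\mathbb C$, and: if $p\notin\mathbb Z$, then $\lambda=0$ and $g_2(x)=g_1(x,a',-p)$; if $p\in\mathbb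 N^*$, then $g_2(0)=1$ and the coefficient of $x^p$ in $g_2$ is $0$; if $p=0$, then $\lambda=1$ and $g_2(0)=0$. For $k\in\mathbb Z$, $a'\in\mathbb C^{m-1}$ and $p\in\mathbb C\setminus\{-1,-2,\dots\}$, the $0\infty$ connection matrix $M_k(a',p)$ is the unique $2\times2$ matrix such that $$\begin{pmatrix}\Phi_{k-1}\\ \Phi_k\end{pmatrix}(x,a)=M_k(a',p)\begin{pmatrix}f_1\\ f_2\end{pmatrix}(x,a',p)\qquad\text{for all }x .$$ Let $L_k(a',p)$ and $\tilde L_k(a',p)$ be its entries $(1,1)$ and $(1,2)$. Then, for every $k\in\mathbb Z$, the following holds. a) For all $a'$ and all $p\notin\{-1,-2,\dots\}$, $$\det M_k(a',p)=\begin{cases}2(-1)^k\,\dfrac{\omega^{(k-1)(1-\frac m2)+r(\omega^k\cdot a)}}{p}& \text{if }p\ne0,\\[2mm] 2(-1)^{k-1}\,\omega^{(k-1)(1-\frac m2)+r(\omega^k\cdot a)}& \text{if }p=0.\end{cases}$$ b) For every $p\notin\{-1,-2,\dots\}$, the matrix $M_k(a',p)$, and in particular $L_k$ and $\tilde L_k$,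 is entire in $a'$, and $$M_k(a',p)=\begin{pmatrix}L_k(a',p)&\tilde L_k(a',p)\\ \omega^{s(p)}L_k(\omega\cdot a',p)+\frac{2i\pi}m\lambda(a',p)\,\omega^{s(-p)}\tilde L_k(\omega\cdot a',p)&\omega^{s(-p)}\tilde L_k(\omega\cdot a',p)\end{pmatrix}.$$ c) $M_k$ is holomorphic on $\{(a',p):p\notin\mathbb Z\}$, and $\tilde L_k(a',p)=L_k(a',-p)$ for all $a'$ and all $p\notin\mathbb Z$. Moreover $\tilde L_k$ extends analytically to $p\in\mathbb N^*$, that is, $\tilde L_k$ is holomorphic on $\{(a',p): p\notin\{0,-1,-2,\dots\}\}$. d) For all $a'$ and all $p\notin\{-1,-2,\dots\}$, $$M_k(a',p)=M_0(\omega^k\cdot a',p)\begin{pmatrix}\omega^{ks(p)}&0\\ \frac{2i\pi k}m\lambda(a',p)\,\omega^{ks(-p)}&\omega^{ks(-p)}\end{pmatrix}.$$ In particular $M_m(a',p)=M_0(a',p)\,\mathfrak M(a',p)$, where $$\mathfrak M(a',p)=\begin{pmatrix}e^{2i\pi s(p)}&0\\ 2i\pi\lambda(a',p)e^{2i\pi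 s(-p)}&e^{2i\pi s(-p)}\end{pmatrix}$$ is the monodromy matrix at the origin: $\binom{f_1}{f_2}(e^{2i\pi}x,a',p)=\mathfrak M(a',p)\binom{f_1}{f_2}(x,a',p)$. -/

import Mathlib

/-! Points of the universal covering of the punctured plane are written `x = e^t` with `t : ℂ`;
the argument of `x` is `Im t`, powers are `x^α = e^{α t}`, and the logarithm of `x` is `t`.
Functions on the covering are functions of `t`, and multiplication of `x` by `ω^k`,
where `ω = e^{2πi/m}`, is the shift `t ↦ t + 2πik/m`. -/

namespace ZeroInf

noncomputable section

/-- The number `ω = e^{2πi/m}`. -/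
def om (m : ℕ) : ℂ := Complex.exp (2 * Real.pi * Complex.I / m)

/-- The power `ω^z = e^{2πiz/m}` with complex exponent `z`. -/
def omPow (m : ℕ) (z : ℂ) : ℂ := Complex.exp (2 * Real.pi * Complex.I / m * z)

/-- The quasi-homogeneous action `τ · (a_1, a_2, …) = (τ a_1, τ² a_2, …)`
(the entry with index `i` is `a_{i+1}`). -/
def dil {n : ℕ} (τ : ℂ) (a : Fin n → ℂ) : Fin n → ℂ := fun i => τ ^ (i.val + 1) * a i

/-- The coefficients `a_0 = 1, a_1, …, a_m, 0, 0, …`. -/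
def coef {m : ℕ} (a : Fin m → ℂ) : ℕ → ℂ
  | 0 => 1
  | k + 1 => if h : k < m then a ⟨k, h⟩ else 0

/-- `P_m(x, a) = x^m + a_1 x^{m-1} + ⋯ + a_m`. -/
def P {m : ℕ} (a : Fin m → ℂ) (x : ℂ) : ℂ :=
  ∑ k ∈ Finset.range (m + 1), coef a k * x ^ (m - k)

/-- The derivative `d/dx` of a function on the covering, in the coordinate `x = e^t`. -/
def dx (f : ℂ → ℂ) : ℂ → ℂ := fun t => Complex.exp (-t) * deriv f t

/-- `f` is an analytic solution of `d²f/dx² = (P_m(x, a) / x²) f` on the whole covering. -/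
def IsSolution {m : ℕ} (a : Fin m → ℂ) (f : ℂ → ℂ) : Prop :=
  Differentiable ℂ f ∧
    ∀ t, dx (dx f) t = P a (Complex.exp t) / Complex.exp t ^ 2 * f t

/-- The coefficient of `u^k` in `√(1 + a_1 u + ⋯ + a_m u^m)`; in other words the `b_{m/2-k}(a)` of
the expansion `√P_m(x, a) / x = x^{m/2-1} + ∑_{k ≥ 1} b_{m/2-k}(a) x^{m/2-k-1}` at infinity. -/
def sqrtCoef {m : ℕ} (a : Fin m → ℂ) : ℕ → ℂ
  | 0 => 1
  | k + 1 => (coef a (k + 1) - ∑ j : Fin k, sqrtCoef a (j + 1) * sqrtCoef a (k - j)) / 2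
  decreasing_by
  all_goals omega

/-- The recursion does give the square root. -/
theorem sqrtCoef_sq {m : ℕ} (a : Fin m → ℂ) :
    PowerSeries.mk (sqrtCoef a) ^ 2 = PowerSeries.mk (coef a) := by
  ext k
  rw [pow_two, PowerSeries.coeff_mul, PowerSeries.coeff_mk]
  simp only [PowerSeries.coeff_mk]
  rw [Finset.Nat.sum_antidiagonal_eq_sum_range_succ (fun i j => sqrtCoef a i * sqrtCoef a j)]
  cases k with
  | zero => simp [sqrtCoef, coef]
  | succ k =>
    rw [Finset.sum_range_succ, Finset.sum_range_succ']
    have h : sqrtCoef a (k + 1) =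
        (coef a (k + 1) - ∑ j : Fin k, sqrtCoef a (j + 1) * sqrtCoef a (k - j)) / 2 := by
      rw [sqrtCoef]
    rw [← Fin.sum_univ_eq_sum_range
      (fun j => sqrtCoef a (j + 1) * sqrtCoef a (k + 1 - (j + 1)))]
    have h0 : sqrtCoef a 0 = 1 := by rw [sqrtCoef]
    simp only [Nat.add_sub_add_right, Nat.sub_zero, Nat.sub_self, h0, one_mul, mul_one]
    rw [h]
    ring

/-- `S(x, a) = (2/m) x^{m/2} + ∑_{1 ≤ k < m/2} b_{m/2-k}(a) / (m/2-k) x^{m/2-k}` at `x = e^t`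
(the term `k = 0` below is the leading one). -/
def S {m : ℕ} (a : Fin m → ℂ) (t : ℂ) : ℂ :=
  ∑ k ∈ Finset.range ((m + 1) / 2),
    sqrtCoef a k / ((m : ℂ) / 2 - k) * Complex.exp (((m : ℂ) / 2 - k) * t)

/-- The exponent `r(a)`: `1/2 - m/4` for odd `m`, and `1/2 - m/4 - b_0(a)` for even `m`. -/
def r {m : ℕ} (a : Fin m → ℂ) : ℂ :=
  if Even m then 1 / 2 - (m : ℂ) / 4 - sqrtCoef a (m / 2) else 1 / 2 - (m : ℂ) / 4

/-- The property characterizing `Φ_0`. For every `a` the function `Φ(·, a)` solves the equation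
and, in every strict sub-sector of `|arg x| < 3π/m`, it has at infinity the Poincaré asymptotic
expansion `x^{r(a)} e^{-S(x, a)} ∑_n c_n(a) x^{-n/2}`, uniformly for `a` in compact sets,
where `c_n ∈ ℂ[a]`, `c_0 = 1`, and only integral powers of `x` occur in the series
if `m` is even. -/
def IsPhiZero (m : ℕ) (Φ : ℂ → (Fin m → ℂ) → ℂ) : Prop :=
  (∀ a, IsSolution a (fun t => Φ t a)) ∧
  ∃ c : ℕ → MvPolynomial (Fin m) ℂ, c 0 = 1 ∧ (Even m → ∀ n, Odd n → c n = 0) ∧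
    ∀ K : Set (Fin m → ℂ), IsCompact K → ∀ θ : ℝ, 0 < θ → θ < 3 * Real.pi / m → ∀ N : ℕ,
      ∃ C R : ℝ, ∀ a ∈ K, ∀ t : ℂ, R ≤ t.re → |t.im| ≤ θ →
        ‖Φ t a * Complex.exp (S a t - r a * t)
            - ∑ n ∈ Finset.range N, MvPolynomial.eval a (c n) * Complex.exp (-((n : ℂ) / 2) * t)‖
          ≤ C * Real.exp (-((N : ℝ) / 2) * t.re)

/-- The solution `Φ_0(x, a)`, at `x = e^t`. -/
def PhiZero (m : ℕ) : ℂ → (Fin m → ℂ) → ℂ := Classical.epsilon (IsPhiZero m)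

/-- `Φ_k(x, a) = Φ_0(ω^k x, ω^k · a)`, at `x = e^t`. -/
def Phi (m : ℕ) (k : ℤ) (t : ℂ) (a : Fin m → ℂ) : ℂ :=
  PhiZero m (t + 2 * Real.pi * Complex.I / m * k) (dil (om m ^ k) a)

/-- `s(p) = (1 + p)/2`. -/
def s (p : ℂ) : ℂ := (1 + p) / 2

/-- The full parameter `a = (a', a_m)` with `p² = 1 + 4 a_m`, i.e. `a_m = (p² - 1)/4`. -/
def full (m : ℕ) (a' : Fin (m - 1) → ℂ) (p : ℂ) : Fin m → ℂ :=
  fun i => if h : i.val < m - 1 then a' ⟨i.val, h⟩ else (p ^ 2 - 1) / 4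

/-- The data `(λ, g_1, g_2)` from which the basis at the origin is formed. -/
structure FuchsData where
  lam : ℂ
  g₁ : ℂ → ℂ
  g₂ : ℂ → ℂ

instance : Inhabited FuchsData := ⟨⟨0, 0, 0⟩⟩

/-- `x^{s(p)} g_1(x)` at `x = e^t`. -/
def FuchsData.f₁ (d : FuchsData) (p t : ℂ) : ℂ :=
  Complex.exp (s p * t) * d.g₁ (Complex.exp t)

/-- `λ f_1(x) ln x + x^{s(-p)} g_2(x)` at `x = e^t`. -/
def FuchsData.f₂ (d : FuchsData) (p t : ℂ) : ℂ :=
  d.lam * d.f₁ p t * t + Complex.exp (s (-p) * t) * d.g₂ (Complex.exp t)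

/-- The property characterizing the Fuchs basis at the origin: `g_1, g_2` are entire, `f_1, f_2`
are solutions, `g_1(0) = 1`, and
* if `p ∉ ℤ`, then `λ = 0` and `g_2(0) = 1` (so that `g_2` is the `g_1` belonging to `-p`);
* if `p ∈ {1, 2, …}`, then `g_2(0) = 1` and the coefficient of `x^p` in `g_2` is `0`;
* if `p = 0`, then `λ = 1` and `g_2(0) = 0`.
It is only used for `p ∉ {-1, -2, …}`. -/
def IsFuchs (m : ℕ) (a' : Fin (m - 1) → ℂ) (p : ℂ) (d : FuchsData) : Prop :=
  Differentiable ℂ d.g₁ ∧ Differentiable ℂ d.g₂ ∧ d.g₁ 0 = 1 ∧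
  IsSolution (full m a' p) (d.f₁ p) ∧ IsSolution (full m a' p) (d.f₂ p) ∧
  ((∀ n : ℤ, p ≠ n) → d.lam = 0 ∧ d.g₂ 0 = 1) ∧
  (∀ n : ℕ, 1 ≤ n → p = n → d.g₂ 0 = 1 ∧ iteratedDeriv n d.g₂ 0 = 0) ∧
  (p = 0 → d.lam = 1 ∧ d.g₂ 0 = 0)

/-- The Fuchs data at the parameter `(a', p)`. -/
def fuchs (m : ℕ) (a' : Fin (m - 1) → ℂ) (p : ℂ) : FuchsData :=
  Classical.epsilon (IsFuchs m a' p)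

/-- `f_1(x, a', p)` at `x = e^t`. -/
def f₁ (m : ℕ) (t : ℂ) (a' : Fin (m - 1) → ℂ) (p : ℂ) : ℂ := (fuchs m a' p).f₁ p t

/-- `f_2(x, a', p)` at `x = e^t`. -/
def f₂ (m : ℕ) (t : ℂ) (a' : Fin (m - 1) → ℂ) (p : ℂ) : ℂ := (fuchs m a' p).f₂ p t

/-- `λ(a', p)`. -/
def lam (m : ℕ) (a' : Fin (m - 1) → ℂ) (p : ℂ) : ℂ := (fuchs m a' p).lam

/-- `N` expresses `(Φ_{k-1}, Φ_k)(·, a)` in the basis `(f_1, f_2)(·, a', p)`. -/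
def IsConn (m : ℕ) (k : ℤ) (a' : Fin (m - 1) → ℂ) (p : ℂ) (N : Matrix (Fin 2) (Fin 2) ℂ) : Prop :=
  ∀ t : ℂ, ![Phi m (k - 1) t (full m a' p), Phi m k t (full m a' p)]
    = N.mulVec ![f₁ m t a' p, f₂ m t a' p]

/-- The `0∞` connection matrix `M_k(a', p)`. -/
def M (m : ℕ) (k : ℤ) (a' : Fin (m - 1) → ℂ) (p : ℂ) : Matrix (Fin 2) (Fin 2) ℂ :=
  Classical.epsilon (IsConn m k a' p)

/-- `L_k(a', p)`, the coefficient of `f_1` in `Φ_{k-1}`. -/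
def L (m : ℕ) (k : ℤ) (a' : Fin (m - 1) → ℂ) (p : ℂ) : ℂ := M m k a' p 0 0

/-- `L̃_k(a', p)`, the coefficient of `f_2` in `Φ_{k-1}`. -/
def Lt (m : ℕ) (k : ℤ) (a' : Fin (m - 1) → ℂ) (p : ℂ) : ℂ := M m k a' p 0 1

/-- The matrix of the monodromy at the origin in the basis `(f_1, f_2)`. -/
def monodromy (m : ℕ) (a' : Fin (m - 1) → ℂ) (p : ℂ) : Matrix (Fin 2) (Fin 2) ℂ :=
  !![Complex.exp (2 * Real.pi * Complex.I * s p), 0;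
     2 * Real.pi * Complex.I * lam m a' p * Complex.exp (2 * Real.pi * Complex.I * s (-p)),
     Complex.exp (2 * Real.pi * Complex.I * s (-p))]

/-- The set of those `p` for which the Fuchs basis is defined: all complex numbers
except `-1, -2, -3, …` . -/
def admissible : Set ℂ := {p | ∀ n : ℕ, 1 ≤ n → p ≠ -(n : ℂ)}

end

end ZeroInf

open Filter Topology

namespace ZeroInf

/-! ### Holomorphic functions on normed spaces -/

/-! Everything is read off Wronskians. In the variable t = ln x the equation has no singularity, and
the Wronskian in x of two solutions is constant. The coefficients of a solution in the basis (f₁,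
f₂) are therefore quotients of Wronskians, and the determinant of M_k is the Wronskian of (Φ_{k-1},
Φ_k) divided by that of (f₁, f₂).

At the origin, Frobenius recursions have solutions decaying faster than any geometric sequence
(`rapidOn_frob`). This gives g₁ entire in x and jointly holomorphic in (a', p) as long as p is not a
negative integer; for p = N a logarithmic companion series gives f₂. Evaluating at x = 0 yields the
Wronskian of (f₁, f₂), which is -p, or 1 if p = 0, and with monodromy arguments the uniqueness of
the normalised basis (`IsFuchs.unique`).

At infinity one writes f = x^r e^{-S} v. The equation becomes v'' = x^{m/2} (2A v' + B v), where A
tends to 1 and, thanks to the choice of r, B tends to 0. The component v' expands in suitable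
directions, so bounds can be carried back from far points along segments in the plane of x^{m/2}
(`propagate`). Solutions whose Cauchy data at far points are those of the truncated formal series
subconverge to a solution with that expansion in a sector (`exists_sectorial_solution`). A solution
whose amplitude tends to 1, with derivative tending to 0, on the positive axis is unique
(`eq_of_tendsto_amp`); hence the sectorial solutions coincide and Φ₀ has its expansion in every
strict sub-sector of |arg x| < 3π/m.

The rotation x ↦ ωx, a ↦ ω·a preserves the equation and changes S into -S. The exponentials thus
cancel in the Wronskian of Φ_{k-1} and Φ_k, whose value is obtained as a limit at infinity
(`wr_recessive`). By uniqueness the Fuchs basis is transformed by an explicit triangular matrix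
(`fuchs_rot`), and `M_add` then contains the matrix form in b) as well as d).

For holomorphy, the Wronskian of Φ₀ with a holomorphic family of solutions is a locally uniform
limit of Wronskians with solutions having explicit Cauchy data (`differentiableOn_wr_recessive`).
The entry L̃ involves only f₁ and a division by -p, so positive integers p are harmless; L follows
from the symmetry p ↦ -p, which fixes the equation and exchanges f₁ and f₂ when p is not an integer.
-/

theorem norm_fderiv_le_of_forall_mem_ball {E : Type*} [NormedAddCommGroup E] [NormedSpace ℂ E]
    {g : E → ℂ} {x : E} {ρ C : ℝ} (hρ : 0 < ρ) (hC : 0 ≤ C)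
    (hg : DifferentiableOn ℂ g (Metric.ball x ρ)) (hb : ∀ y ∈ Metric.ball x ρ, ‖g y‖ ≤ C) :
    ‖fderiv ℂ g x‖ ≤ C / (ρ / 2) := by
  refine ContinuousLinearMap.opNorm_le_bound _ (by positivity) fun v => ?_
  rcases eq_or_ne v 0 with rfl | hv
  · simp
  have hv' : 0 < ‖v‖ := norm_pos_iff.2 hv
  -- Restriction to the complex line x + ζv reduces to the one-variable Cauchy estimate; the radius
  -- is halved so that the closed disc stays in the open ball.
  have hmem : ∀ ζ : ℂ, ‖ζ‖ ≤ ρ / 2 / ‖v‖ → x + ζ • v ∈ Metric.ball x ρ := by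
    intro ζ hζ
    rw [mem_ball_iff_norm, add_sub_cancel_left, norm_smul]
    rw [le_div_iff₀ hv'] at hζ
    linarith
  have hd : ∀ ζ : ℂ, ‖ζ‖ ≤ ρ / 2 / ‖v‖ → DifferentiableAt ℂ (fun ζ : ℂ => g (x + ζ • v)) ζ := by
    intro ζ hζ
    have h1 := hg.differentiableAt (Metric.isOpen_ball.mem_nhds (hmem ζ hζ))
    exact DifferentiableAt.comp ζ (f := fun ζ : ℂ => x + ζ • v) h1 (by fun_prop)
  have hR : 0 < ρ / 2 / ‖v‖ := by positivity
  have key := Complex.norm_deriv_le_of_forall_mem_sphere_norm_le (c := 0) (C := C)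
    (f := fun ζ : ℂ => g (x + ζ • v)) hR ?_ ?_
  · have h1 := hg.differentiableAt (Metric.isOpen_ball.mem_nhds (Metric.mem_ball_self hρ))
    have h2 : HasDerivAt (fun ζ : ℂ => g (x + ζ • v)) (fderiv ℂ g x v) 0 := by
      have h3 : HasDerivAt (fun ζ : ℂ => x + ζ • v) v 0 := by
        simpa using ((hasDerivAt_id (0 : ℂ)).smul_const v).const_add x
      have h4 : HasFDerivAt g (fderiv ℂ g x) (x + (0 : ℂ) • v) := by
        simpa using h1.hasFDerivAt
      exact h4.comp_hasDerivAt 0 h3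
    rw [h2.deriv] at key
    calc _ ≤ _ := key
      _ = _ := by field_simp
  · refine DifferentiableOn.diffContOnCl fun ζ hζ => (hd ζ ?_).differentiableWithinAt
    have := Metric.closure_ball_subset_closedBall hζ
    simpa using this
  · intro ζ hζ
    exact hb _ (hmem ζ (by simpa using (le_of_eq hζ)))

/-- A locally uniform limit of holomorphic functions on a normed space is holomorphic. -/
theorem differentiableOn_of_tendstoUniformlyOn_nhds {E : Type*} [NormedAddCommGroup E]
    [NormedSpace ℂ E] {F : ℕ → E → ℂ} {f : E → ℂ} {U : Set E} (hU : IsOpen U)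
    (hF : ∀ n, DifferentiableOn ℂ (F n) U)
    (h : ∀ x ∈ U, ∃ V ∈ 𝓝 x, TendstoUniformlyOn F f atTop V) : DifferentiableOn ℂ f U := by
  intro x hx
  obtain ⟨V, hV, hlim⟩ := h x hx
  obtain ⟨ρ, hρ, hsub⟩ := Metric.mem_nhds_iff.1 (inter_mem hV (hU.mem_nhds hx))
  have hball : ∀ y ∈ Metric.ball x (ρ / 2), Metric.ball y (ρ / 2) ⊆ Metric.ball x ρ := by
    intro y hy
    refine Metric.ball_subset_ball' ?_
    rw [Metric.mem_ball] at hy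
    linarith
  -- Around each point of the half ball there is room for a ball of radius ρ/2, so the Cauchy
  -- estimate for F m - F n passes uniform convergence on to the derivatives.
  have hcau : UniformCauchySeqOn (fun n => fderiv ℂ (F n)) atTop (Metric.ball x (ρ / 2)) := by
    rw [Metric.uniformCauchySeqOn_iff]
    intro ε hε
    obtain ⟨N, hN⟩ := Metric.uniformCauchySeqOn_iff.1 hlim.uniformCauchySeqOn
      (ε * (ρ / 2 / 2) / 2) (by positivity)
    refine ⟨N, fun m hm n hn y hy => ?_⟩
    have hdm := ((hF m).mono (fun z hz => (hsub (hball y hy hz)).2) :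
      DifferentiableOn ℂ (F m) (Metric.ball y (ρ / 2)))
    have hdn := ((hF n).mono (fun z hz => (hsub (hball y hy hz)).2) :
      DifferentiableOn ℂ (F n) (Metric.ball y (ρ / 2)))
    have hyy := Metric.isOpen_ball.mem_nhds (Metric.mem_ball_self (x := y) (half_pos hρ))
    rw [dist_eq_norm, ← fderiv_fun_sub (hdm.differentiableAt hyy) (hdn.differentiableAt hyy)]
    have := norm_fderiv_le_of_forall_mem_ball (half_pos hρ) (C := ε * (ρ / 2 / 2) / 2)
      (by positivity) (hdm.sub hdn) (fun z hz => by
        have := hN m hm n hn z (hsub (hball y hy hz)).1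
        rw [dist_eq_norm] at this
        exact this.le)
    refine lt_of_le_of_lt this ?_
    rw [div_lt_iff₀ (by positivity)]
    have : 0 < ε * (ρ / 2 / 2) := by positivity
    linarith
  have hex : ∀ y, ∃ l, y ∈ Metric.ball x (ρ / 2) → Tendsto (fun n => fderiv ℂ (F n) y) atTop (𝓝 l) := by
    intro y
    by_cases hy : y ∈ Metric.ball x (ρ / 2)
    · obtain ⟨l, hl⟩ := cauchySeq_tendsto_of_complete (hcau.cauchySeq hy)
      exact ⟨l, fun _ => hl⟩
    · exact ⟨0, fun h => absurd h hy⟩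
  choose l hl using hex
  have := hasFDerivAt_of_tendstoUniformlyOn (f := F) (g := f) (x := x)
    (Metric.isOpen_ball (x := x) (ε := ρ / 2))
    (hcau.tendstoUniformlyOn_of_tendsto hl) (fun n y hy => ?_) (fun y hy => ?_)
    (Metric.mem_ball_self (half_pos hρ))
  · exact this.differentiableAt.differentiableWithinAt
  · have hy' := hsub (hball y hy (Metric.mem_ball_self (half_pos hρ)))
    exact ((hF n).differentiableAt (hU.mem_nhds hy'.2)).hasFDerivAt
  · have hy' := hsub (hball y hy (Metric.mem_ball_self (half_pos hρ)))
    exact hlim.tendsto_at hy'.1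

/-! ### The equation and its Wronskian -/

/-- Since d/dx = e^{-t} d/dt, the factor x^{-2} cancels and the singular point x = 0 disappears to
Re t = -∞: the coefficients are entire in t. -/
theorem isSolution_iff {m : ℕ} {a : Fin m → ℂ} {f : ℂ → ℂ} :
    IsSolution a f ↔ Differentiable ℂ f ∧
      ∀ t, deriv (deriv f) t = deriv f t + P a (Complex.exp t) * f t := by
  refine and_congr_right fun hf => forall_congr' fun t => ?_
  have h1 : DifferentiableAt ℂ (deriv f) t :=
    (hf.differentiableOn.deriv isOpen_univ).differentiableAt univ_mem
  have h2 : HasDerivAt (dx f) (-Complex.exp (-t) * deriv f t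
      + Complex.exp (-t) * deriv (deriv f) t) t := by
    have h3 : HasDerivAt (fun t : ℂ => Complex.exp (-t)) (-Complex.exp (-t)) t := by
      simpa using (hasDerivAt_neg t).cexp
    exact h3.mul h1.hasDerivAt
  have h4 : dx (dx f) t = Complex.exp (-t) * (-Complex.exp (-t) * deriv f t
      + Complex.exp (-t) * deriv (deriv f) t) := by
    rw [← h2.deriv]; rfl
  have hne : Complex.exp t ≠ 0 := Complex.exp_ne_zero t
  rw [h4, Complex.exp_neg]
  constructor
  · intro h
    field_simp at h
    linear_combination h
  · intro h
    rw [h]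
    field_simp
    ring

theorem differentiable_deriv {f : ℂ → ℂ} (hf : Differentiable ℂ f) :
    Differentiable ℂ (deriv f) := fun _ =>
  (hf.differentiableOn.deriv isOpen_univ).differentiableAt univ_mem

theorem IsSolution.deriv2 {m : ℕ} {a : Fin m → ℂ} {f : ℂ → ℂ} (hf : IsSolution a f) (t : ℂ) :
    deriv (deriv f) t = deriv f t + P a (Complex.exp t) * f t := (isSolution_iff.1 hf).2 t

theorem isSolution_of_hasDerivAt {m : ℕ} {a : Fin m → ℂ} {f g h : ℂ → ℂ}
    (hf : ∀ t, HasDerivAt f (g t) t) (hg : ∀ t, HasDerivAt g (h t) t)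
    (heq : ∀ t, h t = g t + P a (Complex.exp t) * f t) : IsSolution a f := by
  have hd : deriv f = g := funext fun t => (hf t).deriv
  refine isSolution_iff.2 ⟨fun t => (hf t).differentiableAt, fun t => ?_⟩
  rw [hd, (hg t).deriv, heq]

theorem IsSolution.linear_comb {m : ℕ} {a : Fin m → ℂ} {f g : ℂ → ℂ} (hf : IsSolution a f)
    (hg : IsSolution a g) (A B : ℂ) : IsSolution a (fun t => A * f t + B * g t) := by
  refine isSolution_of_hasDerivAt (g := fun t => A * deriv f t + B * deriv g t)
    (h := fun t => A * deriv (deriv f) t + B * deriv (deriv g) t) (fun t => ?_) (fun t => ?_) ?_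
  · exact ((hf.1 t).hasDerivAt.const_mul A).add ((hg.1 t).hasDerivAt.const_mul B)
  · exact ((differentiable_deriv hf.1 t).hasDerivAt.const_mul A).add
      ((differentiable_deriv hg.1 t).hasDerivAt.const_mul B)
  · intro t
    simp only [hf.deriv2, hg.deriv2]
    ring

theorem IsSolution.const_mul {m : ℕ} {a : Fin m → ℂ} {f : ℂ → ℂ} (hf : IsSolution a f) (A : ℂ) :
    IsSolution a (fun t => A * f t) := by
  simpa using hf.linear_comb hf A 0

/-- The Wronskian with respect to `x = e^t`. -/
noncomputable def wr (f g : ℂ → ℂ) (t : ℂ) : ℂ :=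
  Complex.exp (-t) * (f t * deriv g t - deriv f t * g t)

/-- The equation has no first-order term in x, so the Wronskian in x is constant; in t this is the
factor e^{-t} compensating the term f'. -/
theorem wr_const {m : ℕ} {a : Fin m → ℂ} {f g : ℂ → ℂ} (hf : IsSolution a f)
    (hg : IsSolution a g) (t u : ℂ) : wr f g t = wr f g u := by
  have key : ∀ t, HasDerivAt (wr f g) 0 t := by
    intro t
    have h3 : HasDerivAt (fun t : ℂ => Complex.exp (-t)) (-Complex.exp (-t)) t := by
      simpa using (hasDerivAt_neg t).cexp
    have h4 := ((hf.1 t).hasDerivAt.mul (differentiable_deriv hg.1 t).hasDerivAt).sub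
      ((differentiable_deriv hf.1 t).hasDerivAt.mul (hg.1 t).hasDerivAt)
    refine (h3.mul h4).congr_deriv ?_
    rw [hf.deriv2, hg.deriv2]
    simp only [Pi.sub_apply, Pi.mul_apply]
    ring
  exact is_const_of_deriv_eq_zero (fun t => (key t).differentiableAt)
    (fun t => (key t).deriv) t u

theorem wr_swap (f g : ℂ → ℂ) (t : ℂ) : wr f g t = -wr g f t := by
  simp only [wr]; ring

/-- Plücker identity for three solutions. -/
theorem wr_mul_eq {m : ℕ} {a : Fin m → ℂ} {f u v : ℂ → ℂ} (hf : IsSolution a f)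
    (hu : IsSolution a u) (hv : IsSolution a v) (t₀ t : ℂ) :
    wr u v t₀ * f t = wr f v t₀ * u t + wr u f t₀ * v t := by
  rw [wr_const hu hv t₀ t, wr_const hf hv t₀ t, wr_const hu hf t₀ t]
  simp only [wr]
  ring

theorem IsSolution.eq_linear_comb {m : ℕ} {a : Fin m → ℂ} {f u v : ℂ → ℂ} (hf : IsSolution a f)
    (hu : IsSolution a u) (hv : IsSolution a v) (t₀ : ℂ) (h : wr u v t₀ ≠ 0) (t : ℂ) :
    f t = wr f v t₀ / wr u v t₀ * u t + wr u f t₀ / wr u v t₀ * v t := by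
  have := wr_mul_eq hf hu hv t₀ t
  field_simp
  linear_combination this

/-! ### Power series with infinite radius of convergence -/

/-- The sum of the power series with coefficients `X n`. -/
noncomputable def PS (X : ℕ → ℂ) (x : ℂ) : ℂ := ∑' n, X n * x ^ n

/-- Coefficients decaying faster than any geometric sequence, uniformly over `V`. -/
def RapidOn {E : Type*} (V : Set E) (X : E → ℕ → ℂ) : Prop :=
  ∀ R : ℝ, 1 ≤ R → ∃ C : ℝ, 0 ≤ C ∧ ∀ a ∈ V, ∀ n, ‖X a n‖ * R ^ n ≤ C

/-- Coefficients decaying faster than any geometric sequence. -/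
def Rapid (X : ℕ → ℂ) : Prop := RapidOn (Set.univ : Set Unit) (fun _ => X)

theorem RapidOn.rapid {E : Type*} {V : Set E} {X : E → ℕ → ℂ} (h : RapidOn V X) {a : E}
    (ha : a ∈ V) : Rapid (X a) := fun R hR => by
  obtain ⟨C, hC, h⟩ := h R hR
  exact ⟨C, hC, fun _ _ => h a ha⟩

theorem RapidOn.mono {E : Type*} {V W : Set E} {X : E → ℕ → ℂ} (h : RapidOn V X) (hW : W ⊆ V) :
    RapidOn W X := fun R hR => by
  obtain ⟨C, hC, h⟩ := h R hR
  exact ⟨C, hC, fun a ha => h a (hW ha)⟩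

/-- The bound is available for every R, so a factor 2^n is absorbed by replacing R by 2R. In
particular polynomial factors in n do no harm. -/
theorem RapidOn.of_norm_le {E : Type*} {V : Set E} {X Y : E → ℕ → ℂ} (h : RapidOn V X) (B : ℝ)
    (hY : ∀ a ∈ V, ∀ n, ‖Y a n‖ ≤ B * 2 ^ n * ‖X a n‖) : RapidOn V Y := fun R hR => by
  obtain ⟨C, hC, h⟩ := h (2 * R) (by linarith)
  refine ⟨|B| * C, by positivity, fun a ha n => ?_⟩
  calc ‖Y a n‖ * R ^ n ≤ (|B| * 2 ^ n * ‖X a n‖) * R ^ n := by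
        gcongr
        refine (hY a ha n).trans ?_
        gcongr
        exact le_abs_self B
    _ = |B| * (‖X a n‖ * (2 * R) ^ n) := by rw [mul_pow]; ring
    _ ≤ |B| * C := by gcongr; exact h a ha n

theorem RapidOn.nat_mul {E : Type*} {V : Set E} {X : E → ℕ → ℂ} (h : RapidOn V X) :
    RapidOn V (fun a n => n * X a n) := h.of_norm_le 1 fun a _ n => by
  rw [norm_mul, one_mul]
  gcongr
  rw [Complex.norm_natCast]
  exact_mod_cast Nat.lt_two_pow_self.le

theorem RapidOn.const_mul {E : Type*} {V : Set E} {X : E → ℕ → ℂ} (h : RapidOn V X) (c : ℂ) :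
    RapidOn V (fun a n => c * X a n) := h.of_norm_le ‖c‖ fun a _ n => by
  rw [norm_mul, mul_assoc]
  gcongr
  have : (1 : ℝ) ≤ 2 ^ n := one_le_pow₀ (by norm_num)
  nlinarith [norm_nonneg (X a n)]

theorem RapidOn.add {E : Type*} {V : Set E} {X Y : E → ℕ → ℂ} (h : RapidOn V X)
    (h' : RapidOn V Y) : RapidOn V (fun a n => X a n + Y a n) := fun R hR => by
  obtain ⟨C, hC, h⟩ := h R hR
  obtain ⟨C', hC', h'⟩ := h' R hR
  refine ⟨C + C', by positivity, fun a ha n => ?_⟩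
  calc _ ≤ (‖X a n‖ + ‖Y a n‖) * R ^ n := by gcongr; exact norm_add_le _ _
    _ ≤ _ := by rw [add_mul]; exact add_le_add (h a ha n) (h' a ha n)

/-- The coefficients of `x ^ j` times a power series. -/
def shiftSeq (j : ℕ) (X : ℕ → ℂ) (n : ℕ) : ℂ := if j ≤ n then X (n - j) else 0

theorem RapidOn.shift {E : Type*} {V : Set E} {X : E → ℕ → ℂ} (h : RapidOn V X) (j : ℕ) :
    RapidOn V (fun a => shiftSeq j (X a)) := fun R hR => by
  obtain ⟨C, hC, h⟩ := h R hR
  refine ⟨C * R ^ j, by positivity, fun a ha n => ?_⟩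
  simp only [shiftSeq]
  split_ifs with hj
  · obtain ⟨k, rfl⟩ := Nat.exists_eq_add_of_le hj
    rw [Nat.add_sub_cancel_left, pow_add, mul_comm (R ^ j), ← mul_assoc]
    gcongr
    exact h a ha k
  · simp only [norm_zero, zero_mul]
    positivity

theorem rapidOn_single {E : Type*} (V : Set E) (η : ℂ) :
    RapidOn V (fun _ n => if n = 0 then η else 0) := fun R hR => by
  refine ⟨‖η‖, norm_nonneg _, fun a _ n => ?_⟩
  dsimp only
  split_ifs with h
  · simp [h]
  · simp

/-- Taking R ≥ 2r in the definition gives one geometric majorant valid for all parameters and all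
|x| ≤ r; summability, termwise differentiation and holomorphy in the parameters all rest on it. -/
theorem RapidOn.norm_term_le {E : Type*} {V : Set E} {X : E → ℕ → ℂ} (h : RapidOn V X) (r : ℝ) :
    ∃ C : ℝ, 0 ≤ C ∧ ∀ a ∈ V, ∀ x : ℂ, ‖x‖ ≤ r → ∀ n, ‖X a n * x ^ n‖ ≤ C * (1 / 2) ^ n := by
  obtain ⟨C, hC, h⟩ := h (max 1 (2 * r)) (le_max_left _ _)
  refine ⟨C, hC, fun a ha x hx n => ?_⟩
  have h1 : ‖x‖ ≤ max 1 (2 * r) * (1 / 2) := by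
    have := le_max_right 1 (2 * r)
    linarith
  calc ‖X a n * x ^ n‖ = ‖X a n‖ * ‖x‖ ^ n := by rw [norm_mul, norm_pow]
    _ ≤ ‖X a n‖ * (max 1 (2 * r) * (1 / 2)) ^ n := by gcongr
    _ = (‖X a n‖ * max 1 (2 * r) ^ n) * (1 / 2) ^ n := by rw [mul_pow]; ring
    _ ≤ _ := by gcongr; exact h a ha n

/-! ### Sums, shifts and derivatives of entire power series -/

theorem Rapid.add {X Y : ℕ → ℂ} (hX : Rapid X) (hY : Rapid Y) : Rapid (fun n => X n + Y n) :=
  RapidOn.add hX hY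

theorem Rapid.const_mul {X : ℕ → ℂ} (hX : Rapid X) (c : ℂ) : Rapid (fun n => c * X n) :=
  RapidOn.const_mul hX c

theorem Rapid.nat_mul {X : ℕ → ℂ} (hX : Rapid X) : Rapid (fun n => n * X n) :=
  RapidOn.nat_mul hX

theorem summable_geometric_half (C : ℝ) : Summable fun n : ℕ => C * (1 / 2 : ℝ) ^ n :=
  (summable_geometric_of_lt_one (by norm_num) (by norm_num)).mul_left C

theorem Rapid.summable {X : ℕ → ℂ} (h : Rapid X) (x : ℂ) : Summable fun n => X n * x ^ n := by
  obtain ⟨C, _, hb⟩ := RapidOn.norm_term_le h ‖x‖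
  exact Summable.of_norm_bounded (summable_geometric_half C)
    fun n => hb () trivial x le_rfl n

theorem PS_zero (X : ℕ → ℂ) : PS X 0 = X 0 := by
  rw [PS, tsum_eq_single 0]
  · simp
  · intro n hn
    simp [hn]

theorem Rapid.PS_add {X Y : ℕ → ℂ} (h : Rapid X) (h' : Rapid Y) (x : ℂ) :
    PS (fun n => X n + Y n) x = PS X x + PS Y x := by
  simp only [PS, add_mul]
  exact (h.summable x).tsum_add (h'.summable x)

theorem PS_const_mul (X : ℕ → ℂ) (c x : ℂ) : PS (fun n => c * X n) x = c * PS X x := by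
  simp only [PS, mul_assoc]
  exact tsum_mul_left

theorem Rapid.PS_shift {X : ℕ → ℂ} (h : Rapid X) (j : ℕ) (x : ℂ) :
    PS (shiftSeq j X) x = x ^ j * PS X x := by
  have hs : Summable fun n => shiftSeq j X n * x ^ n :=
    Rapid.summable (RapidOn.shift h j) x
  rw [PS, ← hs.sum_add_tsum_nat_add j, PS, ← tsum_mul_left]
  rw [Finset.sum_eq_zero, zero_add]
  · refine tsum_congr fun n => ?_
    simp only [shiftSeq, Nat.le_add_left, if_true, Nat.add_sub_cancel, pow_add]
    ring
  · intro i hi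
    have : ¬ j ≤ i := by simpa using hi
    simp [shiftSeq, this]

/-- The coefficients of the derivative. -/
def derivSeq (X : ℕ → ℂ) (n : ℕ) : ℂ := (n + 1) * X (n + 1)

theorem Rapid.derivSeq {X : ℕ → ℂ} (h : Rapid X) : Rapid (derivSeq X) := fun R hR => by
  obtain ⟨C, hC, h⟩ := RapidOn.nat_mul h R hR
  refine ⟨C, hC, fun a ha n => ?_⟩
  refine le_trans ?_ (h a ha (n + 1))
  simp only [ZeroInf.derivSeq]
  push_cast
  gcongr
  exact n.le_succ

theorem Rapid.hasDerivAt {X : ℕ → ℂ} (h : Rapid X) (x : ℂ) :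
    HasDerivAt (PS X) (PS (ZeroInf.derivSeq X) x) x := by
  obtain ⟨C, hC, hb⟩ := RapidOn.norm_term_le h.derivSeq (‖x‖ + 1)
  -- The n-th term of the differentiated series is the (n-1)-st term of `derivSeq`; this index shift
  -- costs the factor 2.
  have hb' : ∀ n : ℕ, ∀ y ∈ Metric.ball (0 : ℂ) (‖x‖ + 1),
      ‖X n * (n * y ^ (n - 1))‖ ≤ (2 * C) * (1 / 2) ^ n := by
    intro n y hy
    cases n with
    | zero => simp [hC]
    | succ n =>
      have := hb () trivial y (by simpa using (Metric.mem_ball.1 hy).le) n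
      simp only [ZeroInf.derivSeq] at this
      rw [pow_succ, Nat.add_sub_cancel]
      push_cast
      calc _ = ‖(n + 1) * X (n + 1) * y ^ n‖ := by congr 1; ring
        _ ≤ _ := this
        _ = _ := by ring
  have := hasDerivAt_tsum_of_isPreconnected (summable_geometric_half (2 * C))
    Metric.isOpen_ball (convex_ball (0 : ℂ) (‖x‖ + 1)).isPreconnected
    (g := fun n y => X n * y ^ n) (g' := fun n y => X n * (n * y ^ (n - 1)))
    (fun n y _ => (hasDerivAt_pow n y).const_mul (X n)) hb'
    (Metric.mem_ball_self (by positivity)) (h.summable 0)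
    (show x ∈ Metric.ball 0 (‖x‖ + 1) by simp)
  refine this.congr_deriv ?_
  have hs : Summable fun n : ℕ => X n * (n * x ^ (n - 1)) :=
    Summable.of_norm_bounded (summable_geometric_half (2 * C))
      fun n => hb' n x (by simp)
  rw [hs.tsum_eq_zero_add, PS]
  simp only [Nat.cast_zero, zero_mul, mul_zero, zero_add, Nat.add_sub_cancel, ZeroInf.derivSeq]
  refine tsum_congr fun n => ?_
  push_cast
  ring

theorem Rapid.differentiable {X : ℕ → ℂ} (h : Rapid X) : Differentiable ℂ (PS X) :=
  fun x => (h.hasDerivAt x).differentiableAt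

theorem Rapid.mul_PS_derivSeq {X : ℕ → ℂ} (h : Rapid X) (x : ℂ) :
    x * PS (ZeroInf.derivSeq X) x = PS (fun n => n * X n) x := by
  have := h.derivSeq.PS_shift 1 x
  rw [pow_one] at this
  rw [← this]
  congr 1
  ext n
  cases n <;> simp [shiftSeq, ZeroInf.derivSeq]

theorem Rapid.hasDerivAt_exp {X : ℕ → ℂ} (h : Rapid X) (t : ℂ) :
    HasDerivAt (fun t => PS X (Complex.exp t)) (PS (fun n => n * X n) (Complex.exp t)) t := by
  refine ((h.hasDerivAt (Complex.exp t)).comp t (Complex.hasDerivAt_exp t)).congr_deriv ?_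
  rw [← h.mul_PS_derivSeq, mul_comm]

theorem Rapid.iteratedDeriv_zero {X : ℕ → ℂ} (h : Rapid X) (n : ℕ) :
    iteratedDeriv n (PS X) 0 = n.factorial * X n := by
  induction n generalizing X with
  | zero => simp [PS_zero]
  | succ n ih =>
    have hd : deriv (PS X) = PS (ZeroInf.derivSeq X) := funext fun x => (h.hasDerivAt x).deriv
    rw [iteratedDeriv_succ', hd, ih h.derivSeq, Nat.factorial_succ]
    simp only [ZeroInf.derivSeq]
    push_cast
    ring

/-! ### Parameter dependence -/

/-- Coefficients that are holomorphic on `U` and decay fast, locally uniformly on `U`. -/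
def HolRapid {E : Type*} [NormedAddCommGroup E] [NormedSpace ℂ E] (U : Set E)
    (X : E → ℕ → ℂ) : Prop :=
  (∀ n, DifferentiableOn ℂ (fun a => X a n) U) ∧ ∀ a ∈ U, ∃ V ∈ 𝓝 a, RapidOn V X

theorem HolRapid.rapid {E : Type*} [NormedAddCommGroup E] [NormedSpace ℂ E] {U : Set E}
    {X : E → ℕ → ℂ} (h : HolRapid U X) {a : E} (ha : a ∈ U) : Rapid (X a) := by
  obtain ⟨V, hV, hr⟩ := h.2 a ha
  exact hr.rapid (mem_of_mem_nhds hV)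

theorem HolRapid.nat_mul {E : Type*} [NormedAddCommGroup E] [NormedSpace ℂ E] {U : Set E}
    {X : E → ℕ → ℂ} (h : HolRapid U X) : HolRapid U (fun a n => n * X a n) :=
  ⟨fun n => (h.1 n).const_mul _, fun a ha =>
    let ⟨V, hV, hr⟩ := h.2 a ha
    ⟨V, hV, hr.nat_mul⟩⟩

/-- The partial sums are holomorphic in the parameters and converge locally uniformly by the
Weierstrass test. -/
theorem HolRapid.differentiableOn {E : Type*} [NormedAddCommGroup E] [NormedSpace ℂ E] {U : Set E}
    (hU : IsOpen U) {X : E → ℕ → ℂ} (h : HolRapid U X) (x : ℂ) :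
    DifferentiableOn ℂ (fun a => PS (X a) x) U := by
  refine differentiableOn_of_tendstoUniformlyOn_nhds hU
    (F := fun N a => ∑ n ∈ Finset.range N, X a n * x ^ n) (fun N => ?_) (fun a ha => ?_)
  · exact DifferentiableOn.fun_sum fun n _ => (h.1 n).mul_const _
  · obtain ⟨V, hV, hr⟩ := h.2 a ha
    obtain ⟨C, hC, hb⟩ := hr.norm_term_le ‖x‖
    exact ⟨V, hV, tendstoUniformlyOn_tsum_nat (summable_geometric_half C)
      fun n a ha => hb a ha x le_rfl n⟩

/-! ### Recursions of Frobenius type -/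

/-- The solution of the recursion `X_n = ε_n ∑_{j < n} c_{n-j} X_j + e_n`. -/
noncomputable def frob (ε c e : ℕ → ℂ) (n : ℕ) : ℂ :=
  ε n * ∑ j : Fin n, c (n - j) * frob ε c e j + e n

theorem frob_eq (ε c e : ℕ → ℂ) (n : ℕ) :
    frob ε c e n = ε n * ∑ j ∈ Finset.range n, c (n - j) * frob ε c e j + e n := by
  rw [frob, ← Fin.sum_univ_eq_sum_range (fun j => c (n - j) * frob ε c e j)]

theorem sum_range_sub_le {g : ℕ → ℝ} {m : ℕ} (hg : ∀ n, 0 ≤ g n) (hm : ∀ n, m < n → g n = 0)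
    (n : ℕ) : ∑ j ∈ Finset.range n, g (n - j) ≤ ∑ j ∈ Finset.range (m + 1), g j := by
  have h1 : ∑ j ∈ Finset.range n, g (n - j) = ∑ j ∈ Finset.range n, g (j + 1) := by
    rw [← Finset.sum_range_reflect]
    refine Finset.sum_congr rfl fun j hj => ?_
    rw [Finset.mem_range] at hj
    congr 1
    omega
  have h2 : ∑ j ∈ Finset.range n, g (j + 1) ≤ ∑ j ∈ Finset.range (n + 1), g j := by
    rw [Finset.sum_range_succ']
    linarith [hg 0]
  have h3 : ∑ j ∈ Finset.range (n + 1), g j ≤ ∑ j ∈ Finset.range (m + 1), g j := by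
    have h4 : ∑ j ∈ Finset.range (n + 1), g j
        = ∑ j ∈ (Finset.range (n + 1)).filter (· < m + 1), g j := by
      rw [Finset.sum_filter]
      refine Finset.sum_congr rfl fun j _ => ?_
      split_ifs with h
      · rfl
      · exact hm j (by omega)
    rw [h4]
    refine Finset.sum_le_sum_of_subset_of_nonneg (fun j hj => ?_) fun j _ _ => hg j
    simp only [Finset.mem_filter] at hj
    exact Finset.mem_range.2 hj.2
  linarith

/-- With x_n = |X_n| R^n and Q = |A| ∑ |B| R^k, the recursion gives x_n ≤ (Q/n) max_{j<n} x_j + C.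
Once n ≥ 2Q the factor is at most 1/2 and the bound stops growing; this holds for every R because
the recursion involves only finitely many c_k. -/
theorem rapidOn_frob {E : Type*} {V : Set E} {ε c e : E → ℕ → ℂ} {m : ℕ} {A B : ℝ}
    (hε : ∀ a ∈ V, ∀ n : ℕ, ‖ε a n‖ * n ≤ A) (hc : ∀ a ∈ V, ∀ k, ‖c a k‖ ≤ B)
    (hcm : ∀ a ∈ V, ∀ k, m < k → c a k = 0) (he : RapidOn V e) :
    RapidOn V (fun a => frob (ε a) (c a) (e a)) := by
  intro R hR
  obtain ⟨C, hC, he⟩ := he R hR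
  have hR0 : (0 : ℝ) ≤ R := by linarith
  set Q : ℝ := |A| * ∑ k ∈ Finset.range (m + 1), |B| * R ^ k with hQdef
  have hQ : 0 ≤ Q := by positivity
  obtain ⟨n₀, hn₀⟩ := exists_nat_ge (2 * Q)
  -- The bound grows by a factor 1 + Q at each of the first n₀ ≥ 2Q indices and is then stationary;
  -- the factor 2 keeps C ≤ b n / 2, which closes the induction beyond n₀.
  set b : ℕ → ℝ := fun n => 2 * C * (1 + Q) ^ (min n n₀) with hb
  have hbmono : Monotone b := fun i j hij => by
    simp only [hb]
    gcongr
    linarith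
  have hbpos : ∀ n, C ≤ b n / 2 := fun n => by
    have : (1 : ℝ) ≤ (1 + Q) ^ (min n n₀) := one_le_pow₀ (by linarith)
    simp only [hb]
    nlinarith
  refine ⟨2 * C * (1 + Q) ^ n₀, by positivity, fun a ha n => ?_⟩
  have hmain : ‖frob (ε a) (c a) (e a) n‖ * R ^ n ≤ b n := by
    induction n using Nat.strong_induction_on with
    | _ n ih =>
    rcases Nat.eq_zero_or_pos n with rfl | hn
    · rw [frob_eq, Finset.range_zero, Finset.sum_empty, mul_zero, zero_add]
      linarith [he a ha 0, hbpos 0]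
    · have hbn : 0 ≤ b (n - 1) := by linarith [hbpos (n - 1)]
      have hsum : ‖∑ j ∈ Finset.range n, c a (n - j) * frob (ε a) (c a) (e a) j‖ * R ^ n
          ≤ (∑ k ∈ Finset.range (m + 1), |B| * R ^ k) * b (n - 1) := by
        calc _ ≤ (∑ j ∈ Finset.range n, ‖c a (n - j) * frob (ε a) (c a) (e a) j‖) * R ^ n := by
              gcongr; exact norm_sum_le _ _
          _ = ∑ j ∈ Finset.range n, (‖c a (n - j)‖ * R ^ (n - j)) *
                (‖frob (ε a) (c a) (e a) j‖ * R ^ j) := by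
              rw [Finset.sum_mul]
              refine Finset.sum_congr rfl fun j hj => ?_
              rw [Finset.mem_range] at hj
              have : R ^ n = R ^ (n - j) * R ^ j := by rw [← pow_add]; congr 1; omega
              rw [norm_mul, this]
              ring
          _ ≤ ∑ j ∈ Finset.range n, (‖c a (n - j)‖ * R ^ (n - j)) * b (n - 1) := by
              refine Finset.sum_le_sum fun j hj => ?_
              rw [Finset.mem_range] at hj
              gcongr
              exact (ih j hj).trans (hbmono (by omega))
          _ = (∑ j ∈ Finset.range n, ‖c a (n - j)‖ * R ^ (n - j)) * b (n - 1) := by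
              rw [Finset.sum_mul]
          _ ≤ (∑ k ∈ Finset.range (m + 1), ‖c a k‖ * R ^ k) * b (n - 1) := by
              gcongr
              exact sum_range_sub_le (g := fun k => ‖c a k‖ * R ^ k)
                (fun k => by positivity) (fun k hk => by simp [hcm a ha k hk]) n
          _ ≤ _ := by
              gcongr with k
              exact (hc a ha k).trans (le_abs_self B)
      have hn1 : (1 : ℝ) ≤ n := by exact_mod_cast hn
      have hεn : ‖ε a n‖ ≤ |A| / n := by
        rw [le_div_iff₀ (by linarith)]
        exact (hε a ha n).trans (le_abs_self A)
      have h1 : ‖frob (ε a) (c a) (e a) n‖ * R ^ n ≤ Q / n * b (n - 1) + C := by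
        rw [frob_eq]
        calc _ ≤ (‖ε a n‖ * ‖∑ j ∈ Finset.range n, c a (n - j) * frob (ε a) (c a) (e a) j‖
              + ‖e a n‖) * R ^ n := by
              gcongr
              exact (norm_add_le _ _).trans (by rw [norm_mul])
          _ = ‖ε a n‖ * (‖∑ j ∈ Finset.range n, c a (n - j) * frob (ε a) (c a) (e a) j‖ * R ^ n)
              + ‖e a n‖ * R ^ n := by ring
          _ ≤ |A| / n * ((∑ k ∈ Finset.range (m + 1), |B| * R ^ k) * b (n - 1)) + C := by
              gcongr
              exact he a ha n
          _ = _ := by rw [hQdef]; ring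
      refine h1.trans ?_
      rcases le_or_gt n n₀ with hle | hgt
      · have h2 : Q / n ≤ Q := div_le_self hQ hn1
        have h3 : b n = (1 + Q) * b (n - 1) := by
          simp only [hb]
          rw [min_eq_left hle, min_eq_left (by omega)]
          obtain ⟨k, rfl⟩ := Nat.exists_eq_add_of_le' hn
          simp only [Nat.add_sub_cancel, pow_succ]
          ring
        rw [h3]
        have := hbpos (n - 1)
        nlinarith
      · have h2 : Q / n ≤ 1 / 2 := by
          rw [div_le_iff₀ (by linarith)]
          have : (n₀ : ℝ) ≤ n := by exact_mod_cast hgt.le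
          linarith
        have h3 : b (n - 1) ≤ b n := hbmono (by omega)
        have := hbpos n
        nlinarith
  refine hmain.trans ?_
  simp only [hb]
  gcongr
  · linarith
  · exact min_le_right _ _

/-- Each X_n is a finite algebraic expression in holomorphic functions. Near a point the c_k are
bounded uniformly in k, as only those with k ≤ m can be nonzero. -/
theorem holRapid_frob {E : Type*} [NormedAddCommGroup E] [NormedSpace ℂ E] {U : Set E}
    (hU : IsOpen U) {ε c e : E → ℕ → ℂ} {m : ℕ}
    (hε : ∀ n, DifferentiableOn ℂ (fun a => ε a n) U)
    (hε' : ∀ a ∈ U, ∃ V ∈ 𝓝 a, ∃ A : ℝ, ∀ b ∈ V, ∀ n : ℕ, ‖ε b n‖ * n ≤ A)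
    (hc : ∀ k, DifferentiableOn ℂ (fun a => c a k) U)
    (hcm : ∀ a, ∀ k, m < k → c a k = 0) (he : HolRapid U e) :
    HolRapid U (fun a => frob (ε a) (c a) (e a)) := by
  refine ⟨fun n => ?_, fun a ha => ?_⟩
  · induction n using Nat.strong_induction_on with
    | _ n ih =>
    rw [show (fun a => frob (ε a) (c a) (e a) n) = fun a => ε a n * ∑ j ∈ Finset.range n,
      c a (n - j) * frob (ε a) (c a) (e a) j + e a n from funext fun a => frob_eq _ _ _ _]
    refine ((hε n).mul (DifferentiableOn.fun_sum fun j hj => ?_)).add (he.1 n)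
    exact (hc _).mul (ih j (Finset.mem_range.1 hj))
  · obtain ⟨V₁, hV₁, A, hA⟩ := hε' a ha
    obtain ⟨V₂, hV₂, he₂⟩ := he.2 a ha
    have h3 : ∀ᶠ b in 𝓝 a, ∀ k ∈ Finset.range (m + 1), ‖c b k‖ < ‖c a k‖ + 1 := by
      rw [eventually_all_finset]
      intro k _
      have : ContinuousAt (fun b => ‖c b k‖) a :=
        ((hc k).continuousOn.continuousAt (hU.mem_nhds ha)).norm
      exact this.eventually_lt continuousAt_const (by linarith)
    refine ⟨V₁ ∩ V₂ ∩ {b | ∀ k ∈ Finset.range (m + 1), ‖c b k‖ < ‖c a k‖ + 1},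
      inter_mem (inter_mem hV₁ hV₂) h3, ?_⟩
    refine rapidOn_frob (A := A) (B := ∑ k ∈ Finset.range (m + 1), (‖c a k‖ + 1)) (m := m)
      (fun b hb => hA b hb.1.1) (fun b hb k => ?_) (fun b _ => hcm b)
      (he₂.mono fun b hb => hb.1.2)
    by_cases hk : k ∈ Finset.range (m + 1)
    · exact (hb.2 k hk).le.trans (Finset.single_le_sum (f := fun k => ‖c a k‖ + 1)
        (fun i _ => by positivity) hk)
    · rw [hcm b k (by simpa using hk)]
      simp only [norm_zero]
      positivity

/-! ### Frobenius solutions at the origin -/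

/-- The coefficient of `x ^ k` in `P_m(x, a)`. -/
noncomputable def cc {m : ℕ} (a : Fin m → ℂ) (k : ℕ) : ℂ := if k ≤ m then coef a (m - k) else 0

theorem cc_of_lt {m : ℕ} (a : Fin m → ℂ) {k : ℕ} (hk : m < k) : cc a k = 0 := by
  simp [cc, hk]

theorem rapid_cc {m : ℕ} (a : Fin m → ℂ) : Rapid (cc a) := fun R hR => by
  refine ⟨∑ k ∈ Finset.range (m + 1), ‖cc a k‖ * R ^ k, by positivity, fun _ _ n => ?_⟩
  by_cases hn : n ∈ Finset.range (m + 1)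
  · exact Finset.single_le_sum (f := fun k => ‖cc a k‖ * R ^ k) (fun i _ => by positivity) hn
  · dsimp only
    rw [cc_of_lt a (by simpa using hn)]
    simp only [norm_zero, zero_mul]
    positivity

theorem PS_cc {m : ℕ} (a : Fin m → ℂ) (x : ℂ) : PS (cc a) x = P a x := by
  rw [PS, tsum_eq_sum (s := Finset.range (m + 1)), P, ← Finset.sum_range_reflect]
  · refine Finset.sum_congr rfl fun k hk => ?_
    rw [Finset.mem_range] at hk
    rw [cc, if_pos (by omega)]
    congr 2
    omega
  · intro n hn
    rw [cc_of_lt a (by simpa using hn), zero_mul]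

theorem Rapid.PS_mul {X Y : ℕ → ℂ} (hX : Rapid X) (hY : Rapid Y) (x : ℂ) :
    PS X x * PS Y x = PS (fun n => ∑ k ∈ Finset.range (n + 1), X k * Y (n - k)) x := by
  rw [PS, PS, tsum_mul_tsum_eq_tsum_sum_range_of_summable_norm (hX.summable x).norm
    (hY.summable x).norm, PS]
  refine tsum_congr fun n => ?_
  rw [Finset.sum_mul]
  refine Finset.sum_congr rfl fun k hk => ?_
  rw [Finset.mem_range] at hk
  have : x ^ n = x ^ k * x ^ (n - k) := by rw [← pow_add]; congr 1; omega
  rw [this]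
  ring

/-- Functions x^ρ (ln x · Z(x) + Y(x)) are stable under d/dt, which acts on coefficients by ρ + n
and adds Z to the part without logarithm. -/
theorem hasDerivAt_exp_log {Z Y : ℕ → ℂ} (hZ : Rapid Z) (hY : Rapid Y) (ρ t : ℂ) :
    HasDerivAt (fun t => Complex.exp (ρ * t) * (t * PS Z (Complex.exp t) + PS Y (Complex.exp t)))
      (Complex.exp (ρ * t) * (t * PS (fun n => ρ * Z n + n * Z n) (Complex.exp t)
        + PS (fun n => Z n + (ρ * Y n + n * Y n)) (Complex.exp t))) t := by
  have h1 : HasDerivAt (fun t => Complex.exp (ρ * t)) (Complex.exp (ρ * t) * ρ) t := by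
    simpa using ((hasDerivAt_id t).const_mul ρ).cexp
  have h2 : HasDerivAt (fun t => t * PS Z (Complex.exp t) + PS Y (Complex.exp t)) _ t :=
    ((hasDerivAt_id' t).mul (hZ.hasDerivAt_exp t)).add (hY.hasDerivAt_exp t)
  refine (h1.mul h2).congr_deriv ?_
  rw [(hZ.const_mul ρ).PS_add hZ.nat_mul, hZ.PS_add ((hY.const_mul ρ).add hY.nat_mul),
    (hY.const_mul ρ).PS_add hY.nat_mul, PS_const_mul, PS_const_mul]
  ring

theorem Rapid.mul_P {m : ℕ} {a : Fin m → ℂ} {X W : ℕ → ℂ} (hX : Rapid X)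
    (h : ∀ n : ℕ, W n = ∑ j ∈ Finset.range n, cc a (n - j) * X j + cc a 0 * X n) (x : ℂ) :
    PS W x = P a x * PS X x := by
  rw [← PS_cc, mul_comm, hX.PS_mul (rapid_cc a)]
  congr 1
  ext n
  rw [h, Finset.sum_range_succ, Nat.sub_self, mul_comm (X n)]
  congr 1
  exact Finset.sum_congr rfl fun _ _ => mul_comm _ _

/-- Comparison of coefficients: ρ is a root of the indicial equation, and (ρ+n)² - (ρ+n) - (ρ² - ρ)
= n(n + 2ρ - 1). The factor 2n + 2ρ - 1 in front of Z_n is the ρ-derivative of the indicial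
polynomial at ρ + n, produced by differentiating ln x. -/
theorem isSolution_exp_log {m : ℕ} {a : Fin m → ℂ} {Z Y : ℕ → ℂ} (hZ : Rapid Z) (hY : Rapid Y)
    {ρ : ℂ} (hρ : ρ ^ 2 - ρ = cc a 0)
    (h1 : ∀ n : ℕ, n * (n + (2 * ρ - 1)) * Z n = ∑ j ∈ Finset.range n, cc a (n - j) * Z j)
    (h2 : ∀ n : ℕ, n * (n + (2 * ρ - 1)) * Y n + (2 * n + (2 * ρ - 1)) * Z n
      = ∑ j ∈ Finset.range n, cc a (n - j) * Y j) :
    IsSolution a (fun t => Complex.exp (ρ * t) *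
      (t * PS Z (Complex.exp t) + PS Y (Complex.exp t))) := by
  have hZ' : Rapid (fun n => ρ * Z n + n * Z n) := (hZ.const_mul ρ).add hZ.nat_mul
  have hY' : Rapid (fun n => Z n + (ρ * Y n + n * Y n)) :=
    hZ.add ((hY.const_mul ρ).add hY.nat_mul)
  refine isSolution_of_hasDerivAt (hasDerivAt_exp_log hZ hY ρ) (hasDerivAt_exp_log hZ' hY' ρ)
    fun t => ?_
  generalize Complex.exp t = x
  have hZ'' : Rapid fun n => ρ * (ρ * Z n + n * Z n) + n * (ρ * Z n + n * Z n) :=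
    (hZ'.const_mul ρ).add hZ'.nat_mul
  have e1 : PS (fun n => (ρ * (ρ * Z n + n * Z n) + n * (ρ * Z n + n * Z n))
      + (-1 : ℂ) * (ρ * Z n + n * Z n)) x = P a x * PS Z x :=
    hZ.mul_P (fun n => by rw [← h1, ← hρ]; ring) x
  have hY'' : Rapid fun n => (ρ * Z n + n * Z n) + (ρ * (Z n + (ρ * Y n + n * Y n))
        + n * (Z n + (ρ * Y n + n * Y n))) :=
    hZ'.add ((hY'.const_mul ρ).add hY'.nat_mul)
  have e2 : PS (fun n => ((ρ * Z n + n * Z n) + (ρ * (Z n + (ρ * Y n + n * Y n))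
        + n * (Z n + (ρ * Y n + n * Y n)))) + (-1 : ℂ) * (Z n + (ρ * Y n + n * Y n))) x
      = P a x * PS Y x :=
    hY.mul_P (fun n => by rw [← h2, ← hρ]; ring) x
  rw [hZ''.PS_add (hZ'.const_mul (-1)), PS_const_mul] at e1
  rw [hY''.PS_add (hY'.const_mul (-1)), PS_const_mul] at e2
  linear_combination Complex.exp (ρ * t) * (t * e1 + e2)

/-! ### The series of f₁ and its dependence on (a', p) -/

theorem cc_full_zero {m : ℕ} (hm : 1 ≤ m) (a' : Fin (m - 1) → ℂ) (p : ℂ) :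
    cc (full m a' p) 0 = (p ^ 2 - 1) / 4 := by
  obtain ⟨n, rfl⟩ := Nat.exists_eq_add_of_le' hm
  simp [cc, coef, full]

theorem full_neg (m : ℕ) (a' : Fin (m - 1) → ℂ) (p : ℂ) : full m a' (-p) = full m a' p := by
  ext i; simp [full]

theorem differentiable_full (m : ℕ) :
    Differentiable ℂ fun q : (Fin (m - 1) → ℂ) × ℂ => full m q.1 q.2 := by
  rw [differentiable_pi]
  intro i
  by_cases h : i.val < m - 1
  · simp only [full, h, dif_pos]
    fun_prop
  · simp only [full, h, dif_neg, not_false_eq_true]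
    fun_prop

theorem differentiable_coef {m : ℕ} (k : ℕ) :
    Differentiable ℂ fun a : Fin m → ℂ => coef a k := by
  cases k with
  | zero => simp [coef]
  | succ k =>
    by_cases h : k < m
    · simp only [coef, h, dif_pos]
      fun_prop
    · simp [coef, h]

theorem differentiable_cc {m : ℕ} (k : ℕ) :
    Differentiable ℂ fun a : Fin m → ℂ => cc a k := by
  by_cases h : k ≤ m
  · simp only [cc, h, if_true]
    exact differentiable_coef _
  · simp [cc, h]

/-- The coefficients of `g_1`. -/
noncomputable def frobSeq {m : ℕ} (a : Fin m → ℂ) (p : ℂ) : ℕ → ℂ :=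
  frob (fun n => ((n : ℂ) * (n + p))⁻¹) (cc a) (fun n => if n = 0 then 1 else 0)

theorem frobSeq_zero {m : ℕ} (a : Fin m → ℂ) (p : ℂ) : frobSeq a p 0 = 1 := by
  rw [frobSeq, frob_eq]; simp

theorem isOpen_admissible : IsOpen admissible := by
  have : admissible = (((↑) : ℕ → ℂ) '' {n | 1 ≤ n})ᶜ.preimage (fun p : ℂ => -p) := by
    ext p
    simp only [admissible, Set.mem_ofPred_eq, Set.mem_preimage, Set.mem_compl_iff, Set.mem_image,
      not_exists, not_and]
    refine forall_congr' fun n => forall_congr' fun _ => not_congr ?_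
    constructor <;> intro h
    · rw [h]; ring
    · rw [h]; ring
  rw [this]
  refine IsOpen.preimage continuous_neg ?_
  rw [isOpen_compl_iff]
  have h1 : Topology.IsClosedEmbedding ((↑) : ℕ → ℂ) := by
    have := Complex.isometry_ofReal.isClosedEmbedding.comp Nat.isClosedEmbedding_coe_real
    exact this
  exact h1.isClosedMap _ (isClosed_discrete _)

/-- Near an admissible p the distance to the negative integers is bounded below; this is the decay
of the recursion factor required by `holRapid_frob`. -/
theorem exists_norm_inv_mul_le {p : ℂ} (hp : p ∈ admissible) :
    ∃ V ∈ 𝓝 p, ∃ A : ℝ, ∀ b ∈ V, ∀ n : ℕ, ‖((n : ℂ) * (n + b))⁻¹‖ * n ≤ A := by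
  obtain ⟨δ, hδ, hb⟩ := Metric.isOpen_iff.1 isOpen_admissible p hp
  refine ⟨Metric.ball p (δ / 2), Metric.ball_mem_nhds _ (by positivity), (δ / 2)⁻¹,
    fun b hb' n => ?_⟩
  rcases Nat.eq_zero_or_pos n with rfl | hn
  · simp; positivity
  have h1 : δ / 2 ≤ ‖(n : ℂ) + b‖ := by
    have h2 : (-(n : ℂ)) ∉ Metric.ball p δ := fun h => hb h n hn rfl
    rw [Metric.mem_ball, dist_eq_norm, not_lt] at h2
    rw [Metric.mem_ball, dist_eq_norm] at hb'
    have h3 : -(n : ℂ) - p = -((n : ℂ) + b) + (b - p) := by ring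
    rw [h3] at h2
    have := norm_add_le (-((n : ℂ) + b)) (b - p)
    rw [norm_neg] at this
    linarith
  have hn' : (0 : ℝ) < n := by exact_mod_cast hn
  rw [mul_inv, norm_mul, norm_inv, norm_inv, Complex.norm_natCast, mul_comm, ← mul_assoc,
    mul_inv_cancel₀ hn'.ne', one_mul]
  exact inv_anti₀ (by positivity) h1

theorem isOpen_snd_admissible (m : ℕ) :
    IsOpen {q : (Fin (m - 1) → ℂ) × ℂ | q.2 ∈ admissible} :=
  isOpen_admissible.preimage continuous_snd

theorem natCast_add_ne_zero {p : ℂ} (hp : p ∈ admissible) {n : ℕ} (hn : 1 ≤ n) :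
    (n : ℂ) + p ≠ 0 := fun h => hp n hn (by linear_combination h)

/-- The only denominators are n and n + p with n ≥ 1, and n + p vanishes precisely at the excluded
values of p. -/
theorem holRapid_frobSeq (m : ℕ) :
    HolRapid {q : (Fin (m - 1) → ℂ) × ℂ | q.2 ∈ admissible}
      (fun q => frobSeq (full m q.1 q.2) q.2) := by
  refine holRapid_frob (isOpen_snd_admissible m) (m := m) (fun n => ?_) (fun q hq => ?_)
    (fun k => ?_) (fun q k hk => cc_of_lt _ hk)
    ⟨fun n => differentiableOn_const _, fun q _ => ⟨Set.univ, univ_mem, rapidOn_single _ _⟩⟩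
  -- At n = 0 the factor is 0⁻¹ = 0, a constant, so no division takes place.
  · rcases Nat.eq_zero_or_pos n with rfl | hn
    · simp
    · refine DifferentiableOn.inv (by fun_prop) fun q hq => mul_ne_zero ?_ ?_
      · exact_mod_cast hn.ne'
      · exact natCast_add_ne_zero hq hn
  · obtain ⟨V, hV, A, hA⟩ := exists_norm_inv_mul_le hq
    exact ⟨_, continuous_snd.continuousAt.preimage_mem_nhds hV, A, fun b hb => hA b.2 hb⟩
  · exact ((differentiable_cc k).comp (differentiable_full m)).differentiableOn

theorem frobSeq_rec {m : ℕ} (a : Fin m → ℂ) {p : ℂ} (hp : p ∈ admissible) (n : ℕ) :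
    n * (n + p) * frobSeq a p n = ∑ j ∈ Finset.range n, cc a (n - j) * frobSeq a p j := by
  rcases Nat.eq_zero_or_pos n with rfl | hn
  · simp
  · have h1 : (n : ℂ) ≠ 0 := by exact_mod_cast hn.ne'
    have h2 := natCast_add_ne_zero hp hn
    conv_lhs => rw [frobSeq, frob_eq]
    rw [if_neg hn.ne', add_zero, mul_inv_cancel_left₀ (mul_ne_zero h1 h2)]
    rfl

theorem rapid_frobSeq {m : ℕ} (a' : Fin (m - 1) → ℂ) {p : ℂ} (hp : p ∈ admissible) :
    Rapid (frobSeq (full m a' p) p) :=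
  (holRapid_frobSeq m).rapid (a := (a', p)) hp

theorem isSolution_frobSeq {m : ℕ} (hm : 1 ≤ m) (a' : Fin (m - 1) → ℂ) {p : ℂ}
    (hp : p ∈ admissible) : IsSolution (full m a' p)
      (fun t => Complex.exp (s p * t) * PS (frobSeq (full m a' p) p) (Complex.exp t)) := by
  have h0 : Rapid (fun _ => 0) := fun R _ => ⟨0, le_rfl, by simp⟩
  have h00 : ∀ x, PS (fun _ => 0) x = 0 := fun x => by simp [PS]
  have := isSolution_exp_log (a := full m a' p) h0 (rapid_frobSeq a' hp) (ρ := s p)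
    (by rw [cc_full_zero hm, s]; ring) (by simp)
    (fun n => by rw [← frobSeq_rec _ hp, s]; ring)
  simpa [h00] using this

/-! ### The logarithmic case -/

theorem HolRapid.add {E : Type*} [NormedAddCommGroup E] [NormedSpace ℂ E] {U : Set E}
    {X Y : E → ℕ → ℂ} (h : HolRapid U X) (h' : HolRapid U Y) :
    HolRapid U (fun a n => X a n + Y a n) :=
  ⟨fun n => (h.1 n).add (h'.1 n), fun a ha => by
    obtain ⟨V, hV, hr⟩ := h.2 a ha
    obtain ⟨V', hV', hr'⟩ := h'.2 a ha
    exact ⟨V ∩ V', inter_mem hV hV', (hr.mono Set.inter_subset_left).add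
      (hr'.mono Set.inter_subset_right)⟩⟩

theorem HolRapid.shift {E : Type*} [NormedAddCommGroup E] [NormedSpace ℂ E] {U : Set E}
    {X : E → ℕ → ℂ} (h : HolRapid U X) (j : ℕ) : HolRapid U (fun a => shiftSeq j (X a)) := by
  refine ⟨fun n => ?_, fun a ha => ?_⟩
  · by_cases hj : j ≤ n
    · simpa only [shiftSeq, hj, if_true] using h.1 _
    · simp [shiftSeq, hj]
  · obtain ⟨V, hV, hr⟩ := h.2 a ha
    exact ⟨V, hV, hr.shift j⟩

theorem HolRapid.fun_mul {E : Type*} [NormedAddCommGroup E] [NormedSpace ℂ E] {U : Set E}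
    (hU : IsOpen U) {X : E → ℕ → ℂ} (h : HolRapid U X) {f : E → ℂ} (hf : DifferentiableOn ℂ f U)
    {d : ℕ → ℂ} {B : ℝ} (hd : ∀ n, ‖d n‖ ≤ B) : HolRapid U (fun a n => f a * d n * X a n) := by
  refine ⟨fun n => (hf.mul_const _).mul (h.1 n), fun a ha => ?_⟩
  obtain ⟨V, hV, hr⟩ := h.2 a ha
  have h3 : ∀ᶠ b in 𝓝 a, ‖f b‖ < ‖f a‖ + 1 := by
    have : ContinuousAt (fun b => ‖f b‖) a := (hf.continuousOn.continuousAt (hU.mem_nhds ha)).norm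
    exact this.eventually_lt continuousAt_const (by linarith)
  refine ⟨V ∩ {b | ‖f b‖ < ‖f a‖ + 1}, inter_mem hV h3, (hr.mono Set.inter_subset_left).of_norm_le
    ((‖f a‖ + 1) * B) fun b hb n => ?_⟩
  rw [norm_mul, norm_mul]
  have hB : 0 ≤ B := (norm_nonneg _).trans (hd 0)
  refine mul_le_mul_of_nonneg_right ?_ (norm_nonneg _)
  have h1 : (1 : ℝ) ≤ 2 ^ n := one_le_pow₀ (by norm_num)
  have h2 : ‖f b‖ * ‖d n‖ ≤ (‖f a‖ + 1) * B := by
    gcongr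
    · exact hb.2.le
    · exact hd n
  have h4 : 0 ≤ (‖f a‖ + 1) * B := by positivity
  nlinarith

/-- The number `λ` for `p = N`. -/
noncomputable def logCoef {m : ℕ} (a : Fin m → ℂ) (N : ℕ) : ℂ :=
  if N = 0 then 1 else (∑ j ∈ Finset.range N, cc a (N - j) * frobSeq a (-N) j) / N

/-- The coefficients of `g_2` for `p = N`. -/
noncomputable def logSeq {m : ℕ} (a : Fin m → ℂ) (N : ℕ) : ℕ → ℂ :=
  frob (fun n => ((n : ℂ) * (n + -N))⁻¹) (cc a)
    (fun n => (if n = 0 then (if N = 0 then 0 else 1) else 0)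
      + logCoef a N * (-(2 * n - N) * ((n : ℂ) * (n + -N))⁻¹) * shiftSeq N (frobSeq a N) n)

theorem natCast_mem_admissible (N : ℕ) : (N : ℂ) ∈ admissible := fun n hn h => by
  have : ((N + n : ℕ) : ℂ) = 0 := by push_cast; rw [h]; ring
  rw [Nat.cast_eq_zero] at this
  omega

/-- Below index N the source term coming from the logarithm vanishes, so the recursion is the one
for exponent -N. -/
theorem logSeq_eq_of_lt {m : ℕ} (a : Fin m → ℂ) {N n : ℕ} (hn : n < N) :
    logSeq a N n = frobSeq a (-N) n := by
  induction n using Nat.strong_induction_on with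
  | _ n ih =>
  conv_lhs => rw [logSeq, frob_eq]
  conv_rhs => rw [frobSeq, frob_eq]
  congr 1
  · congr 1
    refine Finset.sum_congr rfl fun j hj => ?_
    rw [Finset.mem_range] at hj
    congr 1
    exact ih j hj (hj.trans hn)
  · have : ¬ N ≤ n := by omega
    have : N ≠ 0 := by omega
    simp [shiftSeq, *]

theorem logSeq_zero {m : ℕ} (a : Fin m → ℂ) (N : ℕ) :
    logSeq a N 0 = if N = 0 then 0 else 1 := by
  rw [logSeq, frob_eq]; simp

/-- At n = N the factor n(n - N) vanishes and its inverse is 0 by convention; this default is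
exactly the normalisation that x^N has coefficient 0 in g₂. -/
theorem logSeq_self {m : ℕ} (a : Fin m → ℂ) {N : ℕ} : logSeq a N N = 0 := by
  rw [logSeq, frob_eq]
  by_cases h : N = 0 <;> simp [h]

/-- At n = N the unknown X_N drops out and the equation becomes a compatibility condition, which is
what determines λ = `logCoef`. For every other n ≥ 1 the recursion is solved for X_n. -/
theorem logSeq_rec {m : ℕ} (a : Fin m → ℂ) (N n : ℕ) :
    n * (n + -N) * logSeq a N n + (2 * n - N) * (logCoef a N * shiftSeq N (frobSeq a N) n)
      = ∑ j ∈ Finset.range n, cc a (n - j) * logSeq a N j := by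
  rcases eq_or_ne n N with rfl | hnN
  · rw [logSeq_self]
    rw [Finset.sum_congr rfl fun j hj => by rw [logSeq_eq_of_lt a (Finset.mem_range.1 hj)]]
    simp only [shiftSeq, le_refl, if_true, Nat.sub_self, frobSeq_zero, logCoef]
    split_ifs with h
    · simp [h]
    · have : (n : ℂ) ≠ 0 := by exact_mod_cast h
      field_simp
      ring
  rcases Nat.eq_zero_or_pos n with rfl | hn
  · have : ¬ N ≤ 0 := by omega
    simp [shiftSeq, this]
  · have h1 : (n : ℂ) ≠ 0 := by exact_mod_cast hn.ne'
    have h2 : (n : ℂ) + -N ≠ 0 := by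
      rw [← sub_eq_add_neg, sub_ne_zero]; exact_mod_cast hnN
    conv_lhs => rw [logSeq, frob_eq]
    rw [if_neg hn.ne', zero_add]
    change _ * (_ * (∑ j ∈ Finset.range n, cc a (n - j) * logSeq a N j) + _) + _ = _
    field_simp
    ring

/-- Partial fractions: the factor is -(1/(n-N) + 1/n), a sum of two inverses of nonzero integers. -/
theorem norm_logFactor_le (N n : ℕ) : ‖-(2 * (n : ℂ) - N) * ((n : ℂ) * (n + -N))⁻¹‖ ≤ 2 := by
  rcases Nat.eq_zero_or_pos n with rfl | hn
  · simp
  rcases eq_or_ne n N with rfl | hnN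
  · simp
  have h1 : (n : ℂ) ≠ 0 := by exact_mod_cast hn.ne'
  have h2 : (n : ℂ) - N ≠ 0 := by rw [sub_ne_zero]; exact_mod_cast hnN
  have h3 : -(2 * (n : ℂ) - N) * ((n : ℂ) * (n + -N))⁻¹ = -(((n : ℂ) - N)⁻¹ + (n : ℂ)⁻¹) := by
    rw [← sub_eq_add_neg]
    field_simp
    ring
  have h4 : ‖((n : ℂ) - N)⁻¹‖ ≤ 1 := by
    rw [norm_inv]
    refine inv_le_one_of_one_le₀ ?_
    have : ((n : ℂ) - N) = ((n - N : ℤ) : ℂ) := by push_cast; ring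
    rw [this, Complex.norm_intCast]
    exact_mod_cast Int.one_le_abs (z := (n : ℤ) - N) (by omega)
  have h5 : ‖(n : ℂ)⁻¹‖ ≤ 1 := by
    rw [norm_inv, Complex.norm_natCast]
    exact inv_le_one_of_one_le₀ (by exact_mod_cast hn)
  rw [h3, norm_neg]
  linarith [norm_add_le ((n : ℂ) - N)⁻¹ (n : ℂ)⁻¹]

theorem exists_norm_inv_mul_le_nat (N : ℕ) :
    ∃ A : ℝ, ∀ n : ℕ, ‖((n : ℂ) * (n + -N))⁻¹‖ * n ≤ A := by
  refine ⟨1, fun n => ?_⟩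
  rcases Nat.eq_zero_or_pos n with rfl | hn
  · simp
  rcases eq_or_ne n N with rfl | hnN
  · simp
  have hn' : (0 : ℝ) < n := by exact_mod_cast hn
  rw [mul_inv, norm_mul, norm_inv, norm_inv, Complex.norm_natCast, mul_comm, ← mul_assoc,
    mul_inv_cancel₀ hn'.ne', one_mul]
  refine inv_le_one_of_one_le₀ ?_
  have : ((n : ℂ) + -N) = ((n - N : ℤ) : ℂ) := by push_cast; ring
  rw [this, Complex.norm_intCast]
  exact_mod_cast Int.one_le_abs (z := (n : ℤ) - N) (by omega)

theorem differentiable_full_left (m : ℕ) (p : ℂ) :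
    Differentiable ℂ fun a' : Fin (m - 1) → ℂ => full m a' p :=
  (differentiable_full m).comp (g := fun q : (Fin (m - 1) → ℂ) × ℂ => full m q.1 q.2)
    (f := fun a' => (a', p)) (by fun_prop)

theorem holRapid_frobSeq_left (m : ℕ) {p : ℂ} (hp : p ∈ admissible) :
    HolRapid Set.univ (fun a' => frobSeq (full m a' p) p) := by
  have h := holRapid_frobSeq m
  refine ⟨fun n => (h.1 n).comp (f := fun a' : Fin (m - 1) → ℂ => (a', p))
    (by fun_prop) fun _ _ => hp, fun a' _ => ?_⟩
  obtain ⟨V, hV, hr⟩ := h.2 (a', p) hp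
  refine ⟨(fun a' => (a', p)) ⁻¹' V, ?_, fun R hR => ?_⟩
  · exact (Continuous.prodMk_left p).continuousAt.preimage_mem_nhds hV
  · obtain ⟨C, hC, hb⟩ := hr R hR
    exact ⟨C, hC, fun b hb' n => hb (b, p) hb' n⟩

theorem differentiable_logCoef (m N : ℕ) :
    Differentiable ℂ fun a' : Fin (m - 1) → ℂ => logCoef (full m a' N) N := by
  by_cases h : N = 0
  · simp [logCoef, h]
  · simp only [logCoef, h, if_false]
    -- For N ≥ 1 the value -N is not admissible, so `holRapid_frobSeq` does not apply. For fixed N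
    -- the inverses are constants, and each coefficient is built from the `cc a k` by finitely many
    -- sums and products.
    have h1 : ∀ j, Differentiable ℂ fun a : Fin m → ℂ => frobSeq a (-N) j := by
      intro j
      induction j using Nat.strong_induction_on with
      | _ j ih =>
      rw [show (fun a : Fin m → ℂ => frobSeq a (-N) j) = fun a => ((j : ℂ) * (j + -N))⁻¹ *
        ∑ i ∈ Finset.range j, cc a (j - i) * frobSeq a (-N) i + (if j = 0 then 1 else 0) from
        funext fun a => frob_eq _ _ _ _]
      refine ((Differentiable.fun_sum fun i hi => ?_).const_mul _).add_const _
      exact (differentiable_cc _).mul (ih i (Finset.mem_range.1 hi))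
    simp only [div_eq_mul_inv]
    refine Differentiable.mul_const (Differentiable.fun_sum fun j _ => ?_) _
    exact ((differentiable_cc _).mul (h1 j)).comp (differentiable_full_left m N)

theorem holRapid_logSeq (m N : ℕ) :
    HolRapid Set.univ (fun a' : Fin (m - 1) → ℂ => logSeq (full m a' N) N) := by
  refine holRapid_frob isOpen_univ (m := m) (fun n => differentiableOn_const _) (fun a' _ => ?_)
    (fun k => ((differentiable_cc k).comp (differentiable_full_left m N)).differentiableOn)
    (fun q k hk => cc_of_lt _ hk) (HolRapid.add ⟨fun n => differentiableOn_const _,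
      fun q _ => ⟨Set.univ, univ_mem, rapidOn_single _ _⟩⟩ ?_)
  · obtain ⟨A, hA⟩ := exists_norm_inv_mul_le_nat N
    exact ⟨Set.univ, univ_mem, A, fun b _ => hA⟩
  · exact ((holRapid_frobSeq_left m (natCast_mem_admissible N)).shift N).fun_mul isOpen_univ
      (differentiable_logCoef m N).differentiableOn (norm_logFactor_le N)

theorem exp_s_natCast (N : ℕ) (t : ℂ) :
    Complex.exp (s N * t) = Complex.exp (s (-N) * t) * Complex.exp t ^ N := by
  rw [← Complex.exp_nat_mul, ← Complex.exp_add]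
  congr 1
  simp only [s]
  ring

/-- Writing x^{s(N)} = x^{s(-N)} x^N brings f₂ into the form treated by `isSolution_exp_log`, with ρ
= s(-N) and with the f₁-series shifted by N as logarithmic part. -/
theorem logForm_eq {m : ℕ} (a' : Fin (m - 1) → ℂ) (N : ℕ) (t : ℂ) :
    logCoef (full m a' N) N * (Complex.exp (s N * t) *
        PS (frobSeq (full m a' N) N) (Complex.exp t)) * t
      + Complex.exp (s (-N) * t) * PS (logSeq (full m a' N) N) (Complex.exp t)
    = Complex.exp (s (-N) * t) * (t * PS (fun n => logCoef (full m a' N) N *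
        shiftSeq N (frobSeq (full m a' N) N) n) (Complex.exp t)
      + PS (logSeq (full m a' N) N) (Complex.exp t)) := by
  rw [PS_const_mul, (rapid_frobSeq a' (natCast_mem_admissible N)).PS_shift, exp_s_natCast]
  ring

theorem isSolution_logSeq {m : ℕ} (hm : 1 ≤ m) (a' : Fin (m - 1) → ℂ) (N : ℕ) :
    IsSolution (full m a' N) (fun t => logCoef (full m a' N) N * (Complex.exp (s N * t) *
        PS (frobSeq (full m a' N) N) (Complex.exp t)) * t
      + Complex.exp (s (-N) * t) * PS (logSeq (full m a' N) N) (Complex.exp t)) := by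
  simp_rw [logForm_eq]
  have hN := natCast_mem_admissible N
  refine isSolution_exp_log (RapidOn.const_mul (RapidOn.shift (rapid_frobSeq a' hN) N) _)
    ((holRapid_logSeq m N).rapid trivial) (by rw [cc_full_zero hm, s]; ring) (fun n => ?_)
    (fun n => ?_)
  -- Here 2ρ - 1 = -N. For n = N + k the factor n(n - N) is k(k + N), so the shifted series
  -- satisfies the recursion of f₁; for n < N both sides vanish.
  · rw [Finset.sum_congr rfl fun j _ => mul_left_comm _ _ _, ← Finset.mul_sum]
    rw [mul_left_comm]
    congr 1
    by_cases h : N ≤ n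
    · obtain ⟨k, rfl⟩ := Nat.exists_eq_add_of_le h
      rw [Finset.sum_range_add, Finset.sum_eq_zero, zero_add]
      · simp only [shiftSeq, Nat.le_add_right, if_true, Nat.add_sub_cancel_left,
          Nat.add_sub_add_left]
        rw [← frobSeq_rec _ hN]
        push_cast
        simp only [s]
        ring
      · intro j hj
        have : ¬ N ≤ j := by simpa using hj
        simp [shiftSeq, this]
    · rw [Finset.sum_eq_zero]
      · simp [shiftSeq, h]
      · intro j hj
        rw [Finset.mem_range] at hj
        have : ¬ N ≤ j := by omega
        simp [shiftSeq, this]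
  · rw [← logSeq_rec]
    simp only [s]
    ring

/-! ### The Fuchs basis: existence, Wronskian and uniqueness -/

theorem admissible_cases {p : ℂ} (hp : p ∈ admissible) :
    (∀ n : ℤ, p ≠ n) ∨ ∃ N : ℕ, p = N := by
  by_cases h : ∃ n : ℤ, p = n
  · obtain ⟨n, rfl⟩ := h
    right
    obtain ⟨k, rfl | rfl⟩ := n.eq_nat_or_neg
    · exact ⟨k, by simp⟩
    · rcases Nat.eq_zero_or_pos k with rfl | hk
      · exact ⟨0, by simp⟩
      · exact absurd (by push_cast; rfl) (hp k hk)
  · left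
    push Not at h
    exact h

theorem admissible_of_ne_int {p : ℂ} (hp : ∀ n : ℤ, p ≠ n) : p ∈ admissible :=
  fun n _ h => hp (-n) (by rw [h]; push_cast; rfl)

theorem neg_ne_int {p : ℂ} (hp : ∀ n : ℤ, p ≠ n) (n : ℤ) : -p ≠ n :=
  fun h => hp (-n) (by push_cast; rw [← h]; ring)

theorem isFuchs_frobSeq {m : ℕ} (hm : 1 ≤ m) (a' : Fin (m - 1) → ℂ) {p : ℂ}
    (hp : ∀ n : ℤ, p ≠ n) :
    IsFuchs m a' p ⟨0, PS (frobSeq (full m a' p) p), PS (frobSeq (full m a' p) (-p))⟩ := by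
  have h1 := admissible_of_ne_int hp
  have h2 := admissible_of_ne_int (neg_ne_int hp)
  have r1 := rapid_frobSeq a' h1
  have r2 := rapid_frobSeq a' h2
  have s2 := isSolution_frobSeq hm a' h2
  rw [full_neg] at r2 s2
  refine ⟨r1.differentiable, r2.differentiable, ?_, isSolution_frobSeq hm a' h1, ?_, fun _ => ?_,
    fun n _ h => absurd h (hp n), fun h => absurd h (by simpa using hp 0)⟩
  · exact (PS_zero _).trans (frobSeq_zero _ _)
  · convert! s2 using 1
    ext t
    simp [FuchsData.f₂]
  · exact ⟨rfl, (PS_zero _).trans (frobSeq_zero _ _)⟩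

theorem isFuchs_logSeq {m : ℕ} (hm : 1 ≤ m) (a' : Fin (m - 1) → ℂ) (N : ℕ) :
    IsFuchs m a' N ⟨logCoef (full m a' N) N, PS (frobSeq (full m a' N) N),
      PS (logSeq (full m a' N) N)⟩ := by
  have h1 := natCast_mem_admissible N
  have r1 := rapid_frobSeq a' h1
  have r2 : Rapid (logSeq (full m a' N) N) := (holRapid_logSeq m N).rapid trivial
  refine ⟨r1.differentiable, r2.differentiable, ?_, isSolution_frobSeq hm a' h1,
    isSolution_logSeq hm a' N, fun h => absurd rfl (h N), fun n hn h => ?_, fun h => ?_⟩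
  · exact (PS_zero _).trans (frobSeq_zero _ _)
  · have h : N = n := by exact_mod_cast h
    subst h
    have : N ≠ 0 := by omega
    dsimp only
    rw [PS_zero, logSeq_zero, if_neg this, r2.iteratedDeriv_zero, logSeq_self, mul_zero]
    exact ⟨rfl, rfl⟩
  · have h : N = 0 := by exact_mod_cast h
    subst h
    dsimp only
    rw [PS_zero, logSeq_zero, logCoef]
    simp

theorem exists_isFuchs {m : ℕ} (hm : 1 ≤ m) (a' : Fin (m - 1) → ℂ) {p : ℂ}
    (hp : p ∈ admissible) : ∃ d, IsFuchs m a' p d := by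
  rcases admissible_cases hp with h | ⟨N, rfl⟩
  · exact ⟨_, isFuchs_frobSeq hm a' h⟩
  · exact ⟨_, isFuchs_logSeq hm a' N⟩

theorem isFuchs_fuchs {m : ℕ} (hm : 1 ≤ m) (a' : Fin (m - 1) → ℂ) {p : ℂ}
    (hp : p ∈ admissible) : IsFuchs m a' p (fuchs m a' p) :=
  Classical.epsilon_spec (exists_isFuchs hm a' hp)

/-- A continuous function that is constant on `ℂ \ {0}`. -/
theorem eq_of_forall_exp {k : ℂ → ℂ} (hk : Continuous k) {κ : ℂ}
    (h : ∀ t, k (Complex.exp t) = κ) (x : ℂ) : k x = κ := by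
  by_cases hx : x = 0
  · subst hx
    have h1 : Tendsto (fun n : ℕ => Complex.exp (-(n : ℂ))) atTop (𝓝 0) := by
      rw [tendsto_zero_iff_norm_tendsto_zero]
      simp only [Complex.norm_exp, Complex.neg_re, Complex.natCast_re]
      exact Real.tendsto_exp_neg_atTop_nhds_zero.comp tendsto_natCast_atTop_atTop
    have h2 := (hk.tendsto 0).comp h1
    exact tendsto_nhds_unique h2 (tendsto_const_nhds.congr fun n => (h _).symm)
  · rw [← Complex.exp_log hx, h]

theorem hasDerivAt_exp_mul_comp {g : ℂ → ℂ} (hg : Differentiable ℂ g) (α t : ℂ) :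
    HasDerivAt (fun t => Complex.exp (α * t) * g (Complex.exp t))
      (Complex.exp (α * t) * (α * g (Complex.exp t)
        + Complex.exp t * deriv g (Complex.exp t))) t := by
  have h1 : HasDerivAt (fun t => Complex.exp (α * t)) (Complex.exp (α * t) * α) t := by
    simpa using ((hasDerivAt_id t).const_mul α).cexp
  have h2 := (hg (Complex.exp t)).hasDerivAt.comp t (Complex.hasDerivAt_exp t)
  refine (h1.mul h2).congr_deriv ?_
  simp only [Function.comp]
  ring

theorem exp_s_mul_exp_s (p t : ℂ) : Complex.exp (s p * t) * Complex.exp (s (-p) * t)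
    = Complex.exp t := by
  rw [← Complex.exp_add]; congr 1; simp only [s]; ring

theorem exp_s_eq (p t : ℂ) : Complex.exp (s p * t)
    = Complex.exp (p * t) * Complex.exp (s (-p) * t) := by
  rw [← Complex.exp_add]; congr 1; simp only [s]; ring

theorem wr_fuchs_formula (d : FuchsData) (h₁ : Differentiable ℂ d.g₁) (h₂ : Differentiable ℂ d.g₂)
    (p t : ℂ) : wr (d.f₁ p) (d.f₂ p) t =
      d.lam * Complex.exp (p * t) * d.g₁ (Complex.exp t) ^ 2
      + (Complex.exp t * (d.g₁ (Complex.exp t) * deriv d.g₂ (Complex.exp t)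
        - deriv d.g₁ (Complex.exp t) * d.g₂ (Complex.exp t))
        - p * d.g₁ (Complex.exp t) * d.g₂ (Complex.exp t)) := by
  have e1 := hasDerivAt_exp_mul_comp h₁ (s p) t
  have e2 := hasDerivAt_exp_mul_comp h₂ (s (-p)) t
  have e3 : HasDerivAt (d.f₁ p) _ t := e1
  have e4 : HasDerivAt (d.f₂ p) _ t := ((e3.const_mul d.lam).mul (hasDerivAt_id' t)).add e2
  rw [wr, e3.deriv, e4.deriv]
  simp only [FuchsData.f₁, FuchsData.f₂]
  have e5 := exp_s_mul_exp_s p t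
  have e6 := exp_s_eq p t
  have e7 : Complex.exp (-t) * Complex.exp t = 1 := by rw [← Complex.exp_add]; simp
  clear e1 e2 e3 e4
  generalize Complex.exp (-t) = y at *
  generalize Complex.exp t = x at *
  generalize d.g₁ x = G at *
  generalize d.g₂ x = H at *
  generalize deriv d.g₁ x = G' at *
  generalize deriv d.g₂ x = H' at *
  have e8 : s (-p) = s p - p := by simp only [s]; ring
  rw [e8] at e5 e6 ⊢
  generalize Complex.exp (s p * t) = A at *
  generalize Complex.exp ((s p - p) * t) = B at *
  generalize Complex.exp (p * t) = q at *
  have e9 : y * A * B = 1 := by rw [mul_assoc, e5, e7]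
  have e10 : y * A * A = q := by
    linear_combination q * e9 + y * A * e6
  linear_combination (d.lam * G ^ 2) * e10 + (G * ((s p - p) * H + x * H')
    - (s p * G + x * G') * H) * e9

/-- The Wronskian is constant and equals a continuous function of x once λ x^p is zero or a power
with natural exponent, so its value can be read off at x = 0. -/
theorem wr_fuchs {m : ℕ} {a : Fin m → ℂ} (d : FuchsData) (h₁ : Differentiable ℂ d.g₁)
    (h₂ : Differentiable ℂ d.g₂) {p : ℂ} (s₁ : IsSolution a (d.f₁ p)) (s₂ : IsSolution a (d.f₂ p))
    (hp : d.lam = 0 ∨ ∃ N : ℕ, p = N) (t : ℂ) : wr (d.f₁ p) (d.f₂ p) t =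
      (if p = 0 then d.lam * d.g₁ 0 ^ 2 else 0) - p * d.g₁ 0 * d.g₂ 0 := by
  have c₁ := h₁.continuous
  have c₂ := h₂.continuous
  have c₁' := (differentiable_deriv h₁).continuous
  have c₂' := (differentiable_deriv h₂).continuous
  rcases hp with h | ⟨N, rfl⟩
  · have key := eq_of_forall_exp (k := fun x => x * (d.g₁ x * deriv d.g₂ x
        - deriv d.g₁ x * d.g₂ x) - p * d.g₁ x * d.g₂ x) (κ := wr (d.f₁ p) (d.f₂ p) t)
      (by fun_prop) (fun u => by
        rw [wr_const s₁ s₂ t u, wr_fuchs_formula d h₁ h₂, h]; ring) 0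
    rw [← key, h]
    simp
  · have key := eq_of_forall_exp (k := fun x => d.lam * x ^ N * d.g₁ x ^ 2
        + (x * (d.g₁ x * deriv d.g₂ x
        - deriv d.g₁ x * d.g₂ x) - N * d.g₁ x * d.g₂ x)) (κ := wr (d.f₁ N) (d.f₂ N) t)
      (by fun_prop) (fun u => by
        rw [wr_const s₁ s₂ t u, wr_fuchs_formula d h₁ h₂, ← Complex.exp_nat_mul]) 0
    rw [← key]
    by_cases hN : N = 0
    · subst hN; simp
    · simp [hN]

theorem IsFuchs.lam_eq_zero_or {m : ℕ} {a' : Fin (m - 1) → ℂ} {p : ℂ} {d : FuchsData}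
    (h : IsFuchs m a' p d) (hp : p ∈ admissible) : d.lam = 0 ∨ ∃ N : ℕ, p = N :=
  (admissible_cases hp).imp_left fun hn => (h.2.2.2.2.2.1 hn).1

theorem IsFuchs.g₂_zero {m : ℕ} {a' : Fin (m - 1) → ℂ} {p : ℂ} {d : FuchsData}
    (h : IsFuchs m a' p d) (hp : p ∈ admissible) : d.g₂ 0 = if p = 0 then 0 else 1 := by
  obtain ⟨-, -, -, -, -, h1, h2, h3⟩ := h
  rcases admissible_cases hp with hn | ⟨N, rfl⟩
  · rw [if_neg (by simpa using hn 0), (h1 hn).2]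
  · split_ifs with h0
    · exact (h3 h0).2
    · have : N ≠ 0 := by exact_mod_cast h0
      exact (h2 N (by omega) rfl).1

theorem IsFuchs.wr_eq {m : ℕ} {a' : Fin (m - 1) → ℂ} {p : ℂ} {d : FuchsData}
    (h : IsFuchs m a' p d) (hp : p ∈ admissible) (t : ℂ) :
    wr (d.f₁ p) (d.f₂ p) t = if p = 0 then 1 else -p := by
  rw [wr_fuchs d h.1 h.2.1 h.2.2.2.1 h.2.2.2.2.1 (h.lam_eq_zero_or hp), h.g₂_zero hp, h.2.2.1]
  split_ifs with h0
  · rw [(h.2.2.2.2.2.2.2 h0).1, h0]; simp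
  · simp

theorem wrFuchs_ne_zero (p : ℂ) : (if p = 0 then 1 else -p : ℂ) ≠ 0 := by
  split_ifs with h
  · exact one_ne_zero
  · exact neg_ne_zero.2 h

theorem int_of_exp_eq_one {p : ℂ} (h : Complex.exp (p * (2 * Real.pi * Complex.I)) = 1) :
    ∃ n : ℤ, p = n := by
  obtain ⟨n, hn⟩ := Complex.exp_eq_one_iff.1 h
  exact ⟨n, mul_right_cancel₀ Complex.two_pi_I_ne_zero hn⟩

theorem exp_add_two_pi_I (t : ℂ) : Complex.exp (t + 2 * Real.pi * Complex.I) = Complex.exp t :=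
  Complex.exp_periodic t

/-- The Wronskian is x^p times x times an entire function. If this constant were nonzero, a turn
around the origin would force p to be an integer, hence a natural number; but then the function
vanishes at x = 0. -/
theorem wr_fuchs_fst {m : ℕ} {a : Fin m → ℂ} {g h : ℂ → ℂ} (hg : Differentiable ℂ g)
    (hh : Differentiable ℂ h) {p : ℂ} (hp : p ∈ admissible)
    (s₁ : IsSolution a fun t => Complex.exp (s p * t) * g (Complex.exp t))
    (s₂ : IsSolution a fun t => Complex.exp (s p * t) * h (Complex.exp t)) (t : ℂ) :
    wr (fun t => Complex.exp (s p * t) * g (Complex.exp t))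
      (fun t => Complex.exp (s p * t) * h (Complex.exp t)) t = 0 := by
  set κ := wr (fun t => Complex.exp (s p * t) * g (Complex.exp t))
      (fun t => Complex.exp (s p * t) * h (Complex.exp t)) t with hκ
  have key : ∀ u, κ = Complex.exp (p * u) * (Complex.exp u * (g (Complex.exp u)
      * deriv h (Complex.exp u) - deriv g (Complex.exp u) * h (Complex.exp u))) := by
    intro u
    rw [hκ, wr_const s₁ s₂ t u, wr, (hasDerivAt_exp_mul_comp hg (s p) u).deriv,
      (hasDerivAt_exp_mul_comp hh (s p) u).deriv]
    have e10 : Complex.exp (-u) * Complex.exp (s p * u) * Complex.exp (s p * u)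
        = Complex.exp (p * u) := by
      rw [← Complex.exp_add, ← Complex.exp_add]; congr 1; simp only [s]; ring
    linear_combination (Complex.exp u * (g (Complex.exp u)
      * deriv h (Complex.exp u) - deriv g (Complex.exp u) * h (Complex.exp u))) * e10
  by_contra hne
  have h1 : Complex.exp (p * (2 * Real.pi * Complex.I)) = 1 := by
    have h2 := key 0
    have h3 := key (0 + 2 * Real.pi * Complex.I)
    rw [exp_add_two_pi_I, mul_add, Complex.exp_add] at h3
    have h4 : κ = Complex.exp (p * (2 * Real.pi * Complex.I)) * κ := by
      nth_rw 1 [h3]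
      rw [h2]
      ring
    exact mul_right_cancel₀ hne (by rw [← h4, one_mul])
  have h2 : ∃ N : ℕ, p = N := (admissible_cases hp).resolve_left fun hn => by
    obtain ⟨n, hn'⟩ := int_of_exp_eq_one h1
    exact hn n hn'
  obtain ⟨N, rfl⟩ := h2
  have c₁ := hg.continuous
  have c₂ := hh.continuous
  have c₁' := (differentiable_deriv hg).continuous
  have c₂' := (differentiable_deriv hh).continuous
  have := eq_of_forall_exp (k := fun x => x ^ N * (x * (g x * deriv h x - deriv g x * h x)))
    (κ := κ) (by fun_prop) (fun u => by rw [key u, ← Complex.exp_nat_mul]) 0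
  exact hne (by rw [← this]; simp)

theorem iteratedDeriv_pow_mul_zero {g : ℂ → ℂ} (hg : Differentiable ℂ g) (n : ℕ) :
    iteratedDeriv n (fun x => x ^ n * g x) 0 = n.factorial * g 0 := by
  induction n generalizing g with
  | zero => simp
  | succ n ih =>
    have hd : deriv (fun x => x ^ (n + 1) * g x)
        = fun x => x ^ n * ((n + 1) * g x + x * deriv g x) := by
      ext x
      refine ((hasDerivAt_pow (n + 1) x).mul (hg x).hasDerivAt).deriv.trans ?_
      rw [Nat.add_sub_cancel, pow_succ]
      push_cast
      ring
    have hg' := differentiable_deriv hg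
    rw [iteratedDeriv_succ', hd, ih (g := fun x => (n + 1) * g x + x * deriv g x) (by fun_prop),
      Nat.factorial_succ]
    push_cast
    ring

/-- Two candidates have vanishing Wronskian, so they are proportional, and g₁(0) = 1 fixes the
factor. -/
theorem IsFuchs.f₁_unique {m : ℕ} {a' : Fin (m - 1) → ℂ} {p : ℂ} {d d' : FuchsData}
    (h : IsFuchs m a' p d) (h' : IsFuchs m a' p d') (hp : p ∈ admissible) :
    d'.g₁ = d.g₁ := by
  have hW : wr (d.f₁ p) (d.f₂ p) 0 ≠ 0 := by rw [h.wr_eq hp]; exact wrFuchs_ne_zero p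
  have hW0 : wr (d.f₁ p) (d'.f₁ p) 0 = 0 := wr_fuchs_fst h.1 h'.1 hp h.2.2.2.1 h'.2.2.2.1 0
  have hcomb := h'.2.2.2.1.eq_linear_comb h.2.2.2.1 h.2.2.2.2.1 0 hW
  rw [hW0] at hcomb
  set c := wr (d'.f₁ p) (d.f₂ p) 0 / wr (d.f₁ p) (d.f₂ p) 0
  have h1 : ∀ t, d'.g₁ (Complex.exp t) = c * d.g₁ (Complex.exp t) := fun t => by
    have := hcomb t
    simp only [FuchsData.f₁, zero_div, zero_mul, add_zero] at this
    refine mul_left_cancel₀ (Complex.exp_ne_zero (s p * t)) ?_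
    rw [this]; ring
  have c₁ := h.1.continuous
  have c₂ := h'.1.continuous
  have h2 := eq_of_forall_exp (k := fun x => d'.g₁ x - c * d.g₁ x) (κ := 0) (by fun_prop)
    (fun t => by rw [h1, sub_self])
  have h3 : c = 1 := by
    have := h2 0
    simp only [h.2.2.1, h'.2.2.1] at this
    linear_combination -this
  ext x
  have := h2 x
  simp only [h3] at this
  linear_combination this

theorem IsFuchs.unique {m : ℕ} {a' : Fin (m - 1) → ℂ} {p : ℂ} {d d' : FuchsData}
    (h : IsFuchs m a' p d) (h' : IsFuchs m a' p d') (hp : p ∈ admissible) : d' = d := by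
  have hg₁ := h.f₁_unique h' hp
  have hW : wr (d.f₁ p) (d.f₂ p) 0 ≠ 0 := by rw [h.wr_eq hp]; exact wrFuchs_ne_zero p
  -- The difference of two candidates for f₂ has again the form of an f₂. By `wr_fuchs` and the
  -- normalisations its Wronskian with f₁ vanishes, so it is a multiple α f₁.
  set D : FuchsData := ⟨d'.lam - d.lam, d.g₁, fun x => d'.g₂ x - d.g₂ x⟩ with hD
  have hDf : D.f₂ p = fun t => 1 * d'.f₂ p t + (-1) * d.f₂ p t := by
    ext t
    simp only [hD, FuchsData.f₂, FuchsData.f₁, hg₁]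
    ring
  have hDs : IsSolution (full m a' p) (D.f₂ p) := by
    rw [hDf]; exact h'.2.2.2.2.1.linear_comb h.2.2.2.2.1 _ _
  have hW0 : wr (d.f₁ p) (D.f₂ p) 0 = 0 := by
    have := wr_fuchs D h.1 (h'.2.1.sub h.2.1) (p := p) h.2.2.2.1 hDs (by
      rcases h.lam_eq_zero_or hp with h1 | h1
      · rcases h'.lam_eq_zero_or hp with h2 | h2
        · left; simp [hD, h1, h2]
        · exact Or.inr h2
      · exact Or.inr h1) 0
    refine this.trans ?_
    simp only [hD, h.g₂_zero hp, h'.g₂_zero hp, sub_self, mul_zero, sub_zero]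
    split_ifs with h0
    · rw [(h.2.2.2.2.2.2.2 h0).1, (h'.2.2.2.2.2.2.2 h0).1]; simp
    · rfl
  have hcomb := hDs.eq_linear_comb h.2.2.2.1 h.2.2.2.2.1 0 hW
  rw [hW0] at hcomb
  set α := wr (D.f₂ p) (d.f₂ p) 0 / wr (d.f₁ p) (d.f₂ p) 0
  have h1 : ∀ t, (d'.g₂ (Complex.exp t) - d.g₂ (Complex.exp t))
      = Complex.exp (p * t) * (α - (d'.lam - d.lam) * t) * d.g₁ (Complex.exp t) := fun t => by
    have := hcomb t
    simp only [FuchsData.f₂, FuchsData.f₁, hD, zero_div, zero_mul, add_zero] at this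
    refine mul_left_cancel₀ (Complex.exp_ne_zero (s (-p) * t)) ?_
    rw [exp_s_eq] at this
    linear_combination this
  have c₀ := h.1.continuous
  obtain ⟨t₀, ht₀⟩ : ∃ t, d.g₁ (Complex.exp t) ≠ 0 := by
    by_contra hcon
    push Not at hcon
    have := eq_of_forall_exp c₀ hcon 0
    rw [h.2.2.1] at this
    exact one_ne_zero this
  have c₁ := h.2.1.continuous
  have c₂ := h'.2.1.continuous
  obtain ⟨hlam, hg₂⟩ : d'.lam = d.lam ∧ ∀ t, d'.g₂ (Complex.exp t) - d.g₂ (Complex.exp t) = 0 := by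
    rcases admissible_cases hp with hn | ⟨N, rfl⟩
    · have hl : d'.lam = d.lam := by
        rw [(h.2.2.2.2.2.1 hn).1, (h'.2.2.2.2.2.1 hn).1]
      refine ⟨hl, ?_⟩
      -- A turn around the origin multiplies x^p by e^{2πip} ≠ 1, while the difference of the g₂ is
      -- single-valued.
      have hα : α = 0 := by
        by_contra hα
        have e1 := h1 t₀
        have e2 := h1 (t₀ + 2 * Real.pi * Complex.I)
        rw [exp_add_two_pi_I, mul_add, Complex.exp_add, hl, sub_self] at e2
        rw [hl, sub_self] at e1
        have e3 : Complex.exp (p * (2 * Real.pi * Complex.I)) = 1 := by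
          have e4 : Complex.exp (p * t₀) * (α * d.g₁ (Complex.exp t₀)) ≠ 0 :=
            mul_ne_zero (Complex.exp_ne_zero _) (mul_ne_zero hα ht₀)
          refine mul_left_cancel₀ e4 ?_
          linear_combination e1 - e2
        obtain ⟨n, hn'⟩ := int_of_exp_eq_one e3
        exact hn n hn'
      intro t
      rw [h1, hα, hl]
      ring
    -- Now x^N is single-valued, and a turn changes only the logarithm; this isolates λ' - λ.
    · have hl : d'.lam = d.lam := by
        have e1 := h1 t₀
        have e2 := h1 (t₀ + 2 * Real.pi * Complex.I)
        have e3 : Complex.exp (N * (t₀ + 2 * Real.pi * Complex.I)) = Complex.exp (N * t₀) := by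
          rw [Complex.exp_nat_mul, exp_add_two_pi_I, ← Complex.exp_nat_mul]
        rw [e3, exp_add_two_pi_I] at e2
        have e4 : Complex.exp (N * t₀) * d.g₁ (Complex.exp t₀) * (2 * Real.pi * Complex.I) ≠ 0 :=
          mul_ne_zero (mul_ne_zero (Complex.exp_ne_zero _) ht₀) Complex.two_pi_I_ne_zero
        refine mul_left_cancel₀ e4 ?_
        linear_combination e2 - e1
      refine ⟨hl, ?_⟩
      have e5 := eq_of_forall_exp (k := fun x => d'.g₂ x - d.g₂ x - x ^ N * (α * d.g₁ x)) (κ := 0)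
        (by fun_prop) (fun t => by rw [h1, hl, Complex.exp_nat_mul]; ring)
      have e6 : (fun x => d'.g₂ x - d.g₂ x) = fun x => x ^ N * (α * d.g₁ x) := by
        ext x; linear_combination e5 x
      -- The difference of the g₂ is α x^N g₁, so α is its coefficient of x^N, which both
      -- normalisations set to 0; for N = 0 this is g₂(0) = 0.
      have e7 : iteratedDeriv N (fun x => d'.g₂ x - d.g₂ x) 0 = 0 := by
        rw [iteratedDeriv_fun_sub (h'.2.1.contDiff.contDiffAt) (h.2.1.contDiff.contDiffAt)]
        rcases Nat.eq_zero_or_pos N with rfl | hN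
        · have a1 := (h.2.2.2.2.2.2.2 (by simp)).2
          have a2 := (h'.2.2.2.2.2.2.2 (by simp)).2
          simp [a1, a2]
        · rw [(h.2.2.2.2.2.2.1 N hN rfl).2, (h'.2.2.2.2.2.2.1 N hN rfl).2, sub_self]
      have hα : α = 0 := by
        rw [e6, iteratedDeriv_pow_mul_zero (h.1.const_mul α), h.2.2.1, mul_one] at e7
        exact (mul_eq_zero.1 e7).resolve_left (by exact_mod_cast N.factorial_ne_zero)
      intro t
      rw [h1, hα, hl]
      ring
  have hg₂' := eq_of_forall_exp (k := fun x => d'.g₂ x - d.g₂ x) (κ := 0) (by fun_prop) hg₂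
  have e2 : d'.g₂ = d.g₂ := by ext x; linear_combination hg₂' x
  cases d; cases d'
  simp_all

theorem fuchs_eq_of_isFuchs {m : ℕ} (hm : 1 ≤ m) {a' : Fin (m - 1) → ℂ} {p : ℂ}
    (hp : p ∈ admissible) {d : FuchsData} (h : IsFuchs m a' p d) : fuchs m a' p = d :=
  h.unique (isFuchs_fuchs hm a' hp) hp

/-! ### Cauchy data and limits of solutions -/

/-- Every parameter `a` is of the form `(a', (p² - 1)/4)` with admissible `p`. -/
theorem exists_full_eq {m : ℕ} (hm : 1 ≤ m) (a : Fin m → ℂ) :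
    ∃ (a' : Fin (m - 1) → ℂ) (p : ℂ), p ∈ admissible ∧ full m a' p = a := by
  obtain ⟨q, hq⟩ := IsAlgClosed.exists_pow_nat_eq (1 + 4 * a ⟨m - 1, by omega⟩) zero_lt_two
  have key : ∀ p : ℂ, p ^ 2 = q ^ 2 → full m (fun i => a ⟨i.val, by omega⟩) p = a := by
    intro p hp
    ext i
    by_cases h : i.val < m - 1
    · simp [full, h]
    · have : i = ⟨m - 1, by omega⟩ := Fin.ext (by simp; omega)
      simp only [full, h, dif_neg, not_false_eq_true]
      rw [hp, hq, this]
      ring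
  -- If the square root q is a negative integer, then -q is a natural number with the same square.
  by_cases h : q ∈ admissible
  · exact ⟨_, q, h, key q rfl⟩
  · refine ⟨_, -q, ?_, key (-q) (by ring)⟩
    simp only [admissible, Set.mem_ofPred_eq, not_forall, not_not] at h
    obtain ⟨n, -, rfl⟩ := h
    rw [neg_neg]
    exact natCast_mem_admissible n

/-- The Fuchs basis supplies a fundamental system for every a, hence solutions with arbitrary Cauchy
data, without a general existence theorem. -/
theorem exists_fundamental {m : ℕ} (hm : 1 ≤ m) (a : Fin m → ℂ) :
    ∃ u v, IsSolution a u ∧ IsSolution a v ∧ ∀ t, wr u v t ≠ 0 := by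
  obtain ⟨a', p, hp, rfl⟩ := exists_full_eq hm a
  obtain ⟨d, hd⟩ := exists_isFuchs hm a' hp
  exact ⟨_, _, hd.2.2.2.1, hd.2.2.2.2.1, fun t => by rw [hd.wr_eq hp]; exact wrFuchs_ne_zero p⟩

theorem IsSolution.deriv_linear_comb {m : ℕ} {a : Fin m → ℂ} {f g : ℂ → ℂ} (hf : IsSolution a f)
    (hg : IsSolution a g) (A B t : ℂ) :
    deriv (fun t => A * f t + B * g t) t = A * deriv f t + B * deriv g t :=
  (((hf.1 t).hasDerivAt.const_mul A).add ((hg.1 t).hasDerivAt.const_mul B)).deriv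

theorem exists_solution {m : ℕ} (hm : 1 ≤ m) (a : Fin m → ℂ) (T u₀ u₁ : ℂ) :
    ∃ f, IsSolution a f ∧ f T = u₀ ∧ deriv f T = u₁ := by
  obtain ⟨u, v, hu, hv, hW⟩ := exists_fundamental hm a
  have hw : u T * deriv v T - deriv u T * v T ≠ 0 := right_ne_zero_of_mul (hW T)
  refine ⟨_, hu.linear_comb hv ((u₀ * deriv v T - u₁ * v T) / (u T * deriv v T - deriv u T * v T))
    ((u T * u₁ - deriv u T * u₀) / (u T * deriv v T - deriv u T * v T)), ?_, ?_⟩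
  · rw [div_mul_eq_mul_div, div_mul_eq_mul_div, ← add_div, div_eq_iff hw]
    ring
  · rw [hu.deriv_linear_comb hv, div_mul_eq_mul_div, div_mul_eq_mul_div, ← add_div, div_eq_iff hw]
    ring

/-- Solutions with bounded Cauchy data have a convergent subsequence. -/
theorem exists_limit_solution {m : ℕ} (hm : 1 ≤ m) {a : Fin m → ℂ} {F : ℕ → ℂ → ℂ}
    (hF : ∀ n, IsSolution a (F n)) {t₀ : ℂ} {C : ℝ} (h0 : ∀ᶠ n in atTop, ‖F n t₀‖ ≤ C)
    (h1 : ∀ᶠ n in atTop, ‖deriv (F n) t₀‖ ≤ C) :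
    ∃ f, IsSolution a f ∧ ∃ φ : ℕ → ℕ, StrictMono φ ∧
      ∀ t, Tendsto (fun n => F (φ n) t) atTop (𝓝 (f t)) ∧
        Tendsto (fun n => deriv (F (φ n)) t) atTop (𝓝 (deriv f t)) := by
  obtain ⟨u, v, hu, hv, hW⟩ := exists_fundamental hm a
  set A : ℕ → ℂ := fun n => F n t₀
  set B : ℕ → ℂ := fun n => deriv (F n) t₀
  have hmem : ∃ᶠ n in atTop, (A n, B n) ∈ Metric.closedBall (0 : ℂ × ℂ) C := by
    refine ((h0.and h1).mono fun n hn => ?_).frequently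
    rw [mem_closedBall_zero_iff, Prod.norm_def]
    exact max_le hn.1 hn.2
  obtain ⟨⟨α, β⟩, -, φ, hφ, hlim⟩ :=
    tendsto_subseq_of_frequently_bounded Metric.isBounded_closedBall hmem
  have hA : Tendsto (fun n => F (φ n) t₀) atTop (𝓝 α) := (continuous_fst.tendsto _).comp hlim
  have hB : Tendsto (fun n => deriv (F (φ n)) t₀) atTop (𝓝 β) :=
    (continuous_snd.tendsto _).comp hlim
  have hc1 : Tendsto (fun n => wr (F (φ n)) v t₀ / wr u v t₀) atTop
      (𝓝 (Complex.exp (-t₀) * (α * deriv v t₀ - β * v t₀) / wr u v t₀)) :=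
    (((hA.mul_const _).sub (hB.mul_const _)).const_mul _).div_const _
  have hc2 : Tendsto (fun n => wr u (F (φ n)) t₀ / wr u v t₀) atTop
      (𝓝 (Complex.exp (-t₀) * (u t₀ * β - deriv u t₀ * α) / wr u v t₀)) :=
    (((hB.const_mul _).sub (hA.const_mul _)).const_mul _).div_const _
  refine ⟨_, hu.linear_comb hv (Complex.exp (-t₀) * (α * deriv v t₀ - β * v t₀) / wr u v t₀)
    (Complex.exp (-t₀) * (u t₀ * β - deriv u t₀ * α) / wr u v t₀), φ, hφ, fun t => ⟨?_, ?_⟩⟩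
  · exact ((hc1.mul_const (u t)).add (hc2.mul_const (v t))).congr fun n =>
      ((hF (φ n)).eq_linear_comb hu hv t₀ (hW t₀) t).symm
  · rw [hu.deriv_linear_comb hv]
    refine ((hc1.mul_const (deriv u t)).add (hc2.mul_const (deriv v t))).congr fun n => ?_
    rw [show F (φ n) = _ from funext ((hF (φ n)).eq_linear_comb hu hv t₀ (hW t₀)),
      hu.deriv_linear_comb hv, ← show F (φ n) = _ from
      funext ((hF (φ n)).eq_linear_comb hu hv t₀ (hW t₀))]

/-! ### Polynomial functions of the parameters -/

/-- Functions of the parameters given by a polynomial. -/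
def IsPoly {m : ℕ} (f : (Fin m → ℂ) → ℂ) : Prop :=
  ∃ p : MvPolynomial (Fin m) ℂ, ∀ a, MvPolynomial.eval a p = f a

theorem IsPoly.const {m : ℕ} (c : ℂ) : IsPoly (fun _ : Fin m → ℂ => c) :=
  ⟨MvPolynomial.C c, fun a => by simp⟩

theorem IsPoly.add {m : ℕ} {f g : (Fin m → ℂ) → ℂ} (hf : IsPoly f) (hg : IsPoly g) :
    IsPoly (fun a => f a + g a) := by
  obtain ⟨p, hp⟩ := hf
  obtain ⟨q, hq⟩ := hg
  exact ⟨p + q, fun a => by rw [map_add, hp, hq]⟩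

theorem IsPoly.sub {m : ℕ} {f g : (Fin m → ℂ) → ℂ} (hf : IsPoly f) (hg : IsPoly g) :
    IsPoly (fun a => f a - g a) := by
  obtain ⟨p, hp⟩ := hf
  obtain ⟨q, hq⟩ := hg
  exact ⟨p - q, fun a => by rw [map_sub, hp, hq]⟩

theorem IsPoly.mul {m : ℕ} {f g : (Fin m → ℂ) → ℂ} (hf : IsPoly f) (hg : IsPoly g) :
    IsPoly (fun a => f a * g a) := by
  obtain ⟨p, hp⟩ := hf
  obtain ⟨q, hq⟩ := hg
  exact ⟨p * q, fun a => by rw [map_mul, hp, hq]⟩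

theorem IsPoly.div_const {m : ℕ} {f : (Fin m → ℂ) → ℂ} (hf : IsPoly f) (c : ℂ) :
    IsPoly (fun a => f a / c) := by
  simp only [div_eq_mul_inv]
  exact hf.mul (IsPoly.const _)

theorem IsPoly.sum {m : ℕ} {ι : Type*} (s : Finset ι) {f : ι → (Fin m → ℂ) → ℂ}
    (hf : ∀ i ∈ s, IsPoly (f i)) : IsPoly (fun a => ∑ i ∈ s, f i a) := by
  classical
  induction s using Finset.induction_on with
  | empty => simpa using IsPoly.const 0
  | insert i s hi ih =>
    simp only [Finset.sum_insert hi]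
    exact (hf i (by simp)).add (ih fun j hj => hf j (by simp [hj]))

theorem IsPoly.ite {m : ℕ} (c : Prop) [Decidable c] {f g : (Fin m → ℂ) → ℂ} (hf : IsPoly f)
    (hg : IsPoly g) : IsPoly (fun a => if c then f a else g a) := by
  split_ifs
  · exact hf
  · exact hg

theorem IsPoly.continuous {m : ℕ} {f : (Fin m → ℂ) → ℂ} (hf : IsPoly f) : Continuous f := by
  obtain ⟨p, hp⟩ := hf
  rw [show f = fun a => MvPolynomial.eval a p from funext fun a => (hp a).symm]
  exact MvPolynomial.continuous_eval p

theorem IsPoly.differentiable {m : ℕ} {f : (Fin m → ℂ) → ℂ} (hf : IsPoly f) :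
    Differentiable ℂ f := by
  obtain ⟨p, hp⟩ := hf
  rw [show f = fun a => MvPolynomial.eval a p from funext fun a => (hp a).symm]
  clear hp
  induction p using MvPolynomial.induction_on with
  | C c => simp
  | add p q hp hq =>
    simp only [map_add]
    exact hp.add hq
  | mul_X p i hp =>
    simp only [map_mul, MvPolynomial.eval_X]
    exact hp.mul (by fun_prop)

theorem isPoly_coef {m : ℕ} (k : ℕ) : IsPoly (fun a : Fin m → ℂ => coef a k) := by
  cases k with
  | zero => exact IsPoly.const 1
  | succ k =>
    by_cases h : k < m
    · exact ⟨MvPolynomial.X ⟨k, h⟩, fun a => by simp [coef, h]⟩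
    · simpa [coef, h] using IsPoly.const 0

theorem sqrtCoef_zero {m : ℕ} (a : Fin m → ℂ) : sqrtCoef a 0 = 1 := by rw [sqrtCoef]

theorem isPoly_sqrtCoef {m : ℕ} (k : ℕ) : IsPoly (fun a : Fin m → ℂ => sqrtCoef a k) := by
  induction k using Nat.strong_induction_on with
  | _ k ih =>
  cases k with
  | zero =>
    simp only [sqrtCoef_zero]
    exact IsPoly.const 1
  | succ k =>
    have : (fun a : Fin m → ℂ => sqrtCoef a (k + 1)) = fun a => (coef a (k + 1)
        - ∑ j : Fin k, sqrtCoef a (j + 1) * sqrtCoef a (k - j)) / 2 := by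
      ext a; rw [sqrtCoef]
    rw [this]
    refine ((isPoly_coef _).sub (IsPoly.sum _ fun j _ => ?_)).div_const 2
    exact (ih _ (by omega)).mul (ih _ (by omega))

theorem isPoly_r {m : ℕ} : IsPoly (r (m := m)) := by
  rw [show r (m := m) = fun a => if Even m then 1 / 2 - (m : ℂ) / 4 - sqrtCoef a (m / 2)
    else 1 / 2 - (m : ℂ) / 4 from rfl]
  exact IsPoly.ite _ ((IsPoly.const _).sub (isPoly_sqrtCoef _)) (IsPoly.const _)

theorem sum_antidiagonal_sqrtCoef {m : ℕ} (a : Fin m → ℂ) (k : ℕ) :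
    ∑ x ∈ Finset.HasAntidiagonal.antidiagonal k, sqrtCoef a x.1 * sqrtCoef a x.2 = coef a k := by
  have := congrArg (PowerSeries.coeff k) (sqrtCoef_sq a)
  rw [pow_two, PowerSeries.coeff_mul] at this
  simpa using this

/-! ### The equation for the amplitude at infinity -/

/-- The truncation of `√(1 + a_1 u + ⋯)` that enters `S`. -/
noncomputable def sqrtTrunc {m : ℕ} (a : Fin m → ℂ) : Polynomial ℂ :=
  ∑ k ∈ Finset.range ((m + 1) / 2), Polynomial.monomial k (sqrtCoef a k)

theorem coeff_sqrtTrunc {m : ℕ} (a : Fin m → ℂ) (k : ℕ) :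
    (sqrtTrunc a).coeff k = if k < (m + 1) / 2 then sqrtCoef a k else 0 := by
  simp [sqrtTrunc, Polynomial.coeff_monomial]

/-- The coefficients of `1 + a_1 u + ⋯` minus the square of the truncated root. -/
noncomputable def rootDefect {m : ℕ} (k : ℕ) (a : Fin m → ℂ) : ℂ :=
  coef a k - (sqrtTrunc a ^ 2).coeff k

theorem isPoly_rootDefect {m : ℕ} (k : ℕ) : IsPoly (rootDefect (m := m) k) := by
  have : rootDefect (m := m) k = fun a => coef a k - ∑ x ∈ Finset.HasAntidiagonal.antidiagonal k,
      (if x.1 < (m + 1) / 2 then sqrtCoef a x.1 else 0)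
        * (if x.2 < (m + 1) / 2 then sqrtCoef a x.2 else 0) := by
    ext a
    rw [rootDefect, pow_two, Polynomial.coeff_mul]
    simp only [coeff_sqrtTrunc]
  rw [this]
  refine (isPoly_coef k).sub (IsPoly.sum _ fun x _ => ?_)
  exact (IsPoly.ite _ (isPoly_sqrtCoef _) (IsPoly.const 0)).mul
    (IsPoly.ite _ (isPoly_sqrtCoef _) (IsPoly.const 0))

/-- Below half the degree the truncation does not affect the square. -/
theorem rootDefect_eq_zero {m : ℕ} (a : Fin m → ℂ) {k : ℕ} (hk : k < (m + 1) / 2) :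
    rootDefect k a = 0 := by
  rw [rootDefect, pow_two, Polynomial.coeff_mul, ← sum_antidiagonal_sqrtCoef, sub_eq_zero]
  refine Finset.sum_congr rfl fun x hx => ?_
  rw [Finset.HasAntidiagonal.mem_antidiagonal] at hx
  rw [coeff_sqrtTrunc, coeff_sqrtTrunc, if_pos (by omega), if_pos (by omega)]

/-- For m = 2h the truncation removes only the term b_0 of index h, so exactly the two products
1·b_0 and b_0·1 are missing. This is the contribution that r(a) has to compensate. -/
theorem rootDefect_half {m : ℕ} (hm : 1 ≤ m) (he : Even m) (a : Fin m → ℂ) :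
    rootDefect (m / 2) a = 2 * sqrtCoef a (m / 2) := by
  obtain ⟨h, rfl⟩ := he
  have e1 : (h + h) / 2 = h := by omega
  have e2 : (h + h + 1) / 2 = h := by omega
  rw [rootDefect, pow_two, Polynomial.coeff_mul, ← sum_antidiagonal_sqrtCoef, e1,
    ← Finset.sum_sub_distrib]
  simp only [coeff_sqrtTrunc, e2]
  have hsub : ({(0, h), (h, 0)} : Finset (ℕ × ℕ)) ⊆ Finset.HasAntidiagonal.antidiagonal h := by
    intro x hx
    simp only [Finset.mem_insert, Finset.mem_singleton] at hx
    rcases hx with rfl | rfl <;> simp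
  rw [← Finset.sum_subset hsub]
  · rw [Finset.sum_pair (by simp; omega)]
    have : 0 < h := by omega
    simp [sqrtCoef_zero, this]
    ring
  · intro x hx hx'
    rw [Finset.HasAntidiagonal.mem_antidiagonal] at hx
    have h1 : x.1 < h := by
      by_contra hcon
      exact hx' (by simp only [Finset.mem_insert, Finset.mem_singleton]; right; ext <;> simp <;> omega)
    have h2 : x.2 < h := by
      by_contra hcon
      exact hx' (by simp only [Finset.mem_insert, Finset.mem_singleton]; left; ext <;> simp <;> omega)
    rw [if_pos h1, if_pos h2, sub_self]

/-- The power `x^{-n/2}` at `x = e^t`. -/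
noncomputable def qp (n : ℕ) (t : ℂ) : ℂ := Complex.exp (-((n : ℂ) / 2) * t)

theorem qp_mul (i j : ℕ) (t : ℂ) : qp i t * qp j t = qp (i + j) t := by
  rw [qp, qp, qp, ← Complex.exp_add]; congr 1; push_cast; ring

theorem norm_qp (n : ℕ) (t : ℂ) : ‖qp n t‖ = Real.exp (-((n : ℝ) / 2) * t.re) := by
  rw [qp, Complex.norm_exp]
  congr 1
  have : -((n : ℂ) / 2) * t = ((-((n : ℝ) / 2) : ℝ) : ℂ) * t := by push_cast; ring
  rw [this, Complex.re_ofReal_mul]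

theorem qp_zero (t : ℂ) : qp 0 t = 1 := by simp [qp]

theorem norm_qp_le {i j : ℕ} (h : i ≤ j) {t : ℂ} (ht : 0 ≤ t.re) : ‖qp j t‖ ≤ ‖qp i t‖ := by
  rw [norm_qp, norm_qp, Real.exp_le_exp]
  have : (i : ℝ) ≤ j := by exact_mod_cast h
  nlinarith

/-- The power `x^{m/2}` at `x = e^t`. -/
noncomputable def zz (m : ℕ) (t : ℂ) : ℂ := Complex.exp ((m : ℂ) / 2 * t)

theorem zz_mul_qp (m : ℕ) (t : ℂ) : zz m t * qp m t = 1 := by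
  rw [zz, qp, ← Complex.exp_add, ← Complex.exp_zero]; congr 1; ring

theorem zz_ne_zero (m : ℕ) (t : ℂ) : zz m t ≠ 0 := Complex.exp_ne_zero _

/-- The derivative `dS/dt`. -/
noncomputable def dS {m : ℕ} (a : Fin m → ℂ) (t : ℂ) : ℂ :=
  ∑ k ∈ Finset.range ((m + 1) / 2), sqrtCoef a k * Complex.exp (((m : ℂ) / 2 - k) * t)

/-- The second derivative `d²S/dt²`. -/
noncomputable def d2S {m : ℕ} (a : Fin m → ℂ) (t : ℂ) : ℂ :=
  ∑ k ∈ Finset.range ((m + 1) / 2),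
    ((m : ℂ) / 2 - k) * sqrtCoef a k * Complex.exp (((m : ℂ) / 2 - k) * t)

theorem hasDerivAt_exp_const_mul (c t : ℂ) :
    HasDerivAt (fun t => Complex.exp (c * t)) (c * Complex.exp (c * t)) t := by
  simpa [mul_comm] using ((hasDerivAt_id t).const_mul c).cexp

theorem hasDerivAt_S {m : ℕ} (a : Fin m → ℂ) (t : ℂ) : HasDerivAt (S a) (dS a t) t := by
  refine HasDerivAt.fun_sum fun k hk => ?_
  refine ((hasDerivAt_exp_const_mul _ t).const_mul _).congr_deriv ?_
  rw [Finset.mem_range] at hk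
  have : (m : ℂ) / 2 - k ≠ 0 := by
    intro h
    have : (m : ℂ) = ((2 * k : ℕ) : ℂ) := by push_cast; linear_combination 2 * h
    have : m = 2 * k := by exact_mod_cast this
    omega
  rw [← mul_assoc, div_mul_cancel₀ _ this]

theorem hasDerivAt_dS {m : ℕ} (a : Fin m → ℂ) (t : ℂ) : HasDerivAt (dS a) (d2S a t) t := by
  refine HasDerivAt.fun_sum fun k hk => ?_
  refine ((hasDerivAt_exp_const_mul _ t).const_mul _).congr_deriv ?_
  ring

/-- The coefficients of `x^{-m/2} (dS/dt - r + 1/2)` in powers of `x^{-1/2}`. -/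
noncomputable def ampA {m : ℕ} (i : ℕ) (a : Fin m → ℂ) : ℂ :=
  (∑ k ∈ Finset.range ((m + 1) / 2), if i = 2 * k then sqrtCoef a k else 0)
    + if i = m then 1 / 2 - r a else 0

/-- The coefficients of the potential in the equation for the amplitude. -/
noncomputable def ampB {m : ℕ} (i : ℕ) (a : Fin m → ℂ) : ℂ :=
  (∑ k ∈ Finset.range (m + 1), if i + m = 2 * k then rootDefect k a else 0)
    + (∑ k ∈ Finset.range ((m + 1) / 2), if i = 2 * k then
      (2 * r a - 1 + ((m : ℂ) / 2 - k)) * sqrtCoef a k else 0)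
    + if i = m then r a - r a ^ 2 else 0

theorem isPoly_ampA {m : ℕ} (i : ℕ) : IsPoly (ampA (m := m) i) :=
  (IsPoly.sum _ fun _ _ => IsPoly.ite _ (isPoly_sqrtCoef _) (IsPoly.const 0)).add
    (IsPoly.ite _ ((IsPoly.const _).sub isPoly_r) (IsPoly.const 0))

theorem isPoly_ampB {m : ℕ} (i : ℕ) : IsPoly (ampB (m := m) i) := by
  have : ampB (m := m) i = fun a => (∑ k ∈ Finset.range (m + 1), if i + m = 2 * k then
      rootDefect k a else 0) + (∑ k ∈ Finset.range ((m + 1) / 2), if i = 2 * k then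
      (2 * r a - 1 + ((m : ℂ) / 2 - k)) * sqrtCoef a k else 0)
      + if i = m then r a - r a * r a else 0 := by
    ext a; simp only [ampB, pow_two]
  rw [this]
  exact ((IsPoly.sum _ fun _ _ => IsPoly.ite _ (isPoly_rootDefect _) (IsPoly.const 0)).add
    (IsPoly.sum _ fun _ _ => IsPoly.ite _ (((((IsPoly.const 2).mul isPoly_r).sub
      (IsPoly.const 1)).add (IsPoly.const _)).mul (isPoly_sqrtCoef _)) (IsPoly.const 0))).add
    (IsPoly.ite _ (isPoly_r.sub (isPoly_r.mul isPoly_r)) (IsPoly.const 0))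

theorem ampA_zero {m : ℕ} (hm : 1 ≤ m) (a : Fin m → ℂ) : ampA 0 a = 1 := by
  rw [ampA, Finset.sum_eq_single 0]
  · have : 0 ≠ m := by omega
    simp [sqrtCoef_zero, this]
  · intro k _ hk
    rw [if_neg (by omega)]
  · intro h
    simp at h
    omega

/-- This is the reason for the definition of r: the leading coefficient of the potential is 2r - 1 +
m/2, plus 2b_0 for even m, and r is the value at which it vanishes. -/
theorem ampB_zero {m : ℕ} (hm : 1 ≤ m) (a : Fin m → ℂ) : ampB 0 a = 0 := by
  have h0 : 0 ≠ m := by omega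
  have h1 : (∑ k ∈ Finset.range ((m + 1) / 2), if 0 = 2 * k then
      (2 * r a - 1 + ((m : ℂ) / 2 - k)) * sqrtCoef a k else 0) = 2 * r a - 1 + (m : ℂ) / 2 := by
    rw [Finset.sum_eq_single 0]
    · simp [sqrtCoef_zero]
    · intro k _ hk
      rw [if_neg (by omega)]
    · intro h
      simp at h
      omega
  rw [ampB, h1, if_neg h0]
  by_cases he : Even m
  · rw [Finset.sum_eq_single (m / 2), if_pos (by obtain ⟨h, rfl⟩ := he; omega),
      rootDefect_half hm he, r, if_pos he]
    · ring
    · intro k _ hk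
      rw [if_neg (by omega)]
    · intro h
      simp at h
      omega
  · rw [Finset.sum_eq_zero, r, if_neg he]
    · ring
    · intro k _
      rw [if_neg]
      intro h
      exact he ⟨k, by omega⟩

theorem ampA_of_lt {m : ℕ} (a : Fin m → ℂ) {i : ℕ} (hi : m < i) : ampA i a = 0 := by
  rw [ampA, Finset.sum_eq_zero, if_neg (by omega), add_zero]
  intro k hk
  rw [Finset.mem_range] at hk
  rw [if_neg (by omega)]

theorem ampB_of_lt {m : ℕ} (a : Fin m → ℂ) {i : ℕ} (hi : m < i) : ampB i a = 0 := by
  rw [ampB, Finset.sum_eq_zero, Finset.sum_eq_zero, if_neg (by omega), add_zero, add_zero]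
  · intro k hk
    rw [Finset.mem_range] at hk
    rw [if_neg (by omega)]
  · intro k hk
    rw [Finset.mem_range] at hk
    rw [if_neg (by omega)]

theorem ampA_odd {m : ℕ} (he : Even m) (a : Fin m → ℂ) {i : ℕ} (hi : Odd i) : ampA i a = 0 := by
  obtain ⟨j, rfl⟩ := hi
  obtain ⟨h, hh⟩ := he
  rw [ampA, Finset.sum_eq_zero, if_neg (by omega), add_zero]
  intro k _
  rw [if_neg (by omega)]

theorem ampB_odd {m : ℕ} (he : Even m) (a : Fin m → ℂ) {i : ℕ} (hi : Odd i) : ampB i a = 0 := by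
  obtain ⟨j, rfl⟩ := hi
  obtain ⟨h, hh⟩ := he
  rw [ampB, Finset.sum_eq_zero, Finset.sum_eq_zero, if_neg (by omega), add_zero, add_zero]
  · intro k _
    rw [if_neg (by omega)]
  · intro k _
    rw [if_neg (by omega)]

theorem sum_range_sum_ite {ι : Type*} (s : Finset ι) (n : ℕ) (g : ι → ℕ) (f : ι → ℂ) (h : ℕ → ℂ)
    (hg : ∀ k ∈ s, g k < n) :
    ∑ i ∈ Finset.range n, (∑ k ∈ s, if i = g k then f k else 0) * h i
      = ∑ k ∈ s, f k * h (g k) := by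
  simp only [Finset.sum_mul]
  rw [Finset.sum_comm]
  refine Finset.sum_congr rfl fun k hk => ?_
  rw [Finset.sum_eq_single (g k)]
  · rw [if_pos rfl]
  · intro i _ hi
    rw [if_neg hi, zero_mul]
  · intro h
    exact absurd (Finset.mem_range.2 (hg k hk)) h

/-- `x^{-m/2} (dS/dt - r + 1/2)`. -/
noncomputable def fA {m : ℕ} (a : Fin m → ℂ) (t : ℂ) : ℂ :=
  ∑ i ∈ Finset.range (m + 1), ampA i a * qp i t

/-- `x^{-m/2}` times the potential in the equation for the amplitude. -/
noncomputable def fB {m : ℕ} (a : Fin m → ℂ) (t : ℂ) : ℂ :=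
  ∑ i ∈ Finset.range (m + 1), ampB i a * qp i t

theorem zz_mul_qp_two_mul (m k : ℕ) (t : ℂ) :
    zz m t * qp (2 * k) t = Complex.exp (((m : ℂ) / 2 - k) * t) := by
  rw [zz, qp, ← Complex.exp_add]; congr 1; push_cast; ring

theorem zz_mul_fA {m : ℕ} (a : Fin m → ℂ) (t : ℂ) :
    zz m t * fA a t = dS a t - r a + 1 / 2 := by
  have e1 : fA a t = ∑ k ∈ Finset.range ((m + 1) / 2), sqrtCoef a k * qp (2 * k) t
      + (1 / 2 - r a) * qp m t := by
    simp only [fA, ampA, add_mul, Finset.sum_add_distrib]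
    congr 1
    · refine sum_range_sum_ite _ _ _ _ _ fun k hk => ?_
      rw [Finset.mem_range] at hk
      omega
    · rw [Finset.sum_eq_single m]
      · rw [if_pos rfl]
      · intro i _ hi
        rw [if_neg hi, zero_mul]
      · simp
  rw [e1, mul_add, mul_left_comm, zz_mul_qp, Finset.mul_sum, dS]
  rw [Finset.sum_congr rfl fun k _ => by rw [mul_left_comm, zz_mul_qp_two_mul]]
  ring

theorem dS_eq {m : ℕ} (a : Fin m → ℂ) (t : ℂ) :
    dS a t = zz m t * (sqrtTrunc a).eval (qp 2 t) := by
  rw [sqrtTrunc, Polynomial.eval_finsetSum, Finset.mul_sum, dS]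
  refine Finset.sum_congr rfl fun k _ => ?_
  rw [Polynomial.eval_monomial, mul_left_comm, ← zz_mul_qp_two_mul]
  congr 2
  rw [qp, qp, ← Complex.exp_nat_mul]
  congr 1
  push_cast
  ring

theorem P_sub_dS_sq {m : ℕ} (a : Fin m → ℂ) (t : ℂ) :
    P a (Complex.exp t) - dS a t ^ 2
      = ∑ k ∈ Finset.range (m + 1), rootDefect k a * Complex.exp (((m : ℂ) - k) * t) := by
  -- The square of the truncation has degree at most m - 1, so the sum over k ≤ m loses nothing.
  have hdeg : (sqrtTrunc a ^ 2).natDegree < m + 1 := by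
    have h1 : (sqrtTrunc a).natDegree ≤ (m + 1) / 2 - 1 := by
      refine Polynomial.natDegree_le_iff_coeff_eq_zero.2 fun k hk => ?_
      rw [coeff_sqrtTrunc, if_neg (by omega)]
    have h2 := Polynomial.natDegree_pow_le (p := sqrtTrunc a) (n := 2)
    omega
  rw [dS_eq, mul_pow, ← Polynomial.eval_pow, Polynomial.eval_eq_sum_range' hdeg, P,
    Finset.mul_sum, ← Finset.sum_sub_distrib]
  refine Finset.sum_congr rfl fun k hk => ?_
  rw [Finset.mem_range] at hk
  have e1 : Complex.exp t ^ (m - k) = Complex.exp (((m : ℂ) - k) * t) := by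
    rw [← Complex.exp_nat_mul, Nat.cast_sub (by omega)]
  have e2 : zz m t ^ 2 * qp 2 t ^ k = Complex.exp (((m : ℂ) - k) * t) := by
    rw [zz, qp, ← Complex.exp_nat_mul, ← Complex.exp_nat_mul, ← Complex.exp_add]
    congr 1
    push_cast
    ring
  rw [e1, mul_left_comm, e2, rootDefect]
  ring

theorem zz_mul_fB {m : ℕ} (a : Fin m → ℂ) (t : ℂ) :
    zz m t * fB a t = P a (Complex.exp t) - dS a t ^ 2 + (2 * r a - 1) * dS a t + d2S a t
      + (r a - r a ^ 2) := by
  have e1 : fB a t = ∑ i ∈ Finset.range (m + 1), (∑ k ∈ Finset.range (m + 1),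
        if i + m = 2 * k then rootDefect k a else 0) * qp i t
      + ∑ k ∈ Finset.range ((m + 1) / 2),
        ((2 * r a - 1 + ((m : ℂ) / 2 - k)) * sqrtCoef a k) * qp (2 * k) t
      + (r a - r a ^ 2) * qp m t := by
    simp only [fB, ampB, add_mul, Finset.sum_add_distrib]
    congr 1
    · congr 1
      rw [← Finset.sum_add_distrib]
      simp only [← add_mul]
      refine sum_range_sum_ite _ _ _ _ _ fun k hk => ?_
      rw [Finset.mem_range] at hk
      omega
    · rw [Finset.sum_eq_single m]
      · rw [if_pos rfl]
      · intro i _ hi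
        rw [if_neg hi, zero_mul]
      · simp
  have e2 : zz m t * ∑ i ∈ Finset.range (m + 1), (∑ k ∈ Finset.range (m + 1),
        if i + m = 2 * k then rootDefect k a else 0) * qp i t
      = P a (Complex.exp t) - dS a t ^ 2 := by
    rw [P_sub_dS_sq, Finset.mul_sum]
    simp only [Finset.sum_mul, Finset.mul_sum]
    rw [Finset.sum_comm]
    refine Finset.sum_congr rfl fun k hk => ?_
    rw [Finset.mem_range] at hk
    -- Defects with 2k < m would contribute powers beyond x^{m/2}, but they vanish; the others
    -- contribute at i = 2k - m.
    by_cases hkm : m ≤ 2 * k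
    · rw [Finset.sum_eq_single (2 * k - m)]
      · rw [if_pos (by omega), mul_left_comm]
        congr 1
        rw [zz, qp, ← Complex.exp_add, Nat.cast_sub hkm]
        congr 1
        push_cast
        ring
      · intro i _ hi
        rw [if_neg (by omega), zero_mul, mul_zero]
      · intro h
        simp at h
        omega
    · rw [rootDefect_eq_zero a (by omega)]
      simp
  rw [e1, mul_add, mul_add, e2, mul_left_comm, zz_mul_qp, Finset.mul_sum]
  rw [Finset.sum_congr rfl fun k _ => by rw [mul_left_comm, zz_mul_qp_two_mul]]
  simp only [add_mul, Finset.sum_add_distrib, sub_mul, Finset.sum_sub_distrib]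
  simp only [dS, d2S, Finset.mul_sum, sub_mul, Finset.sum_sub_distrib]
  simp only [mul_assoc, one_mul]
  ring

/-- The amplitude of `f` relative to `x^r e^{-S}`. -/
noncomputable def amp {m : ℕ} (a : Fin m → ℂ) (f : ℂ → ℂ) (t : ℂ) : ℂ :=
  f t * Complex.exp (S a t - r a * t)

theorem hasDerivAt_phase {m : ℕ} (a : Fin m → ℂ) (t : ℂ) :
    HasDerivAt (fun t => Complex.exp (S a t - r a * t))
      (Complex.exp (S a t - r a * t) * (dS a t - r a)) t := by
  have := ((hasDerivAt_S a t).sub ((hasDerivAt_id' t).const_mul (r a))).cexp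
  simpa using this

theorem hasDerivAt_amp {m : ℕ} (a : Fin m → ℂ) {f : ℂ → ℂ} (hf : Differentiable ℂ f) (t : ℂ) :
    HasDerivAt (amp a f)
      (Complex.exp (S a t - r a * t) * (deriv f t + (dS a t - r a) * f t)) t := by
  refine ((hf t).hasDerivAt.mul (hasDerivAt_phase a t)).congr_deriv ?_
  ring

theorem deriv_amp {m : ℕ} (a : Fin m → ℂ) {f : ℂ → ℂ} (hf : Differentiable ℂ f) (t : ℂ) :
    deriv (amp a f) t
      = Complex.exp (S a t - r a * t) * (deriv f t + (dS a t - r a) * f t) :=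
  (hasDerivAt_amp a hf t).deriv

theorem differentiable_amp {m : ℕ} (a : Fin m → ℂ) {f : ℂ → ℂ} (hf : Differentiable ℂ f) :
    Differentiable ℂ (amp a f) := fun t => (hasDerivAt_amp a hf t).differentiableAt

/-- The equation for the amplitude. -/
theorem IsSolution.deriv2_amp {m : ℕ} {a : Fin m → ℂ} {f : ℂ → ℂ} (hf : IsSolution a f) (t : ℂ) :
    deriv (deriv (amp a f)) t
      = zz m t * (2 * fA a t * deriv (amp a f) t + fB a t * amp a f t) := by
  have h1 : deriv (amp a f) = fun t => Complex.exp (S a t - r a * t)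
      * (deriv f t + (dS a t - r a) * f t) := funext (deriv_amp a hf.1)
  have h2 := (hasDerivAt_phase a t).mul ((differentiable_deriv hf.1 t).hasDerivAt.add
    (((hasDerivAt_dS a t).sub_const (r a)).mul (hf.1 t).hasDerivAt))
  have h3 := (congrArg (fun g => deriv g t) h1).trans h2.deriv
  rw [h3, h1, hf.deriv2]
  have e1 : zz m t * (2 * fA a t * (Complex.exp (S a t - r a * t)
      * (deriv f t + (dS a t - r a) * f t)) + fB a t * amp a f t)
      = 2 * (zz m t * fA a t) * (Complex.exp (S a t - r a * t)
      * (deriv f t + (dS a t - r a) * f t)) + (zz m t * fB a t) * amp a f t := by ring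
  rw [e1, zz_mul_fA, zz_mul_fB, amp]
  simp only [Pi.add_apply, Pi.mul_apply]
  ring

theorem exp_phase_mul {m : ℕ} (a : Fin m → ℂ) (t : ℂ) :
    Complex.exp (S a t - r a * t) * Complex.exp (r a * t - S a t) = 1 := by
  rw [← Complex.exp_add, ← Complex.exp_zero]; congr 1; ring

/-- Solutions with prescribed Cauchy data for the amplitude. -/
theorem exists_solution_amp {m : ℕ} (hm : 1 ≤ m) (a : Fin m → ℂ) (T v₀ v₁ : ℂ) :
    ∃ f, IsSolution a f ∧ amp a f T = v₀ ∧ deriv (amp a f) T = v₁ := by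
  obtain ⟨f, hf, h0, h1⟩ := exists_solution hm a T (Complex.exp (r a * T - S a T) * v₀)
    (Complex.exp (r a * T - S a T) * (v₁ - (dS a T - r a) * v₀))
  refine ⟨f, hf, ?_, ?_⟩
  · rw [amp, h0]
    linear_combination v₀ * exp_phase_mul a T
  · rw [deriv_amp a hf.1, h0, h1]
    linear_combination v₁ * exp_phase_mul a T

/-! ### The formal solution at infinity -/

/-- The coefficients of the recursion for the formal amplitude. -/
noncomputable def recCoef {m : ℕ} (i j : ℕ) (a : Fin m → ℂ) : ℂ :=
  ampB i a - j * ampA i a - if i = m then (j : ℂ) ^ 2 / 4 else 0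

/-- The coefficients of the formal amplitude. -/
noncomputable def ampCoef {m : ℕ} (a : Fin m → ℂ) : ℕ → ℂ
  | 0 => 1
  | n + 1 => (∑ j : Fin (n + 1), recCoef (n + 1 - j) j a * ampCoef a j) / (n + 1)

theorem ampCoef_zero {m : ℕ} (a : Fin m → ℂ) : ampCoef a 0 = 1 := by rw [ampCoef]

theorem ampCoef_succ {m : ℕ} (a : Fin m → ℂ) (n : ℕ) : ampCoef a (n + 1)
    = (∑ j ∈ Finset.range (n + 1), recCoef (n + 1 - j) j a * ampCoef a j) / (n + 1) := by
  rw [ampCoef, ← Fin.sum_univ_eq_sum_range (fun j => recCoef (n + 1 - j) j a * ampCoef a j)]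

theorem isPoly_recCoef {m : ℕ} (i j : ℕ) : IsPoly (recCoef (m := m) i j) :=
  ((isPoly_ampB i).sub ((IsPoly.const _).mul (isPoly_ampA i))).sub
    (IsPoly.ite _ (IsPoly.const _) (IsPoly.const 0))

theorem isPoly_ampCoef {m : ℕ} (n : ℕ) : IsPoly (fun a : Fin m → ℂ => ampCoef a n) := by
  induction n using Nat.strong_induction_on with
  | _ n ih =>
  cases n with
  | zero => simpa only [ampCoef_zero] using IsPoly.const 1
  | succ n =>
    simp only [ampCoef_succ]
    exact (IsPoly.sum _ fun j hj => (isPoly_recCoef _ _).mul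
      (ih j (Finset.mem_range.1 hj))).div_const _

theorem recCoef_of_lt {m : ℕ} (a : Fin m → ℂ) {i : ℕ} (j : ℕ) (hi : m < i) : recCoef i j a = 0 := by
  rw [recCoef, ampA_of_lt a hi, ampB_of_lt a hi, if_neg (by omega)]
  ring

theorem ampCoef_odd {m : ℕ} (he : Even m) (a : Fin m → ℂ) {n : ℕ} (hn : Odd n) :
    ampCoef a n = 0 := by
  induction n using Nat.strong_induction_on with
  | _ n ih =>
  cases n with
  | zero => simp at hn
  | succ n =>
    rw [ampCoef_succ, Finset.sum_eq_zero, zero_div]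
    intro j hj
    rw [Finset.mem_range] at hj
    rcases Nat.even_or_odd j with hj' | hj'
    · have h1 : Odd (n + 1 - j) := Nat.Odd.sub_even hj.le hn hj'
      rw [recCoef, ampA_odd he a h1, ampB_odd he a h1, if_neg]
      · ring
      · intro h
        rw [h] at h1
        exact (Nat.not_odd_iff_even.2 he) h1
    · rw [ih j hj hj', mul_zero]

/-- Because A starts with 1 and B with 0, the diagonal coefficient is -l; hence the formal series is
determined by division by l, and its coefficients stay polynomial in a. -/
theorem sum_recCoef_eq_zero {m : ℕ} (hm : 1 ≤ m) (a : Fin m → ℂ) (l : ℕ) :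
    ∑ n ∈ Finset.range (l + 1), recCoef (l - n) n a * ampCoef a n = 0 := by
  have h0 : recCoef 0 l a = -l := by
    rw [recCoef, ampA_zero hm, ampB_zero hm, if_neg (by omega)]
    ring
  rw [Finset.sum_range_succ, Nat.sub_self, h0]
  cases l with
  | zero => simp
  | succ l =>
    rw [ampCoef_succ]
    have : ((l + 1 : ℕ) : ℂ) ≠ 0 := by exact_mod_cast l.succ_ne_zero
    push_cast at this ⊢
    field_simp
    ring

/-- The partial sums of the formal amplitude. -/
noncomputable def ampSum {m : ℕ} (N : ℕ) (a : Fin m → ℂ) (t : ℂ) : ℂ :=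
  ∑ n ∈ Finset.range N, ampCoef a n * qp n t

theorem hasDerivAt_qp (n : ℕ) (t : ℂ) : HasDerivAt (qp n) (-((n : ℂ) / 2) * qp n t) t :=
  hasDerivAt_exp_const_mul _ t

/-- The derivative of the partial sums. -/
noncomputable def dAmpSum {m : ℕ} (N : ℕ) (a : Fin m → ℂ) (t : ℂ) : ℂ :=
  ∑ n ∈ Finset.range N, ampCoef a n * (-((n : ℂ) / 2) * qp n t)

theorem hasDerivAt_ampSum {m : ℕ} (N : ℕ) (a : Fin m → ℂ) (t : ℂ) :
    HasDerivAt (ampSum N a) (dAmpSum N a t) t :=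
  HasDerivAt.fun_sum fun n _ => (hasDerivAt_qp n t).const_mul _

theorem hasDerivAt_dAmpSum {m : ℕ} (N : ℕ) (a : Fin m → ℂ) (t : ℂ) :
    HasDerivAt (dAmpSum N a)
      (∑ n ∈ Finset.range N, ampCoef a n * (-((n : ℂ) / 2) * (-((n : ℂ) / 2) * qp n t))) t :=
  HasDerivAt.fun_sum fun n _ => ((hasDerivAt_qp n t).const_mul _).const_mul _

/-- The coefficients of the residual of the partial sums. -/
noncomputable def resCoef {m : ℕ} (N : ℕ) (l : ℕ) (a : Fin m → ℂ) : ℂ :=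
  ∑ n ∈ Finset.range N, if n ≤ l then recCoef (l - n) n a * ampCoef a n else 0

theorem isPoly_resCoef {m : ℕ} (N l : ℕ) : IsPoly (resCoef (m := m) N l) :=
  IsPoly.sum _ fun _ _ => IsPoly.ite _ ((isPoly_recCoef _ _).mul (isPoly_ampCoef _)) (IsPoly.const 0)

theorem resCoef_of_lt {m : ℕ} (hm : 1 ≤ m) (a : Fin m → ℂ) {N l : ℕ} (hl : l < N) :
    resCoef N l a = 0 := by
  rw [← sum_recCoef_eq_zero hm a l, resCoef, ← Finset.sum_subset (Finset.range_mono (Nat.succ_le_of_lt hl))]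
  · refine Finset.sum_congr rfl fun n hn => ?_
    rw [Finset.mem_range] at hn
    rw [if_pos (by omega)]
  · intro n _ hn
    rw [Finset.mem_range] at hn
    rw [if_neg (by omega)]

/-- On x^{-n/2} the operator acts as -x^{m/2} (B - nA - (n²/4) x^{-m/2}) x^{-n/2}, the last term
being the second derivative. With `resCoef_of_lt` this shows that the N-th partial sum leaves an
error of relative size x^{-N/2}. -/
theorem residual_eq {m : ℕ} (N : ℕ) (a : Fin m → ℂ) (t : ℂ) :
    (∑ n ∈ Finset.range N, ampCoef a n * (-((n : ℂ) / 2) * (-((n : ℂ) / 2) * qp n t)))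
      - zz m t * (2 * fA a t * dAmpSum N a t + fB a t * ampSum N a t)
    = -(zz m t * ∑ l ∈ Finset.range (N + m + 1), resCoef N l a * qp l t) := by
  have h1 : ∀ n < N, ∑ l ∈ Finset.range (N + m + 1),
      (if n ≤ l then recCoef (l - n) n a * ampCoef a n else 0) * qp l t
      = ampCoef a n * qp n t * (fB a t - n * fA a t - (n : ℂ) ^ 2 / 4 * qp m t) := by
    intro n hn
    have e1 : fB a t - n * fA a t - (n : ℂ) ^ 2 / 4 * qp m t
        = ∑ i ∈ Finset.range (m + 1), recCoef i n a * qp i t := by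
      simp only [recCoef, sub_mul, Finset.sum_sub_distrib, fA, fB, Finset.mul_sum, mul_assoc]
      congr 1
      rw [Finset.sum_eq_single m]
      · rw [if_pos rfl]
      · intro i _ hi
        rw [if_neg hi, zero_mul]
      · simp
    rw [e1, show N + m + 1 = n + (m + 1 + (N - n)) by omega, Finset.sum_range_add,
      Finset.sum_eq_zero, zero_add, Finset.sum_range_add, Finset.mul_sum]
    · rw [Finset.sum_eq_zero (s := Finset.range (N - n)), add_zero]
      · refine Finset.sum_congr rfl fun i _ => ?_
        rw [if_pos (by omega), Nat.add_sub_cancel_left, ← qp_mul]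
        ring
      · intro i _
        rw [recCoef_of_lt a n (by omega)]
        simp
    · intro l hl
      rw [Finset.mem_range] at hl
      rw [if_neg (by omega), zero_mul]
  have h2 : ∑ l ∈ Finset.range (N + m + 1), resCoef N l a * qp l t
      = ∑ n ∈ Finset.range N, ampCoef a n * qp n t *
        (fB a t - n * fA a t - (n : ℂ) ^ 2 / 4 * qp m t) := by
    simp only [resCoef, Finset.sum_mul]
    rw [Finset.sum_comm]
    exact Finset.sum_congr rfl fun n hn => h1 n (Finset.mem_range.1 hn)
  rw [h2, ampSum, dAmpSum]
  simp only [Finset.mul_sum, ← Finset.sum_add_distrib, ← Finset.sum_sub_distrib,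
    ← Finset.sum_neg_distrib]
  refine Finset.sum_congr rfl fun n _ => ?_
  linear_combination (-(ampCoef a n * qp n t * (n : ℂ) ^ 2 / 4)) * zz_mul_qp m t

/-! ### Bounds that are uniform on compact sets of parameters -/

theorem IsPoly.exists_bound {m : ℕ} {f : (Fin m → ℂ) → ℂ} (hf : IsPoly f)
    {K : Set (Fin m → ℂ)} (hK : IsCompact K) : ∃ C : ℝ, 0 ≤ C ∧ ∀ a ∈ K, ‖f a‖ ≤ C := by
  obtain ⟨C, hC⟩ := hK.exists_bound_of_continuousOn hf.continuous.continuousOn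
  exact ⟨max C 0, le_max_right _ _, fun a ha => (hC a ha).trans (le_max_left _ _)⟩

theorem exists_sum_bound {m : ℕ} {f : ℕ → (Fin m → ℂ) → ℂ} (hf : ∀ n, IsPoly (f n))
    {K : Set (Fin m → ℂ)} (hK : IsCompact K) (L N : ℕ) (hN : ∀ a ∈ K, ∀ l < N, f l a = 0) :
    ∃ C : ℝ, 0 ≤ C ∧ ∀ a ∈ K, ∀ t : ℂ, 0 ≤ t.re →
      ‖∑ l ∈ Finset.range L, f l a * qp l t‖ ≤ C * ‖qp N t‖ := by
  choose C hC hb using fun n => (hf n).exists_bound hK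
  refine ⟨∑ l ∈ Finset.range L, C l, Finset.sum_nonneg fun l _ => hC l, fun a ha t ht => ?_⟩
  rw [Finset.sum_mul]
  refine (norm_sum_le _ _).trans (Finset.sum_le_sum fun l _ => ?_)
  rw [norm_mul]
  by_cases hl : l < N
  · rw [hN a ha l hl, norm_zero, zero_mul]
    exact mul_nonneg (hC l) (norm_nonneg _)
  · exact mul_le_mul (hb l a ha) (norm_qp_le (by omega) ht) (norm_nonneg _) (hC l)

theorem exists_bound_fA {m : ℕ} (hm : 1 ≤ m) {K : Set (Fin m → ℂ)} (hK : IsCompact K) :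
    ∃ C : ℝ, 0 ≤ C ∧ ∀ a ∈ K, ∀ t : ℂ, 0 ≤ t.re → ‖fA a t - 1‖ ≤ C * ‖qp 1 t‖ := by
  obtain ⟨C, hC, hb⟩ := exists_sum_bound (f := fun n a => ampA n a - if n = 0 then 1 else 0)
    (fun n => (isPoly_ampA n).sub (IsPoly.ite _ (IsPoly.const 1) (IsPoly.const 0))) hK (m + 1) 1
    (fun a _ l hl => by
      have : l = 0 := by omega
      subst this
      simp [ampA_zero hm])
  refine ⟨C, hC, fun a ha t ht => ?_⟩
  convert! hb a ha t ht using 2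
  simp only [sub_mul, Finset.sum_sub_distrib, fA]
  congr 1
  rw [Finset.sum_eq_single 0]
  · simp [qp_zero]
  · intro i _ hi
    simp [hi]
  · simp

theorem exists_bound_fB {m : ℕ} (hm : 1 ≤ m) {K : Set (Fin m → ℂ)} (hK : IsCompact K) :
    ∃ C : ℝ, 0 ≤ C ∧ ∀ a ∈ K, ∀ t : ℂ, 0 ≤ t.re → ‖fB a t‖ ≤ C * ‖qp 1 t‖ :=
  exists_sum_bound (isPoly_ampB) hK (m + 1) 1 fun a _ l hl => by
    have : l = 0 := by omega
    subst this
    exact ampB_zero hm a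

theorem exists_bound_residual {m : ℕ} (hm : 1 ≤ m) {K : Set (Fin m → ℂ)} (hK : IsCompact K)
    (N : ℕ) : ∃ C : ℝ, 0 ≤ C ∧ ∀ a ∈ K, ∀ t : ℂ, 0 ≤ t.re →
      ‖(∑ n ∈ Finset.range N, ampCoef a n * (-((n : ℂ) / 2) * (-((n : ℂ) / 2) * qp n t)))
      - zz m t * (2 * fA a t * dAmpSum N a t + fB a t * ampSum N a t)‖
      ≤ C * ‖zz m t‖ * ‖qp N t‖ := by
  obtain ⟨C, hC, hb⟩ := exists_sum_bound (fun l => isPoly_resCoef (m := m) N l) hK (N + m + 1) N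
    (fun a _ l hl => resCoef_of_lt hm a hl)
  refine ⟨C, hC, fun a ha t ht => ?_⟩
  rw [residual_eq, norm_neg, norm_mul, mul_comm C, mul_assoc]
  gcongr
  exact hb a ha t ht

/-! ### A priori estimates along paths -/

theorem deriv_nonpos_of_isMaxOn_Icc {ρ : ℝ → ℝ} {ρ' s : ℝ} (hs : s ∈ Set.Icc (0 : ℝ) 1)
    (hs1 : s ≠ 1) (hmax : ∀ u ∈ Set.Icc (0 : ℝ) 1, ρ u ≤ ρ s) (hd : HasDerivAt ρ ρ' s) :
    ρ' ≤ 0 := by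
  have hlt : s < 1 := lt_of_le_of_ne hs.2 hs1
  have h1 : Tendsto (slope ρ s) (𝓝[>] s) (𝓝 ρ') :=
    hd.tendsto_slope.mono_left (nhdsWithin_mono _ fun u hu => ne_of_gt hu)
  refine le_of_tendsto h1 ?_
  filter_upwards [Ioo_mem_nhdsGT hlt] with u hu
  rw [slope_def_field]
  have h2 : ρ u ≤ ρ s := hmax u ⟨hs.1.trans hu.1.le, hu.2.le⟩
  exact div_nonpos_of_nonpos_of_nonneg (by linarith) (by linarith [hu.1])

/-- The square of the ratio ‖U‖/φ is differentiable and attains its maximum. Unless this happens at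
s = 1, the right derivative there is nonpositive, which also covers a maximum at s = 0. -/
theorem exists_max_ratio {U U' : ℝ → ℂ} {φ φ' : ℝ → ℝ}
    (hU : ∀ s ∈ Set.Icc (0 : ℝ) 1, HasDerivAt U (U' s) s)
    (hφ : ∀ s ∈ Set.Icc (0 : ℝ) 1, HasDerivAt φ (φ' s) s)
    (hpos : ∀ s ∈ Set.Icc (0 : ℝ) 1, 0 < φ s) :
    ∃ s ∈ Set.Icc (0 : ℝ) 1, (∀ u ∈ Set.Icc (0 : ℝ) 1, ‖U u‖ ≤ ‖U s‖ / φ s * φ u) ∧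
      (s = 1 ∨ inner ℝ (U s) (U' s) * φ s ≤ ‖U s‖ ^ 2 * φ' s) := by
  set ρ : ℝ → ℝ := fun s => ‖U s‖ ^ 2 / φ s ^ 2 with hρ
  have hd : ∀ s ∈ Set.Icc (0 : ℝ) 1, HasDerivAt ρ ((2 * inner ℝ (U s) (U' s) * φ s ^ 2
      - ‖U s‖ ^ 2 * (2 * φ s * φ' s)) / (φ s ^ 2) ^ 2) s := by
    intro s hs
    have h2 : HasDerivAt (fun s => φ s ^ 2) (2 * φ s * φ' s) s := by
      refine ((hφ s hs).pow 2).congr_deriv ?_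
      simp
    exact (hU s hs).norm_sq.div h2 (pow_ne_zero 2 (hpos s hs).ne')
  obtain ⟨s, hs, hmax⟩ := isCompact_Icc.exists_isMaxOn (Set.nonempty_Icc.2 zero_le_one)
    (fun s hs => (hd s hs).continuousAt.continuousWithinAt)
  refine ⟨s, hs, fun u hu => ?_, ?_⟩
  · have h1 : ρ u ≤ ρ s := hmax hu
    have h2 : (‖U u‖ / φ u) ^ 2 ≤ (‖U s‖ / φ s) ^ 2 := by rw [div_pow, div_pow]; exact h1
    have h3 := (pow_le_pow_iff_left₀ (div_nonneg (norm_nonneg _) (hpos u hu).le)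
      (div_nonneg (norm_nonneg _) (hpos s hs).le) two_ne_zero).1 h2
    rwa [div_le_iff₀ (hpos u hu)] at h3
  · by_cases hs1 : s = 1
    · exact Or.inl hs1
    · right
      have hm' : ∀ u ∈ Set.Icc (0 : ℝ) 1, ρ u ≤ ρ s := isMaxOn_iff.1 hmax
      have h1 := deriv_nonpos_of_isMaxOn_Icc hs hs1 hm' (hd s hs)
      have hp := hpos s hs
      have h1 := (div_nonpos_iff.1 h1).resolve_left
        (fun h => absurd (h.2.trans_lt' (by positivity : 0 < (φ s ^ 2) ^ 2)) (lt_irrefl _))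
      have h1 := h1.1
      have h2 : 2 * φ s * (inner ℝ (U s) (U' s) * φ s - ‖U s‖ ^ 2 * φ' s) ≤ 0 := by
        linarith
      by_contra hcon
      push Not at hcon
      have : 0 < 2 * φ s * (inner ℝ (U s) (U' s) * φ s - ‖U s‖ ^ 2 * φ' s) :=
        mul_pos (by positivity) (by linarith)
      linarith

/-- Backward estimate for a system with one expanding component `Y`, weighted by a decreasing
function `φ`. -/
theorem norm_le_of_expanding {W W' Y Y' : ℝ → ℂ} {φ φ' lam : ℝ → ℝ} {κ C d η B Λ D : ℝ}
    (hW : ∀ s ∈ Set.Icc (0 : ℝ) 1, HasDerivAt W (W' s) s)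
    (hY : ∀ s ∈ Set.Icc (0 : ℝ) 1, HasDerivAt Y (Y' s) s)
    (hφ : ∀ s ∈ Set.Icc (0 : ℝ) 1, HasDerivAt φ (φ' s) s)
    (hpos : ∀ s ∈ Set.Icc (0 : ℝ) 1, 0 < φ s)
    (hlam : ∀ s ∈ Set.Icc (0 : ℝ) 1, 0 < lam s)
    (hφ' : ∀ s ∈ Set.Icc (0 : ℝ) 1, φ' s ≤ -(κ * lam s * φ s))
    (h1 : ∀ s ∈ Set.Icc (0 : ℝ) 1, ‖W' s‖ ≤ C * lam s * ‖Y s‖)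
    (h2 : ∀ s ∈ Set.Icc (0 : ℝ) 1,
      Λ * ‖Y s‖ * (d * ‖Y s‖ - η * ‖W s‖ - B * φ s) ≤ inner ℝ (Y s) (Y' s))
    (hκ : 0 < κ) (hC : 0 ≤ C) (hd : 0 < d) (hη : 0 ≤ η) (hB : 0 ≤ B) (hΛ : 0 < Λ) (hD : 0 ≤ D)
    (hCη : C * η ≤ κ * d / 2) (hW1 : ‖W 1‖ ≤ D * φ 1) (hY1 : ‖Y 1‖ ≤ D * φ 1) :
    ‖W 0‖ ≤ 2 * (D + C / κ * (D + B / d)) * φ 0 ∧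
      ‖Y 0‖ ≤ (D + B / d + η / d * (2 * (D + C / κ * (D + B / d)))) * φ 0 := by
  obtain ⟨u, hu, humax, hu'⟩ := exists_max_ratio hW hφ hpos
  obtain ⟨v, hv, hvmax, hv'⟩ := exists_max_ratio hY hφ hpos
  set mw := ‖W u‖ / φ u with hmw
  set my := ‖Y v‖ / φ v with hmy
  have hmw0 : 0 ≤ mw := div_nonneg (norm_nonneg _) (hpos u hu).le
  have hmy0 : 0 ≤ my := div_nonneg (norm_nonneg _) (hpos v hv).le
  have hW1' : (1 : ℝ) ∈ Set.Icc (0 : ℝ) 1 := by simp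
  -- At a maximum of ‖Y‖/φ before the endpoint, the inner product of Y and Y' is nonpositive because
  -- φ decreases; the expansion hypothesis then bounds Y by W and the forcing.
  have hy : my ≤ D + (η * mw + B) / d := by
    have hnn : 0 ≤ (η * mw + B) / d := by positivity
    rcases hv' with rfl | hv'
    · have : my ≤ D := by rw [hmy, div_le_iff₀ (hpos _ hv)]; exact hY1
      linarith
    · have hp := hpos v hv
      rcases eq_or_lt_of_le (norm_nonneg (Y v)) with h0 | h0
      · have : my = 0 := by rw [hmy, ← h0, zero_div]
        rw [this]; positivity
      · have e1 := h2 v hv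
        have e2 := hφ' v hv
        have e3 := hlam v hv
        have e4 : ‖Y v‖ ^ 2 * φ' v ≤ 0 := by
          have : φ' v ≤ 0 := e2.trans (by simp; positivity)
          exact mul_nonpos_of_nonneg_of_nonpos (by positivity) this
        have e5 : Λ * ‖Y v‖ * (d * ‖Y v‖ - η * ‖W v‖ - B * φ v) ≤ 0 := by
          by_contra hcon
          push Not at hcon
          have := mul_pos (hcon.trans_le e1) hp
          linarith
        have e6 : d * ‖Y v‖ - η * ‖W v‖ - B * φ v ≤ 0 := by
          by_contra hcon
          push Not at hcon
          have : 0 < Λ * ‖Y v‖ * (d * ‖Y v‖ - η * ‖W v‖ - B * φ v) := by positivity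
          linarith
        have e7 := mul_le_mul_of_nonneg_left (humax v hv) hη
        have e8 : my ≤ (η * mw + B) / d := by
          rw [hmy, div_le_div_iff₀ hp hd]
          linarith
        linarith
  -- At a maximum of ‖W‖/φ before the endpoint, W decays at least at the rate κ·lam of φ, whereas
  -- ‖W'‖ ≤ C·lam·‖Y‖; hence κ‖W‖ ≤ C‖Y‖.
  have hw : mw ≤ D + C / κ * my := by
    have hnn : 0 ≤ C / κ * my := by positivity
    rcases hu' with rfl | hu'
    · have : mw ≤ D := by rw [hmw, div_le_iff₀ (hpos _ hu)]; exact hW1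
      linarith
    · have hp := hpos u hu
      rcases eq_or_lt_of_le (norm_nonneg (W u)) with h0 | h0
      · have : mw = 0 := by rw [hmw, ← h0, zero_div]
        rw [this]; positivity
      · have e3 := hlam u hu
        have e1 : -(‖W u‖ * (C * lam u * ‖Y u‖)) ≤ inner ℝ (W u) (W' u) := by
          have := neg_le_of_abs_le (abs_real_inner_le_norm (W u) (W' u))
          have := mul_le_mul_of_nonneg_left (h1 u hu) h0.le
          linarith
        have e2 := mul_le_mul_of_nonneg_left (hφ' u hu) (by positivity : (0 : ℝ) ≤ ‖W u‖ ^ 2)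
        have e4 := mul_le_mul_of_nonneg_right e1 hp.le
        have e5 : (‖W u‖ * lam u * φ u) * (κ * ‖W u‖) ≤ (‖W u‖ * lam u * φ u) * (C * ‖Y u‖) := by
          nlinarith
        have e6 := le_of_mul_le_mul_left e5 (by positivity)
        have e7 := mul_le_mul_of_nonneg_left (hvmax u hu) hC
        have e8 : mw ≤ C / κ * my := by
          rw [hmw, div_mul_eq_mul_div, div_le_div_iff₀ hp hκ]
          linarith
        linarith
  -- Inserting one bound into the other leaves (Cη/(κd))·mw ≤ mw/2 on the right, which is absorbed.
  have hmwle : mw ≤ 2 * (D + C / κ * (D + B / d)) := by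
    have e1 : C / κ * my ≤ C / κ * (D + (η * mw + B) / d) :=
      mul_le_mul_of_nonneg_left hy (by positivity)
    have e2 : C / κ * (D + (η * mw + B) / d) = C / κ * (D + B / d) + (C * η) / (κ * d) * mw := by
      field_simp
      ring
    have e3 : (C * η) / (κ * d) ≤ 1 / 2 := by
      rw [div_le_div_iff₀ (by positivity) (by norm_num)]
      linarith
    have e4 := mul_le_mul_of_nonneg_right e3 hmw0
    linarith
  have h0 : (0 : ℝ) ∈ Set.Icc (0 : ℝ) 1 := by simp
  have hp0 := hpos 0 h0
  refine ⟨(humax 0 h0).trans (mul_le_mul_of_nonneg_right hmwle hp0.le),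
    (hvmax 0 h0).trans (mul_le_mul_of_nonneg_right ?_ hp0.le)⟩
  have e1 : η / d * mw ≤ η / d * (2 * (D + C / κ * (D + B / d))) :=
    mul_le_mul_of_nonneg_left hmwle (by positivity)
  have e2 : (η * mw + B) / d = B / d + η / d * mw := by field_simp; ring
  linarith

/-- The vectors 1 and e^ζ make an angle at most π - ε, so their nonnegative combinations cannot
cancel. The constant comes from X² + Y² - 2cXY = (1-c)/2·(X+Y)² + (1+c)/2·(X-Y)² with c = cos ε. -/
theorem norm_segment_ge {ζ : ℂ} {ε s : ℝ} (hε : 0 < ε)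
    (hζ : |ζ.im| ≤ Real.pi - ε) (hs : s ∈ Set.Icc (0 : ℝ) 1) :
    Real.sqrt ((1 - Real.cos ε) / 2) * (1 - s + s * ‖Complex.exp ζ‖)
      ≤ ‖1 + (s : ℂ) * (Complex.exp ζ - 1)‖ := by
  set ρ := ‖Complex.exp ζ‖ with hρ
  have hρ0 : 0 ≤ ρ := norm_nonneg _
  have hcos : -Real.cos ε ≤ Real.cos ζ.im := by
    rw [← Real.cos_abs ζ.im, ← Real.cos_pi_sub]
    exact Real.cos_le_cos_of_nonneg_of_le_pi (abs_nonneg _) (by linarith) hζ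
  have hre : (Complex.exp ζ).re = ρ * Real.cos ζ.im := by
    rw [hρ, Complex.norm_exp, Complex.exp_re]
  have him : (Complex.exp ζ).im = ρ * Real.sin ζ.im := by
    rw [hρ, Complex.norm_exp, Complex.exp_im]
  have hsq : ‖1 + (s : ℂ) * (Complex.exp ζ - 1)‖ ^ 2
      = (1 - s) ^ 2 + (s * ρ) ^ 2 + 2 * (1 - s) * (s * ρ) * Real.cos ζ.im := by
    rw [← Complex.normSq_eq_norm_sq, Complex.normSq_apply]
    simp only [Complex.add_re, Complex.one_re, Complex.mul_re, Complex.ofReal_re, Complex.sub_re,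
      Complex.ofReal_im, Complex.sub_im, Complex.one_im, Complex.add_im, Complex.mul_im, hre, him]
    linear_combination (s * ρ) ^ 2 * Real.sin_sq_add_cos_sq ζ.im
  have h1s : 0 ≤ 1 - s := by linarith [hs.2]
  have hsρ : 0 ≤ s * ρ := mul_nonneg hs.1 hρ0
  have hk : 0 ≤ (1 - Real.cos ε) / 2 := by linarith [Real.cos_le_one ε]
  have hk' : 0 ≤ 1 + Real.cos ε := by linarith [Real.neg_one_le_cos ε]
  refine le_of_sq_le_sq ?_ (norm_nonneg _)
  rw [mul_pow, Real.sq_sqrt hk, hsq]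
  have e1 : 0 ≤ 2 * ((1 - s) * (s * ρ)) * (Real.cos ζ.im + Real.cos ε) :=
    mul_nonneg (by positivity) (by linarith)
  have e2 : 0 ≤ (1 + Real.cos ε) / 2 * ((1 - s) - s * ρ) ^ 2 := by positivity
  nlinarith

/-! ### Paths that are straight in the variable x^{m/2} -/

theorem norm_qp_eq_rpow {m : ℕ} (hm : 1 ≤ m) (n : ℕ) (t : ℂ) :
    ‖qp n t‖ = ‖zz m t‖ ^ (-((n : ℝ) / m)) := by
  have hm' : (m : ℝ) ≠ 0 := by exact_mod_cast (by omega : m ≠ 0)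
  have : ((m : ℂ) / 2 * t).re = (m : ℝ) / 2 * t.re := by
    rw [show (m : ℂ) / 2 * t = (((m : ℝ) / 2 : ℝ) : ℂ) * t by push_cast; ring,
      Complex.re_ofReal_mul]
  rw [norm_qp, zz, Complex.norm_exp, ← Real.exp_mul, this]
  congr 1
  field_simp

/-- The path `γ(s)` from `t` to `T` along which `x^{m/2}` moves on a straight segment. -/
noncomputable def segPath (m : ℕ) (t T : ℂ) (s : ℝ) : ℂ :=
  t + 2 / m * Complex.log (1 + s * (Complex.exp ((m : ℂ) / 2 * (T - t)) - 1))

/-- For |Im ζ| < π the segment from 1 to e^ζ avoids the negative axis, so the principal logarithm is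
differentiable along it. -/
theorem segment_mem_slitPlane {ζ : ℂ} {s : ℝ} (hζ : |ζ.im| < Real.pi)
    (hs : s ∈ Set.Icc (0 : ℝ) 1) : 1 + (s : ℂ) * (Complex.exp ζ - 1) ∈ Complex.slitPlane := by
  rw [Complex.mem_slitPlane_iff]
  have hre : (1 + (s : ℂ) * (Complex.exp ζ - 1)).re
      = (1 - s) + s * (Real.exp ζ.re * Real.cos ζ.im) := by
    simp [Complex.exp_re]; ring
  have him : (1 + (s : ℂ) * (Complex.exp ζ - 1)).im = s * (Real.exp ζ.re * Real.sin ζ.im) := by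
    simp [Complex.exp_im]
  rw [hre, him]
  by_cases h : s * (Real.exp ζ.re * Real.sin ζ.im) = 0
  · left
    rcases mul_eq_zero.1 h with h0 | h0
    · rw [h0]; norm_num
    · have h1 : Real.sin ζ.im = 0 := (mul_eq_zero.1 h0).resolve_left (Real.exp_pos _).ne'
      have h2 : ζ.im = 0 := by
        rw [abs_lt] at hζ
        exact (Real.sin_eq_zero_iff_of_lt_of_lt hζ.1 hζ.2).1 h1
      rw [h2, Real.cos_zero, mul_one]
      rcases eq_or_lt_of_le hs.1 with h3 | h3
      · rw [← h3]; norm_num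
      · have := mul_pos h3 (Real.exp_pos ζ.re)
        linarith [hs.2]
  · exact Or.inr h

theorem segPath_zero (m : ℕ) (t T : ℂ) : segPath m t T 0 = t := by simp [segPath]

theorem segPath_one {m : ℕ} (hm : 1 ≤ m) {t T : ℂ}
    (h : |((m : ℂ) / 2 * (T - t)).im| < Real.pi) : segPath m t T 1 = T := by
  have hm' : (m : ℂ) ≠ 0 := by exact_mod_cast (by omega : m ≠ 0)
  rw [abs_lt] at h
  rw [segPath, Complex.ofReal_one, one_mul, add_sub_cancel, Complex.log_exp h.1 h.2.le]
  field_simp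
  ring

theorem zz_segPath {m : ℕ} (hm : 1 ≤ m) {t T : ℂ}
    (h : |((m : ℂ) / 2 * (T - t)).im| < Real.pi) {s : ℝ} (hs : s ∈ Set.Icc (0 : ℝ) 1) :
    zz m (segPath m t T s)
      = zz m t * (1 + s * (Complex.exp ((m : ℂ) / 2 * (T - t)) - 1)) := by
  have hm' : (m : ℂ) ≠ 0 := by exact_mod_cast (by omega : m ≠ 0)
  have hne := Complex.slitPlane_ne_zero (segment_mem_slitPlane h hs)
  rw [zz, segPath, mul_add, Complex.exp_add, ← mul_assoc,
    show (m : ℂ) / 2 * (2 / m) = 1 by field_simp, one_mul, Complex.exp_log hne, zz]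

theorem hasDerivAt_segPath {m : ℕ} {t T : ℂ}
    (h : |((m : ℂ) / 2 * (T - t)).im| < Real.pi) {s : ℝ} (hs : s ∈ Set.Icc (0 : ℝ) 1) :
    HasDerivAt (segPath m t T) (2 / m * ((Complex.exp ((m : ℂ) / 2 * (T - t)) - 1)
      / (1 + s * (Complex.exp ((m : ℂ) / 2 * (T - t)) - 1)))) s := by
  have h1 : HasDerivAt (fun s : ℝ => 1 + (s : ℂ) * (Complex.exp ((m : ℂ) / 2 * (T - t)) - 1))
      (Complex.exp ((m : ℂ) / 2 * (T - t)) - 1) s := by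
    simpa using ((Complex.ofRealCLM.hasDerivAt (x := s)).mul_const
      (Complex.exp ((m : ℂ) / 2 * (T - t)) - 1)).const_add 1
  exact ((h1.clog_real (segment_mem_slitPlane h hs)).const_mul _).const_add _

/-- Since Re Δ ≥ d‖Δ‖, the term 2Δy expands at rate 2d‖Δ‖; the perturbation A - 1, of size at most
d/2, consumes half of it. -/
theorem le_inner_of_expanding {Δ A b G y w : ℂ} {d η c : ℝ} (hre : d * ‖Δ‖ ≤ Δ.re)
    (hA : ‖A - 1‖ ≤ d / 2) (hb : ‖b‖ ≤ η) (hG : ‖G‖ ≤ c) :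
    ‖Δ‖ * (d * ‖y‖ ^ 2 - ‖y‖ * (η * ‖w‖ + c))
      ≤ inner ℝ y (2 * Δ * y + (2 * Δ * (A - 1) * y + Δ * (b * w + G))) := by
  have hrest : ‖2 * Δ * (A - 1) * y + Δ * (b * w + G)‖
      ≤ ‖Δ‖ * (d * ‖y‖ + (η * ‖w‖ + c)) := by
    calc _ ≤ ‖2 * Δ * (A - 1) * y‖ + ‖Δ * (b * w + G)‖ := norm_add_le _ _
      _ ≤ 2 * ‖Δ‖ * (d / 2) * ‖y‖ + ‖Δ‖ * (η * ‖w‖ + c) := by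
          rw [norm_mul, norm_mul, norm_mul, norm_mul, Complex.norm_ofNat]
          gcongr
          refine (norm_add_le _ _).trans (add_le_add ?_ hG)
          rw [norm_mul]
          gcongr
      _ = _ := by ring
  have hmain : 2 * d * ‖Δ‖ * ‖y‖ ^ 2 ≤ inner ℝ y (2 * Δ * y) := by
    have h1 : inner ℝ y (2 * Δ * y) = 2 * Δ.re * ‖y‖ ^ 2 := by
      rw [Complex.inner, ← Complex.normSq_eq_norm_sq, Complex.normSq_apply]
      simp only [Complex.mul_re, Complex.mul_im, Complex.conj_re, Complex.conj_im,
        Complex.re_ofNat, Complex.im_ofNat]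
      ring
    have h2 := mul_le_mul_of_nonneg_right hre (sq_nonneg ‖y‖)
    rw [h1]
    linarith
  have hcs := neg_le_of_abs_le (abs_real_inner_le_norm y
    (2 * Δ * (A - 1) * y + Δ * (b * w + G)))
  have hcs2 := mul_le_mul_of_nonneg_left hrest (norm_nonneg y)
  rw [inner_add_right]
  have e : ‖Δ‖ * (d * ‖y‖ ^ 2 - ‖y‖ * (η * ‖w‖ + c)) = 2 * d * ‖Δ‖ * ‖y‖ ^ 2
      - ‖y‖ * (‖Δ‖ * (d * ‖y‖ + (η * ‖w‖ + c))) := by ring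
  rw [e]
  linarith

set_option maxHeartbeats 1000000 in
-- Bounds of order x^{-N/2} at a far point T are carried back to t along the segment joining t^ and
-- T^ in the plane of x^{m/2}, where t^, T^ are the images of t, T. Moving towards T, the component
-- y expands, so a bound at T controls it before T. The radius R is independent of N, and all
-- constants are uniform over K and over the solutions considered.
theorem propagate {m : ℕ} (hm : 1 ≤ m) {K : Set (Fin m → ℂ)} (hK : IsCompact K) {ε d : ℝ}
    (hε : 0 < ε) (hε' : ε < Real.pi) (hd : 0 < d) :
    ∃ R : ℝ, 0 ≤ R ∧ ∀ N : ℕ, 1 ≤ N → ∃ C : ℝ, 0 ≤ C ∧ ∀ a ∈ K, ∀ (w y g : ℂ → ℂ) (B D : ℝ),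
      0 ≤ B → 0 ≤ D → (∀ t, HasDerivAt w (y t) t) →
      (∀ t, HasDerivAt y (zz m t * (2 * fA a t * y t + fB a t * w t) + g t) t) →
      (∀ t, 0 ≤ t.re → ‖g t‖ ≤ B * ‖zz m t‖ * ‖qp N t‖) → ∀ t T : ℂ, R ≤ t.re →
      |((m : ℂ) / 2 * (T - t)).im| ≤ Real.pi - ε → 2 * ‖zz m t‖ ≤ ‖zz m T‖ →
      d * ‖zz m T - zz m t‖ ≤ (zz m T - zz m t).re →
      ‖w T‖ ≤ D * ‖qp N T‖ → ‖y T‖ ≤ D * ‖qp N T‖ →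
      ‖w t‖ ≤ C * (B + D) * ‖qp N t‖ ∧ ‖y t‖ ≤ C * (B + D) * ‖qp N t‖ := by
  obtain ⟨CA, hCA, hA⟩ := exists_bound_fA hm hK
  obtain ⟨CB, hCB, hB⟩ := exists_bound_fB hm hK
  have hm' : (0 : ℝ) < m := by exact_mod_cast hm
  set k := Real.sqrt ((1 - Real.cos ε) / 2) with hk
  have hk0 : 0 < k := by
    refine Real.sqrt_pos.2 ?_
    have : Real.cos ε < Real.cos 0 :=
      Real.cos_lt_cos_of_nonneg_of_le_pi le_rfl hε'.le hε
    rw [Real.cos_zero] at this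
    linarith
  -- Chosen so that Cη ≤ κd/2 with C = 6/(mk) and κ = N/m ≥ 1/m, as `norm_le_of_expanding` requires.
  set η := k * d / 12 with hη
  have hη0 : 0 < η := by positivity
  have hlim : Tendsto (fun u : ℝ => (CA + CB) * Real.exp (-(1 / 2 * u))) atTop (𝓝 0) := by
    have h1 : Tendsto (fun u : ℝ => 1 / 2 * u) atTop atTop :=
      tendsto_id.const_mul_atTop (by norm_num)
    simpa using (Real.tendsto_exp_neg_atTop_nhds_zero.comp h1).const_mul (CA + CB)
  obtain ⟨R', hR'⟩ := eventually_atTop.1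
    (hlim.eventually (Iio_mem_nhds (lt_min (half_pos hd) hη0)))
  -- Along the segment |x^{m/2}| may shrink by a factor k, so Re γ may fall below Re t by -(2/m) log
  -- k; R leaves that margin.
  refine ⟨max 0 (max 0 R' - 2 / m * Real.log k), le_max_left _ _, fun N hN => ?_⟩
  have hN' : (0 : ℝ) < N := by exact_mod_cast hN
  set k₁ := k ^ (-((N : ℝ) / m)) with hk₁
  have hk₁0 : 0 < k₁ := Real.rpow_pos_of_pos hk0 _
  set M := 2 * (1 + 6 / (m * k) / (N / m) * (1 + k₁ / d)) with hM
  have hM0 : 0 ≤ M := by positivity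
  refine ⟨M + (1 + k₁ / d + η / d * M), by positivity, ?_⟩
  intro a ha w y g B D hB0 hD0 hw hy hg t T ht hang hzz hre hwT hyT
  have hang' : |((m : ℂ) / 2 * (T - t)).im| < Real.pi := by linarith
  set ζ := (m : ℂ) / 2 * (T - t) with hζ
  set ρ := ‖Complex.exp ζ‖ with hρ
  have hzT : zz m T = zz m t * Complex.exp ζ := by
    rw [zz, zz, ← Complex.exp_add]; congr 1; rw [hζ]; ring
  have hzt0 : 0 < ‖zz m t‖ := norm_pos_iff.2 (zz_ne_zero m t)
  have hρ2 : 2 ≤ ρ := by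
    rw [hzT, norm_mul, mul_comm] at hzz
    exact le_of_mul_le_mul_left hzz hzt0
  have hΔ : zz m T - zz m t = zz m t * (Complex.exp ζ - 1) := by rw [hzT]; ring
  set Δ := zz m T - zz m t with hΔd
  -- As ρ ≥ 2, one has ρ + 1 ≤ 3(ρ - 1).
  have hexp1 : ‖Complex.exp ζ - 1‖ ≤ 3 * (ρ - 1) := by
    have := norm_sub_le (Complex.exp ζ) 1
    rw [norm_one] at this
    linarith
  have hexp2 : ρ - 1 ≤ ‖Complex.exp ζ - 1‖ := by
    have := norm_sub_norm_le (Complex.exp ζ) 1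
    rwa [norm_one] at this
  have hΔ0 : 0 < ‖Δ‖ := by
    rw [hΔ, norm_mul]
    exact mul_pos hzt0 (by linarith)
  set u : ℝ → ℂ := fun s => 1 + (s : ℂ) * (Complex.exp ζ - 1) with hu
  set ℓ : ℝ → ℝ := fun s => 1 - s + s * ρ with hℓ
  have hℓ1 : ∀ s ∈ Set.Icc (0 : ℝ) 1, 1 ≤ ℓ s := fun s hs => by
    simp only [hℓ]
    nlinarith [hs.1]
  have hul : ∀ s ∈ Set.Icc (0 : ℝ) 1, k * ℓ s ≤ ‖u s‖ := fun s hs =>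
    norm_segment_ge hε hang hs
  have huk : ∀ s ∈ Set.Icc (0 : ℝ) 1, k ≤ ‖u s‖ := fun s hs =>
    le_trans (by nlinarith [hℓ1 s hs]) (hul s hs)
  have hu0 : ∀ s ∈ Set.Icc (0 : ℝ) 1, u s ≠ 0 := fun s hs =>
    norm_pos_iff.1 (hk0.trans_le (huk s hs))
  set γ := segPath m t T with hγ
  have hzγ : ∀ s ∈ Set.Icc (0 : ℝ) 1, zz m (γ s) = zz m t * u s := fun s hs =>
    zz_segPath hm hang' hs
  have hγre : ∀ s ∈ Set.Icc (0 : ℝ) 1, max 0 R' ≤ (γ s).re := by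
    intro s hs
    have e1 : (γ s).re = t.re + 2 / m * Real.log ‖u s‖ := by
      rw [hγ, segPath, Complex.add_re, show (2 : ℂ) / m = ((2 / m : ℝ) : ℂ) by push_cast; rfl,
        Complex.re_ofReal_mul, Complex.log_re]
    have e2 : Real.log k ≤ Real.log ‖u s‖ := Real.log_le_log hk0 (huk s hs)
    have e3 : 2 / m * Real.log k ≤ 2 / m * Real.log ‖u s‖ :=
      mul_le_mul_of_nonneg_left e2 (by positivity)
    have e4 := le_max_right 0 (max 0 R' - 2 / m * Real.log k)
    rw [e1]
    linarith
  have hγ0 : ∀ s ∈ Set.Icc (0 : ℝ) 1, 0 ≤ (γ s).re := fun s hs =>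
    (le_max_left _ _).trans (hγre s hs)
  have hq1 : ∀ s ∈ Set.Icc (0 : ℝ) 1, CA * ‖qp 1 (γ s)‖ ≤ d / 2 ∧ CB * ‖qp 1 (γ s)‖ ≤ η := by
    intro s hs
    have e1 := hR' (γ s).re ((le_max_right _ _).trans (hγre s hs))
    have e2 : ‖qp 1 (γ s)‖ = Real.exp (-(1 / 2 * (γ s).re)) := by
      rw [norm_qp]; congr 1; push_cast; ring
    rw [← e2, lt_min_iff, add_mul] at e1
    have e3 : 0 ≤ CA * ‖qp 1 (γ s)‖ := by positivity
    have e4 : 0 ≤ CB * ‖qp 1 (γ s)‖ := by positivity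
    constructor <;> linarith
  -- The weight replaces |u| by ℓ in |x^{-N/2}| = |x^{m/2}|^{-N/m}: it agrees with this norm at both
  -- ends, bounds it up to k₁ in between, and is explicitly decreasing.
  set φ : ℝ → ℝ := fun s => ‖qp N t‖ * ℓ s ^ (-((N : ℝ) / m)) with hφ
  have hqt0 : 0 < ‖qp N t‖ := norm_pos_iff.2 (Complex.exp_ne_zero _)
  have hqN : ∀ s ∈ Set.Icc (0 : ℝ) 1, ‖qp N (γ s)‖ ≤ k₁ * φ s := by
    intro s hs
    have hl := hℓ1 s hs
    rw [norm_qp_eq_rpow hm, hzγ s hs, norm_mul,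
      Real.mul_rpow (norm_nonneg _) (norm_nonneg _), ← norm_qp_eq_rpow hm, hφ, hk₁]
    have : ‖u s‖ ^ (-((N : ℝ) / m)) ≤ (k * ℓ s) ^ (-((N : ℝ) / m)) :=
      Real.rpow_le_rpow_of_nonpos (by positivity) (hul s hs)
        (by rw [neg_nonpos]; positivity)
    rw [Real.mul_rpow hk0.le (by linarith)] at this
    calc _ ≤ ‖qp N t‖ * (k ^ (-((N : ℝ) / m)) * ℓ s ^ (-((N : ℝ) / m))) := by gcongr
      _ = _ := by ring
  have hφ0 : φ 0 = ‖qp N t‖ := by simp [hφ, hℓ]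
  have hφ1 : φ 1 = ‖qp N T‖ := by
    simp only [hφ, hℓ, sub_self, zero_add, one_mul]
    rw [norm_qp_eq_rpow hm, norm_qp_eq_rpow hm, hzT, norm_mul,
      Real.mul_rpow (norm_nonneg _) (norm_nonneg _)]
  have hγ' : ∀ s ∈ Set.Icc (0 : ℝ) 1,
      HasDerivAt γ (2 / m * ((Complex.exp ζ - 1) / u s)) s := fun s hs =>
    hasDerivAt_segPath hang' hs
  have hφd : ∀ s ∈ Set.Icc (0 : ℝ) 1, HasDerivAt φ (-((N / m) * ((ρ - 1) / ℓ s) * φ s)) s := by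
    intro s hs
    have hl : (0 : ℝ) < ℓ s := by linarith [hℓ1 s hs]
    have e1 : HasDerivAt ℓ (ρ - 1) s := by
      have : HasDerivAt (fun s : ℝ => 1 - s + s * ρ) (-1 + 1 * ρ) s :=
        ((hasDerivAt_id' s).const_sub 1).add ((hasDerivAt_id' s).mul_const ρ)
      convert! this using 1
      ring
    refine ((e1.rpow_const (p := -((N : ℝ) / m)) (Or.inl hl.ne')).const_mul
      ‖qp N t‖).congr_deriv ?_
    rw [Real.rpow_sub_one hl.ne']
    simp only [hφ]
    field_simp
  have hfin := norm_le_of_expanding (W := fun s => w (γ s)) (Y := fun s => y (γ s))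
    (W' := fun s => 2 / m * ((Complex.exp ζ - 1) / u s) * y (γ s))
    (Y' := fun s => 2 / m * ((Complex.exp ζ - 1) / u s) * (zz m (γ s) * (2 * fA a (γ s) * y (γ s)
      + fB a (γ s) * w (γ s)) + g (γ s)))
    (φ := φ) (φ' := fun s => -((N / m) * ((ρ - 1) / ℓ s) * φ s)) (lam := fun s => (ρ - 1) / ℓ s)
    (κ := N / m) (C := 6 / (m * k)) (d := d) (η := η) (B := B * k₁) (Λ := 2 / m * ‖Δ‖) (D := D)
    ?_ ?_ hφd ?_ ?_ (fun s hs => le_rfl) ?_ ?_ (by positivity) (by positivity) hd hη0.le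
    (by positivity) (by positivity) hD0 ?_ ?_ ?_
  · simp only [hγ, segPath_zero, hφ0] at hfin
    have b1 : B ≤ B + D := by linarith
    have b2 : D ≤ B + D := by linarith
    have b3 : D + B * k₁ / d ≤ (B + D) * (1 + k₁ / d) := by
      have : 0 ≤ D * (k₁ / d) := by positivity
      have e : (B + D) * (1 + k₁ / d) = B + D + B * k₁ / d + D * (k₁ / d) := by field_simp; ring
      rw [e]; linarith
    have b4 : 2 * (D + 6 / (m * k) / (N / m) * (D + B * k₁ / d)) ≤ (B + D) * M := by
      have : 6 / (m * k) / (N / m) * (D + B * k₁ / d)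
          ≤ 6 / (m * k) / (N / m) * ((B + D) * (1 + k₁ / d)) :=
        mul_le_mul_of_nonneg_left b3 (by positivity)
      have e : (B + D) * M = 2 * ((B + D)
          + 6 / (m * k) / (N / m) * ((B + D) * (1 + k₁ / d))) := by rw [hM]; ring
      rw [e]; linarith
    have b5 : η / d * (2 * (D + 6 / (m * k) / (N / m) * (D + B * k₁ / d)))
        ≤ η / d * ((B + D) * M) := mul_le_mul_of_nonneg_left b4 (by positivity)
    have hq := hqt0.le
    have b6 : 0 ≤ (B + D) * (1 + k₁ / d + η / d * M) := by positivity
    have b7 : 0 ≤ (B + D) * M := by positivity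
    have b8 : (M + (1 + k₁ / d + η / d * M)) * (B + D)
        = (B + D) * M + (B + D) * (1 + k₁ / d + η / d * M) := by ring
    have b9 : (B + D) * (1 + k₁ / d + η / d * M)
        = (B + D) * (1 + k₁ / d) + η / d * ((B + D) * M) := by ring
    exact ⟨hfin.1.trans (mul_le_mul_of_nonneg_right (by linarith) hq),
      hfin.2.trans (mul_le_mul_of_nonneg_right (by linarith) hq)⟩
  · intro s hs
    exact (hw (γ s)).scomp s (hγ' s hs)
  · intro s hs
    exact (hy (γ s)).scomp s (hγ' s hs)
  · intro s hs
    have : (0 : ℝ) < ℓ s := by linarith [hℓ1 s hs]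
    simp only [hφ]
    positivity
  · intro s hs
    have : (0 : ℝ) < ℓ s := by linarith [hℓ1 s hs]
    exact div_pos (by linarith) this
  · intro s hs
    have hl : (0 : ℝ) < ℓ s := by linarith [hℓ1 s hs]
    rw [norm_mul, norm_mul, norm_div, norm_div, Complex.norm_ofNat, Complex.norm_natCast]
    refine mul_le_mul_of_nonneg_right ?_ (norm_nonneg _)
    calc 2 / (m : ℝ) * (‖Complex.exp ζ - 1‖ / ‖u s‖)
        ≤ 2 / m * (3 * (ρ - 1) / (k * ℓ s)) := by
          gcongr
          · linarith
          · exact hul s hs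
      _ = 6 / (m * k) * ((ρ - 1) / ℓ s) := by field_simp; ring
  · intro s hs
    have hus := hu0 s hs
    have hz := zz_ne_zero m (γ s)
    obtain ⟨hq1A, hq1B⟩ := hq1 s hs
    -- The factor u in x^{m/2} cancels the denominator of γ', so the coefficient Δ is constant along
    -- the path.
    have e1 : 2 / (m : ℂ) * ((Complex.exp ζ - 1) / u s) * (zz m (γ s) * (2 * fA a (γ s) * y (γ s)
        + fB a (γ s) * w (γ s)) + g (γ s))
        = ((2 / m : ℝ) : ℂ) * (2 * Δ * y (γ s) + (2 * Δ * (fA a (γ s) - 1) * y (γ s)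
          + Δ * (fB a (γ s) * w (γ s) + g (γ s) / zz m (γ s)))) := by
      rw [hΔ]
      rw [hzγ s hs] at hz ⊢
      have := zz_ne_zero m t
      push_cast
      field_simp
      ring
    have hgz : ‖g (γ s) / zz m (γ s)‖ ≤ B * k₁ * φ s := by
      rw [norm_div, div_le_iff₀ (norm_pos_iff.2 hz)]
      refine (hg (γ s) (hγ0 s hs)).trans ?_
      calc B * ‖zz m (γ s)‖ * ‖qp N (γ s)‖ ≤ B * ‖zz m (γ s)‖ * (k₁ * φ s) :=
            mul_le_mul_of_nonneg_left (hqN s hs) (by positivity)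
        _ = _ := by ring
    have key := le_inner_of_expanding (y := y (γ s)) (w := w (γ s)) hre
      ((hA a ha _ (hγ0 s hs)).trans hq1A) ((hB a ha _ (hγ0 s hs)).trans hq1B) hgz
    rw [e1, ← Complex.real_smul, inner_smul_right, mul_assoc (2 / (m : ℝ)),
      mul_assoc (2 / (m : ℝ))]
    refine mul_le_mul_of_nonneg_left ?_ (by positivity)
    refine le_trans (le_of_eq ?_) key
    ring
  · have : (1 : ℝ) ≤ N := by exact_mod_cast hN
    calc 6 / (m * k) * η = d / 2 * (1 / m) := by rw [hη]; field_simp; ring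
      _ ≤ d / 2 * (N / m) := by gcongr
      _ = _ := by ring
  · rw [hφ1, hγ, segPath_one hm hang']
    exact hwT
  · rw [hφ1, hγ, segPath_one hm hang']
    exact hyT

/-! ### Existence and uniqueness of the solution at infinity -/

/-- The point with `x^{m/2} = (n + 1) e^{iβ}`. -/
noncomputable def farPoint (m : ℕ) (β : ℝ) (n : ℕ) : ℂ :=
  2 / m * (Real.log (n + 1) + β * Complex.I)

theorem half_mul_farPoint {m : ℕ} (hm : 1 ≤ m) (β : ℝ) (n : ℕ) :
    (m : ℂ) / 2 * farPoint m β n = Real.log (n + 1) + β * Complex.I := by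
  have hm' : (m : ℂ) ≠ 0 := by exact_mod_cast (by omega : m ≠ 0)
  rw [farPoint]
  field_simp

theorem zz_farPoint {m : ℕ} (hm : 1 ≤ m) (β : ℝ) (n : ℕ) :
    zz m (farPoint m β n) = ((n + 1 : ℝ) : ℂ) * Complex.exp (β * Complex.I) := by
  rw [zz, half_mul_farPoint hm, Complex.exp_add, ← Complex.ofReal_exp,
    Real.exp_log (by positivity)]

theorem eventually_farPoint {m : ℕ} (hm : 1 ≤ m) {β : ℝ} (hβ : 0 < Real.cos β) (t : ℂ) :
    ∀ᶠ n : ℕ in atTop, 2 * ‖zz m t‖ ≤ ‖zz m (farPoint m β n)‖ ∧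
      Real.cos β / 2 * ‖zz m (farPoint m β n) - zz m t‖
        ≤ (zz m (farPoint m β n) - zz m t).re := by
  have h1 := (tendsto_natCast_atTop_atTop (R := ℝ)).eventually_ge_atTop (2 * ‖zz m t‖)
  have h2 := (tendsto_natCast_atTop_atTop (R := ℝ)).eventually_ge_atTop
    ((2 * (1 + Real.cos β / 2) * ‖zz m t‖) / Real.cos β)
  filter_upwards [h1, h2] with n h1 h2
  have e1 : ‖zz m (farPoint m β n)‖ = n + 1 := by
    rw [zz_farPoint hm, norm_mul, Complex.norm_exp_ofReal_mul_I, mul_one, Complex.norm_real,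
      Real.norm_of_nonneg (by positivity)]
  have e2 : (zz m (farPoint m β n)).re = (n + 1) * Real.cos β := by
    rw [zz_farPoint hm, Complex.re_ofReal_mul, Complex.exp_ofReal_mul_I_re]
  refine ⟨by rw [e1]; linarith, ?_⟩
  rw [Complex.sub_re, e2]
  have e3 := norm_sub_le (zz m (farPoint m β n)) (zz m t)
  have e4 := Complex.re_le_norm (zz m t)
  rw [e1] at e3
  rw [div_le_iff₀ hβ] at h2
  have e5 := mul_le_mul_of_nonneg_left e3 (half_pos hβ).le
  linarith

/-- For fixed t the far points in direction β eventually satisfy the cone condition, with d = cos β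
/ 2. The quantifier over a stands inside "eventually", which later gives uniform convergence in the
parameters. -/
theorem propagate_farPoint {m : ℕ} (hm : 1 ≤ m) {K : Set (Fin m → ℂ)} (hK : IsCompact K)
    {ε β : ℝ} (hε : 0 < ε) (hε' : ε < Real.pi) (hβ : 0 < Real.cos β) :
    ∃ R : ℝ, 0 ≤ R ∧ ∀ N : ℕ, 1 ≤ N → ∃ C : ℝ, 0 ≤ C ∧ ∀ t : ℂ, R ≤ t.re →
      |β - m / 2 * t.im| ≤ Real.pi - ε → ∀ᶠ n : ℕ in atTop, ∀ a ∈ K,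
      ∀ (w y g : ℂ → ℂ) (B D : ℝ), 0 ≤ B → 0 ≤ D → (∀ t, HasDerivAt w (y t) t) →
      (∀ t, HasDerivAt y (zz m t * (2 * fA a t * y t + fB a t * w t) + g t) t) →
      (∀ t, 0 ≤ t.re → ‖g t‖ ≤ B * ‖zz m t‖ * ‖qp N t‖) →
      ‖w (farPoint m β n)‖ ≤ D * ‖qp N (farPoint m β n)‖ →
      ‖y (farPoint m β n)‖ ≤ D * ‖qp N (farPoint m β n)‖ →
      ‖w t‖ ≤ C * (B + D) * ‖qp N t‖ ∧ ‖y t‖ ≤ C * (B + D) * ‖qp N t‖ := by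
  obtain ⟨R, hR, h⟩ := propagate hm hK hε hε' (half_pos hβ)
  refine ⟨R, hR, fun N hN => ?_⟩
  obtain ⟨C, hC, h⟩ := h N hN
  refine ⟨C, hC, fun t ht hi => ?_⟩
  filter_upwards [eventually_farPoint hm hβ t] with n hn a ha w y g B D hB hD hw hy hg h0 h1
  refine h a ha w y g B D hB hD hw hy hg t _ ht ?_ hn.1 hn.2 h0 h1
  have : ((m : ℂ) / 2 * (farPoint m β n - t)).im = β - m / 2 * t.im := by
    rw [mul_sub, half_mul_farPoint hm, show (m : ℂ) / 2 = ((m / 2 : ℝ) : ℂ) by push_cast; rfl]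
    simp only [Complex.sub_im, Complex.add_im, Complex.ofReal_im, Complex.im_ofReal_mul,
      Complex.I_im]
    ring
  rwa [this]

/-! ### Solutions with the formal expansion in one sector -/

theorem eq_amp_mul {m : ℕ} (a : Fin m → ℂ) (f : ℂ → ℂ) (t : ℂ) :
    f t = amp a f t * Complex.exp (r a * t - S a t) := by
  rw [amp, mul_assoc, exp_phase_mul, mul_one]

theorem deriv_eq_amp {m : ℕ} (a : Fin m → ℂ) {f : ℂ → ℂ} (hf : Differentiable ℂ f) (t : ℂ) :
    deriv f t = (deriv (amp a f) t - (dS a t - r a) * amp a f t)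
      * Complex.exp (r a * t - S a t) := by
  rw [deriv_amp a hf, amp]
  linear_combination (-deriv f t) * exp_phase_mul a t

theorem IsSolution.hasDerivAt_amp_sub {m : ℕ} {a : Fin m → ℂ} {f : ℂ → ℂ} (hf : IsSolution a f)
    (N : ℕ) : (∀ t, HasDerivAt (fun t => amp a f t - ampSum N a t)
        (deriv (amp a f) t - dAmpSum N a t) t) ∧
      ∀ t, HasDerivAt (fun t => deriv (amp a f) t - dAmpSum N a t)
        (zz m t * (2 * fA a t * (deriv (amp a f) t - dAmpSum N a t)
          + fB a t * (amp a f t - ampSum N a t))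
          + -((∑ n ∈ Finset.range N, ampCoef a n * (-((n : ℂ) / 2) * (-((n : ℂ) / 2) * qp n t)))
            - zz m t * (2 * fA a t * dAmpSum N a t + fB a t * ampSum N a t))) t := by
  have hd := differentiable_amp a hf.1
  refine ⟨fun t => (hd t).hasDerivAt.sub (hasDerivAt_ampSum N a t), fun t => ?_⟩
  refine ((differentiable_deriv hd t).hasDerivAt.sub (hasDerivAt_dAmpSum N a t)).congr_deriv ?_
  rw [hf.deriv2_amp]
  ring

/-- Solutions that match the truncated series exactly at far points differ from it at t only through
the residual (D = 0 in the propagation). Their Cauchy data at a fixed point stay bounded, so a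
subsequence converges to a solution with the same bounds. -/
theorem exists_sectorial_solution {m : ℕ} (hm : 1 ≤ m) {K : Set (Fin m → ℂ)} (hK : IsCompact K)
    {ε β : ℝ} (hε : 0 < ε) (hε' : ε < Real.pi) (hβ : 0 < Real.cos β) {N : ℕ} (hN : 1 ≤ N) :
    ∃ C R : ℝ, 0 ≤ C ∧ 0 ≤ R ∧ ∀ a ∈ K, ∃ f, IsSolution a f ∧ ∀ t : ℂ, R ≤ t.re →
      |β - m / 2 * t.im| ≤ Real.pi - ε →
      ‖amp a f t - ampSum N a t‖ ≤ C * ‖qp N t‖ ∧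
      ‖deriv (amp a f) t - dAmpSum N a t‖ ≤ C * ‖qp N t‖ := by
  obtain ⟨R, hR, h⟩ := propagate_farPoint hm hK hε hε' hβ
  obtain ⟨C, hC, h⟩ := h N hN
  obtain ⟨B, hB, hres⟩ := exists_bound_residual hm hK N
  refine ⟨C * B, R, by positivity, hR, fun a ha => ?_⟩
  choose F hF hF0 hF1 using fun n : ℕ => exists_solution_amp hm a (farPoint m β n)
    (ampSum N a (farPoint m β n)) (dAmpSum N a (farPoint m β n))
  have key : ∀ t : ℂ, R ≤ t.re → |β - m / 2 * t.im| ≤ Real.pi - ε → ∀ᶠ n in atTop,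
      ‖amp a (F n) t - ampSum N a t‖ ≤ C * B * ‖qp N t‖ ∧
      ‖deriv (amp a (F n)) t - dAmpSum N a t‖ ≤ C * B * ‖qp N t‖ := by
    intro t ht hi
    filter_upwards [h t ht hi] with n hn
    have := hn a ha _ _ _ B 0 hB le_rfl ((hF n).hasDerivAt_amp_sub N).1
      ((hF n).hasDerivAt_amp_sub N).2 (fun t ht => by rw [norm_neg]; exact hres a ha t ht)
      (by rw [hF0]; simp) (by rw [hF1]; simp)
    simpa using this
  -- A point on the bisector of the sector, where the bounds are available.
  set t₀ : ℂ := ⟨R, 2 / m * β⟩ with ht₀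
  have hm' : (m : ℝ) ≠ 0 := by exact_mod_cast (by omega : m ≠ 0)
  have ht₀' : |β - m / 2 * t₀.im| ≤ Real.pi - ε := by
    have : β - m / 2 * (2 / m * β) = 0 := by field_simp; ring
    rw [ht₀]
    simp only [this, abs_zero]
    linarith
  have hamp0 : ∀ᶠ n in atTop, ‖amp a (F n) t₀‖ ≤ C * B * ‖qp N t₀‖ + ‖ampSum N a t₀‖ ∧
      ‖deriv (amp a (F n)) t₀‖ ≤ C * B * ‖qp N t₀‖ + ‖dAmpSum N a t₀‖ := by
    filter_upwards [key t₀ le_rfl ht₀'] with n hn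
    exact ⟨(norm_le_norm_sub_add _ _).trans (by linarith [hn.1]),
      (norm_le_norm_sub_add _ _).trans (by linarith [hn.2])⟩
  set b₀ := C * B * ‖qp N t₀‖ + ‖ampSum N a t₀‖
  set b₁ := C * B * ‖qp N t₀‖ + ‖dAmpSum N a t₀‖
  set E := ‖Complex.exp (r a * t₀ - S a t₀)‖
  have hE : 0 ≤ E := norm_nonneg _
  obtain ⟨f, hf, φ, hφ, hlim⟩ := exists_limit_solution hm hF
    (t₀ := t₀) (C := max (b₀ * E) ((b₁ + ‖dS a t₀ - r a‖ * b₀) * E))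
    (hamp0.mono fun n hn => by
      rw [eq_amp_mul a (F n), norm_mul]
      exact (mul_le_mul_of_nonneg_right hn.1 hE).trans (le_max_left _ _))
    (hamp0.mono fun n hn => by
      rw [deriv_eq_amp a (hF n).1, norm_mul]
      refine (mul_le_mul_of_nonneg_right ?_ hE).trans (le_max_right _ _)
      refine (norm_sub_le _ _).trans (add_le_add hn.2 ?_)
      rw [norm_mul]
      exact mul_le_mul_of_nonneg_left hn.1 (norm_nonneg _))
  refine ⟨f, hf, fun t ht hi => ?_⟩
  have hk := hφ.tendsto_atTop.eventually (key t ht hi)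
  have l0 : Tendsto (fun n => amp a (F (φ n)) t) atTop (𝓝 (amp a f t)) :=
    (hlim t).1.mul_const _
  have l1 : Tendsto (fun n => deriv (amp a (F (φ n))) t) atTop (𝓝 (deriv (amp a f) t)) := by
    simp only [deriv_amp a (hF _).1, deriv_amp a hf.1]
    exact ((hlim t).2.add ((hlim t).1.const_mul _)).const_mul _
  exact ⟨le_of_tendsto (l0.sub_const _).norm (hk.mono fun n hn => hn.1),
    le_of_tendsto (l1.sub_const _).norm (hk.mono fun n hn => hn.2)⟩

/-! #### Uniqueness -/

theorem tendsto_norm_qp {n : ℕ} (hn : 1 ≤ n) (τ : ℂ) :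
    Tendsto (fun x : ℝ => ‖qp n (x + τ)‖) atTop (𝓝 0) := by
  have hn' : (0 : ℝ) < n := by exact_mod_cast hn
  have h1 : Tendsto (fun x : ℝ => (n : ℝ) / 2 * (x + τ.re)) atTop atTop :=
    (tendsto_atTop_add_const_right _ _ tendsto_id).const_mul_atTop (by positivity)
  refine (Real.tendsto_exp_neg_atTop_nhds_zero.comp h1).congr fun x => ?_
  rw [norm_qp]
  simp

theorem wr_eq_amp {m : ℕ} (a : Fin m → ℂ) {f g : ℂ → ℂ} (hf : Differentiable ℂ f)
    (hg : Differentiable ℂ g) (t : ℂ) : wr f g t = Complex.exp (-t + 2 * (r a * t - S a t))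
      * (amp a f t * deriv (amp a g) t - deriv (amp a f) t * amp a g t) := by
  rw [wr, deriv_eq_amp a hf, deriv_eq_amp a hg, eq_amp_mul a f t, eq_amp_mul a g t,
    Complex.exp_add, two_mul, Complex.exp_add]
  ring_nf

/-- The exponent has derivative -2 x^{m/2} A along the real axis, and Re A > 0 far out, so its real
part decreases. -/
theorem exists_bound_phase {m : ℕ} (hm : 1 ≤ m) (a : Fin m → ℂ) :
    ∃ C R : ℝ, ∀ x : ℝ, R ≤ x →
      ‖Complex.exp (-(x : ℂ) + 2 * (r a * x - S a x))‖ ≤ C := by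
  obtain ⟨CA, hCA, hA⟩ := exists_bound_fA hm (isCompact_singleton (x := a))
  have h0 := (tendsto_norm_qp le_rfl 0).const_mul CA
  rw [mul_zero] at h0
  obtain ⟨R, hR⟩ := eventually_atTop.1 (h0.eventually (gt_mem_nhds one_pos))
  set ψ : ℝ → ℝ := fun x => (-(x : ℂ) + 2 * (r a * x - S a x)).re with hψ
  have hd : ∀ x : ℝ, HasDerivAt ψ (-2 * (zz m x * fA a x)).re x := by
    intro x
    have h1 : HasDerivAt (fun t : ℂ => -t + 2 * (r a * t - S a t))
        (-1 + 2 * (r a * 1 - dS a x)) (x : ℂ) :=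
      (hasDerivAt_id' _).neg.add (((hasDerivAt_id' _).const_mul (r a)).sub
        (hasDerivAt_S a x) |>.const_mul 2)
    convert! h1.real_of_complex using 2
    rw [zz_mul_fA]
    ring
  have hanti : AntitoneOn ψ (Set.Ici (max 0 R)) := by
    refine antitoneOn_of_deriv_nonpos (convex_Ici _)
      (fun x _ => (hd x).continuousAt.continuousWithinAt)
      (fun x _ => (hd x).differentiableAt.differentiableWithinAt) fun x hx => ?_
    rw [interior_Ici, Set.mem_Ioi, max_lt_iff] at hx
    rw [(hd x).deriv]
    have e1 : zz m (x : ℂ) = ((Real.exp (m / 2 * x) : ℝ) : ℂ) := by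
      rw [zz]; push_cast; rfl
    have e2 := hA a rfl x hx.1.le
    have e3 := hR x hx.2.le
    rw [add_zero] at e3
    have e4 := (Complex.abs_re_le_norm (fA a x - 1)).trans (e2.trans e3.le)
    rw [Complex.sub_re, Complex.one_re, abs_le] at e4
    rw [e1, show (-2 : ℂ) = ((-2 : ℝ) : ℂ) by push_cast; rfl, Complex.re_ofReal_mul,
      Complex.re_ofReal_mul]
    have := mul_nonneg (Real.exp_pos (m / 2 * x)).le (by linarith : 0 ≤ (fA a x).re)
    linarith
  refine ⟨Real.exp (ψ (max 0 R)), max 0 R, fun x hx => ?_⟩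
  rw [Complex.norm_exp]
  exact Real.exp_le_exp.2 (hanti Set.self_mem_Ici hx hx)

/-- Cauchy's estimate on circles of radius θ, which stay in the strip, turns the bound on the
amplitude into decay of its derivative. -/
theorem tendsto_amp_of_bound {m : ℕ} {a : Fin m → ℂ} {f : ℂ → ℂ} (hf : Differentiable ℂ f)
    {θ C R : ℝ} (hθ : 0 < θ)
    (h : ∀ t : ℂ, R ≤ t.re → |t.im| ≤ θ → ‖amp a f t - 1‖ ≤ C * ‖qp 1 t‖) :
    Tendsto (fun x : ℝ => amp a f x) atTop (𝓝 1) ∧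
      Tendsto (fun x : ℝ => deriv (amp a f) x) atTop (𝓝 0) := by
  have hq : Tendsto (fun x : ℝ => C * ‖qp 1 (x + (0 : ℂ))‖) atTop (𝓝 0) := by
    simpa using (tendsto_norm_qp le_rfl 0).const_mul C
  constructor
  · rw [tendsto_iff_norm_sub_tendsto_zero]
    refine squeeze_zero' (Eventually.of_forall fun _ => norm_nonneg _) ?_ hq
    filter_upwards [eventually_ge_atTop R] with x hx
    rw [add_zero]
    exact h x hx (by simpa using hθ.le)
  · have hq2 : Tendsto (fun x : ℝ => |C| * ‖qp 1 (x + (-θ : ℂ))‖ / θ) atTop (𝓝 0) := by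
      simpa using ((tendsto_norm_qp le_rfl (-θ : ℂ)).const_mul |C|).div_const θ
    refine squeeze_zero_norm' ?_ hq2
    filter_upwards [eventually_ge_atTop (R + θ)] with x hx
    have hd : deriv (amp a f) x = deriv (fun t => amp a f t - 1) x := by
      rw [deriv_sub_const]
    rw [hd]
    refine Complex.norm_deriv_le_of_forall_mem_sphere_norm_le hθ
      ((differentiable_amp a hf).sub_const 1).diffContOnCl fun t ht => ?_
    rw [mem_sphere_iff_norm] at ht
    have hre := (Complex.abs_re_le_norm (t - x)).trans ht.le
    have him := (Complex.abs_im_le_norm (t - x)).trans ht.le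
    rw [Complex.sub_re, Complex.ofReal_re, abs_le] at hre
    rw [Complex.sub_im, Complex.ofReal_im, sub_zero] at him
    refine (h t (by linarith) him).trans ?_
    refine mul_le_mul (le_abs_self C) ?_ (norm_nonneg _) (abs_nonneg _)
    rw [norm_qp, norm_qp]
    refine Real.exp_le_exp.2 ?_
    simp only [Complex.add_re, Complex.neg_re, Complex.ofReal_re, Nat.cast_one]
    linarith

/-- The constant Wronskian of f and g tends to 0 on the positive axis, so g is a multiple of f; the
common limit 1 makes the multiple trivial. -/
theorem eq_of_tendsto_amp {m : ℕ} (hm : 1 ≤ m) {a : Fin m → ℂ} {f g : ℂ → ℂ}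
    (hf : IsSolution a f) (hg : IsSolution a g)
    (f0 : Tendsto (fun x : ℝ => amp a f x) atTop (𝓝 1))
    (f1 : Tendsto (fun x : ℝ => deriv (amp a f) x) atTop (𝓝 0))
    (g0 : Tendsto (fun x : ℝ => amp a g x) atTop (𝓝 1))
    (g1 : Tendsto (fun x : ℝ => deriv (amp a g) x) atTop (𝓝 0)) : f = g := by
  obtain ⟨C, R, hC⟩ := exists_bound_phase hm a
  have hwr : ∀ t, wr f g t = 0 := by
    have h1 : Tendsto (fun x : ℝ => wr f g x) atTop (𝓝 0) := by
      have h2 : Tendsto (fun x : ℝ => amp a f x * deriv (amp a g) x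
          - deriv (amp a f) x * amp a g x) atTop (𝓝 0) := by
        simpa using (f0.mul g1).sub (f1.mul g0)
      have h3 := h2.norm.const_mul C
      rw [norm_zero, mul_zero] at h3
      refine squeeze_zero_norm' ?_ h3
      filter_upwards [eventually_ge_atTop R] with x hx
      rw [wr_eq_amp a hf.1 hg.1, norm_mul]
      exact mul_le_mul_of_nonneg_right (hC x hx) (norm_nonneg _)
    intro t
    have h2 : (fun x : ℝ => wr f g x) = fun _ => wr f g t :=
      funext fun x => wr_const hf hg _ _
    rw [h2] at h1
    exact tendsto_nhds_unique tendsto_const_nhds h1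
  obtain ⟨x, hx⟩ := (f0.eventually_ne one_ne_zero).exists
  have hfx : f x ≠ 0 := left_ne_zero_of_mul hx
  -- A solution vanishing at a point where f does not completes f to a basis.
  obtain ⟨u, hu, hu0, hu1⟩ := exists_solution hm a x 0 1
  have hne : wr f u x ≠ 0 := by
    rw [wr, hu0, hu1]
    simpa using hfx
  have hprop : ∀ t, g t = wr g u x / wr f u x * f t := by
    intro t
    rw [hg.eq_linear_comb hf hu x hne t, hwr]
    simp
  have hamp : ∀ t, amp a g t = wr g u x / wr f u x * amp a f t := by
    intro t
    rw [amp, amp, hprop t, mul_assoc]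
  have h1 : wr g u x / wr f u x = 1 := by
    have h2 := f0.const_mul (wr g u x / wr f u x)
    rw [mul_one] at h2
    simp only [← hamp] at h2
    exact tendsto_nhds_unique h2 g0
  funext t
  rw [hprop t, h1, one_mul]

/-! ### The recessive solution and its expansion in the full sector -/

theorem ampSum_succ {m : ℕ} (N : ℕ) (a : Fin m → ℂ) (t : ℂ) :
    ampSum (N + 1) a t = ampSum N a t + ampCoef a N * qp N t := Finset.sum_range_succ _ _

theorem dAmpSum_succ {m : ℕ} (N : ℕ) (a : Fin m → ℂ) (t : ℂ) :
    dAmpSum (N + 1) a t = dAmpSum N a t + ampCoef a N * (-((N : ℂ) / 2) * qp N t) :=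
  Finset.sum_range_succ _ _

theorem ampSum_one {m : ℕ} (a : Fin m → ℂ) (t : ℂ) : ampSum 1 a t = 1 := by
  simp [ampSum, ampCoef_zero, qp_zero]

theorem dAmpSum_one {m : ℕ} (a : Fin m → ℂ) (t : ℂ) : dAmpSum 1 a t = 0 := by
  simp [dAmpSum]

theorem exists_bound_ampSum_sub_one {m : ℕ} {K : Set (Fin m → ℂ)} (hK : IsCompact K)
    {N : ℕ} (hN : 1 ≤ N) : ∃ C : ℝ, 0 ≤ C ∧ ∀ a ∈ K, ∀ t : ℂ, 0 ≤ t.re →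
      ‖ampSum N a t - 1‖ ≤ C * ‖qp 1 t‖ := by
  induction N, hN using Nat.le_induction with
  | base => exact ⟨0, le_rfl, fun a _ t _ => by simp [ampSum_one]⟩
  | succ N hN ih =>
    obtain ⟨C, hC, h⟩ := ih
    obtain ⟨c, hc, h'⟩ := (isPoly_ampCoef (m := m) N).exists_bound hK
    refine ⟨C + c, by positivity, fun a ha t ht => ?_⟩
    rw [ampSum_succ, add_sub_right_comm, add_mul]
    refine (norm_add_le _ _).trans (add_le_add (h a ha t ht) ?_)
    rw [norm_mul]
    exact mul_le_mul (h' a ha) (norm_qp_le hN ht) (norm_nonneg _) hc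

theorem exists_recessive {m : ℕ} (hm : 1 ≤ m) (a : Fin m → ℂ) :
    ∃ f, IsSolution a f ∧ Tendsto (fun x : ℝ => amp a f x) atTop (𝓝 1) ∧
      Tendsto (fun x : ℝ => deriv (amp a f) x) atTop (𝓝 0) := by
  obtain ⟨C, R, hC, hR, h⟩ := exists_sectorial_solution hm (isCompact_singleton (x := a))
    (half_pos Real.pi_pos) (half_lt_self Real.pi_pos) (β := 0) (by simp) le_rfl
  obtain ⟨f, hf, h⟩ := h a rfl
  have hm' : (0 : ℝ) < m := by exact_mod_cast hm
  refine ⟨f, hf, tendsto_amp_of_bound hf.1 (θ := Real.pi / m) (C := C) (R := R) (by positivity) fun t ht hi => ?_⟩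
  have := (h t ht (by
    rw [zero_sub, abs_neg, abs_mul, abs_of_pos (by positivity)]
    calc (m : ℝ) / 2 * |t.im| ≤ m / 2 * (Real.pi / m) := by gcongr
      _ = Real.pi - Real.pi / 2 := by field_simp; ring)).1
  rwa [ampSum_one] at this

/-- The recessive solution. -/
noncomputable def recessive {m : ℕ} (hm : 1 ≤ m) (a : Fin m → ℂ) : ℂ → ℂ :=
  (exists_recessive hm a).choose

theorem isSolution_recessive {m : ℕ} (hm : 1 ≤ m) (a : Fin m → ℂ) :
    IsSolution a (recessive hm a) := (exists_recessive hm a).choose_spec.1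

theorem eq_recessive {m : ℕ} (hm : 1 ≤ m) {a : Fin m → ℂ} {f : ℂ → ℂ} (hf : IsSolution a f)
    {θ C R : ℝ} (hθ : 0 < θ)
    (h : ∀ t : ℂ, R ≤ t.re → |t.im| ≤ θ → ‖amp a f t - 1‖ ≤ C * ‖qp 1 t‖) :
    f = recessive hm a :=
  eq_of_tendsto_amp hm hf (isSolution_recessive hm a) (tendsto_amp_of_bound hf.1 hθ h).1
    (tendsto_amp_of_bound hf.1 hθ h).2 (exists_recessive hm a).choose_spec.2.1
    (exists_recessive hm a).choose_spec.2.2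

/-- For |β| + ε < π the sector of the solution built in direction β contains a neighbourhood of the
positive axis, so that solution is the recessive one. -/
theorem recessive_sector {m : ℕ} (hm : 1 ≤ m) {K : Set (Fin m → ℂ)} (hK : IsCompact K)
    {ε β : ℝ} (hε : 0 < ε) (hβε : |β| + ε < Real.pi) (hβ : 0 < Real.cos β) {N : ℕ} (hN : 1 ≤ N) :
    ∃ C R : ℝ, 0 ≤ C ∧ 0 ≤ R ∧ ∀ a ∈ K, ∀ t : ℂ, R ≤ t.re →
      |β - m / 2 * t.im| ≤ Real.pi - ε →
      ‖amp a (recessive hm a) t - ampSum N a t‖ ≤ C * ‖qp N t‖ ∧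
      ‖deriv (amp a (recessive hm a)) t - dAmpSum N a t‖ ≤ C * ‖qp N t‖ := by
  have hm' : (0 : ℝ) < m := by exact_mod_cast hm
  obtain ⟨C, R, hC, hR, h⟩ := exists_sectorial_solution hm hK hε
    (by linarith [abs_nonneg β]) hβ hN
  obtain ⟨C', hC', h'⟩ := exists_bound_ampSum_sub_one hK hN
  refine ⟨C, R, hC, hR, fun a ha => ?_⟩
  obtain ⟨f, hf, h⟩ := h a ha
  have : f = recessive hm a := by
    refine eq_recessive hm hf (θ := 2 / m * (Real.pi - ε - |β|)) (C := C + C') (R := R)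
      (mul_pos (by positivity) (by linarith)) fun t ht hi => ?_
    have ht0 : 0 ≤ t.re := hR.trans ht
    have h1 := (h t ht (by
      refine (abs_sub _ _).trans ?_
      rw [abs_mul, abs_of_pos (by positivity : (0 : ℝ) < m / 2)]
      have := mul_le_mul_of_nonneg_left hi (by positivity : (0 : ℝ) ≤ m / 2)
      have e : (m : ℝ) / 2 * (2 / m * (Real.pi - ε - |β|)) = Real.pi - ε - |β| := by
        field_simp
      linarith)).1
    have h2 := h' a ha t ht0
    have h3 := mul_le_mul_of_nonneg_left (norm_qp_le hN ht0) hC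
    have h4 := norm_sub_le_norm_sub_add_norm_sub (amp a f t) (ampSum N a t) 1
    linarith
  rw [← this]
  exact h

/-- The two directions β = ±(π/2 - δ), both with cos β > 0, reach |arg x| = (2/m)(3π/2 - 2δ), and δ
is chosen so that this equals θ. -/
theorem recessive_expansion {m : ℕ} (hm : 1 ≤ m) {K : Set (Fin m → ℂ)} (hK : IsCompact K)
    {θ : ℝ} (hθ : 0 < θ) (hθ' : θ < 3 * Real.pi / m) (N : ℕ) :
    ∃ C R : ℝ, 0 ≤ C ∧ 0 ≤ R ∧ ∀ a ∈ K, ∀ t : ℂ, R ≤ t.re → |t.im| ≤ θ →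
      ‖amp a (recessive hm a) t - ampSum N a t‖ ≤ C * ‖qp N t‖ ∧
      ‖deriv (amp a (recessive hm a)) t - dAmpSum N a t‖ ≤ C * ‖qp N t‖ := by
  have hm' : (0 : ℝ) < m := by exact_mod_cast hm
  set δ := (3 * Real.pi / 2 - m / 2 * θ) / 2 with hδ
  rw [lt_div_iff₀ hm'] at hθ'
  have hmθ : 0 < m * θ := by positivity
  have hπ := Real.pi_pos
  have hδ0 : 0 < δ := by rw [hδ]; linarith
  have hδ1 : δ < 3 * Real.pi / 4 := by rw [hδ]; linarith
  have hcos : 0 < Real.cos (Real.pi / 2 - δ) :=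
    Real.cos_pos_of_mem_Ioo ⟨by linarith, by linarith⟩
  have habs : |Real.pi / 2 - δ| + δ < Real.pi := by
    rcases abs_cases (Real.pi / 2 - δ) with h | h <;> linarith
  -- Order N + 1 is used because the sectorial estimate needs a positive order; the extra term is
  -- discarded at the end.
  obtain ⟨C₁, R₁, hC₁, hR₁, h₁⟩ := recessive_sector hm hK hδ0 habs hcos (Nat.le_add_left 1 N)
  obtain ⟨C₂, R₂, hC₂, hR₂, h₂⟩ := recessive_sector hm hK hδ0 (β := -(Real.pi / 2 - δ))
    (by rwa [abs_neg]) (by rwa [Real.cos_neg]) (Nat.le_add_left 1 N)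
  obtain ⟨c, hc, hcK⟩ := (isPoly_ampCoef (m := m) N).exists_bound hK
  refine ⟨max C₁ C₂ + c * (1 + N / 2), max R₁ R₂, by positivity, le_max_of_le_left hR₁,
    fun a ha t ht hi => ?_⟩
  have ht0 : 0 ≤ t.re := (le_max_of_le_left hR₁).trans ht
  have hi' : m / 2 * |t.im| ≤ 3 * Real.pi / 2 - 2 * δ := by
    have := mul_le_mul_of_nonneg_left hi (by positivity : (0 : ℝ) ≤ m / 2)
    rw [hδ]; linarith
  have hmain : ‖amp a (recessive hm a) t - ampSum (N + 1) a t‖ ≤ max C₁ C₂ * ‖qp (N + 1) t‖ ∧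
      ‖deriv (amp a (recessive hm a)) t - dAmpSum (N + 1) a t‖
        ≤ max C₁ C₂ * ‖qp (N + 1) t‖ := by
    have hq := norm_nonneg (qp (N + 1) t)
    rcases le_total 0 t.im with h0 | h0
    · rw [abs_of_nonneg h0] at hi'
      have := h₁ a ha t ((le_max_left _ _).trans ht) (by
        have := mul_nonneg (by positivity : (0 : ℝ) ≤ m / 2) h0
        rw [abs_le]
        constructor <;> linarith)
      have hm1 := mul_le_mul_of_nonneg_right (le_max_left C₁ C₂) hq
      exact ⟨this.1.trans hm1, this.2.trans hm1⟩
    · rw [abs_of_nonpos h0] at hi'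
      have := h₂ a ha t ((le_max_right _ _).trans ht) (by
        have := mul_nonneg (by positivity : (0 : ℝ) ≤ m / 2) (neg_nonneg.2 h0)
        rw [abs_le]
        constructor <;> linarith)
      have hm1 := mul_le_mul_of_nonneg_right (le_max_right C₁ C₂) hq
      exact ⟨this.1.trans hm1, this.2.trans hm1⟩
  have hq1 := mul_le_mul_of_nonneg_left (norm_qp_le (Nat.le_succ N) ht0)
    (le_max_of_le_left hC₁ : 0 ≤ max C₁ C₂)
  have hq0 := norm_nonneg (qp N t)
  have hcN : ‖ampCoef a N‖ * ‖qp N t‖ ≤ c * ‖qp N t‖ :=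
    mul_le_mul_of_nonneg_right (hcK a ha) hq0
  have hN0 : (0 : ℝ) ≤ N / 2 := by positivity
  have hcN2 := mul_le_mul_of_nonneg_left hcN hN0
  have hcq : 0 ≤ c * ‖qp N t‖ := by positivity
  have hcq2 : 0 ≤ (N : ℝ) / 2 * (c * ‖qp N t‖) := by positivity
  constructor
  · have e : amp a (recessive hm a) t - ampSum N a t
        = (amp a (recessive hm a) t - ampSum (N + 1) a t) + ampCoef a N * qp N t := by
      rw [ampSum_succ]; ring
    have h3 := norm_add_le (amp a (recessive hm a) t - ampSum (N + 1) a t) (ampCoef a N * qp N t)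
    rw [← e, norm_mul] at h3
    linarith [hmain.1]
  · have e : deriv (amp a (recessive hm a)) t - dAmpSum N a t
        = (deriv (amp a (recessive hm a)) t - dAmpSum (N + 1) a t)
          + -((N : ℂ) / 2) * (ampCoef a N * qp N t) := by
      rw [dAmpSum_succ]; ring
    have h3 := norm_add_le (deriv (amp a (recessive hm a)) t - dAmpSum (N + 1) a t)
      (-((N : ℂ) / 2) * (ampCoef a N * qp N t))
    rw [← e, norm_mul, norm_neg, norm_div, Complex.norm_natCast, Complex.norm_ofNat,
      norm_mul] at h3
    linarith [hmain.2]

theorem isPhiZero_recessive {m : ℕ} (hm : 1 ≤ m) : IsPhiZero m (fun t a => recessive hm a t) := by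
  refine ⟨isSolution_recessive hm, fun n => (isPoly_ampCoef (m := m) n).choose, ?_, ?_, ?_⟩
  · refine MvPolynomial.funext fun a => ?_
    exact ((isPoly_ampCoef (m := m) 0).choose_spec a).trans ((ampCoef_zero a).trans (map_one _).symm)
  · intro he n hn
    refine MvPolynomial.funext fun a => ?_
    exact ((isPoly_ampCoef (m := m) n).choose_spec a).trans
      ((ampCoef_odd he a hn).trans (map_zero _).symm)
  · intro K hK θ hθ hθ' N
    obtain ⟨C, R, -, -, h⟩ := recessive_expansion hm hK hθ hθ' N
    refine ⟨C, R, fun a ha t ht hi => ?_⟩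
    have h1 := (h a ha t ht hi).1
    rw [norm_qp] at h1
    convert! h1 using 2
    refine congrArg _ (Finset.sum_congr rfl fun n _ => ?_)
    rw [(isPoly_ampCoef (m := m) n).choose_spec a, qp]

theorem IsPhiZero.eq_recessive {m : ℕ} (hm : 1 ≤ m) {Φ : ℂ → (Fin m → ℂ) → ℂ}
    (h : IsPhiZero m Φ) (a : Fin m → ℂ) : (fun t => Φ t a) = recessive hm a := by
  have hm' : (0 : ℝ) < m := by exact_mod_cast hm
  obtain ⟨hs, c, hc, -, hb⟩ := h
  obtain ⟨C, R, hCR⟩ := hb {a} isCompact_singleton (Real.pi / m) (by positivity)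
    (by gcongr; linarith [Real.pi_pos]) 1
  refine ZeroInf.eq_recessive hm (hs a) (θ := Real.pi / m) (C := C) (R := R) (by positivity)
    fun t ht hi => ?_
  have := hCR a rfl t ht hi
  rw [norm_qp]
  simpa [hc, amp] using this

theorem phiZero_eq {m : ℕ} (hm : 1 ≤ m) (a : Fin m → ℂ) :
    (fun t => PhiZero m t a) = recessive hm a :=
  (Classical.epsilon_spec (p := IsPhiZero m) ⟨_, isPhiZero_recessive hm⟩).eq_recessive hm a

/-! ### Symmetry under rotations -/

/-- The shift of `t` corresponding to the rotation `x ↦ ωx`. -/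
noncomputable def rot (m : ℕ) : ℂ := 2 * Real.pi * Complex.I / m

theorem om_eq (m : ℕ) : om m = Complex.exp (rot m) := rfl

theorem omPow_eq (m : ℕ) (z : ℂ) : omPow m z = Complex.exp (rot m * z) := rfl

theorem om_ne_zero (m : ℕ) : om m ≠ 0 := Complex.exp_ne_zero _

theorem om_zpow (m : ℕ) (k : ℤ) : om m ^ k = Complex.exp (rot m * k) := by
  rw [om_eq, ← Complex.exp_int_mul, mul_comm]

theorem om_pow (m k : ℕ) : om m ^ k = Complex.exp (rot m * k) := by
  rw [om_eq, ← Complex.exp_nat_mul, mul_comm]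

theorem om_pow_self {m : ℕ} (hm : 1 ≤ m) : om m ^ m = 1 := by
  have hm' : (m : ℂ) ≠ 0 := by exact_mod_cast (by omega : m ≠ 0)
  rw [om_pow, rot, div_mul_cancel₀ _ hm', Complex.exp_two_pi_mul_I]

theorem om_zpow_pow {m : ℕ} (hm : 1 ≤ m) (k : ℤ) : (om m ^ k) ^ m = 1 := by
  rw [← zpow_natCast, ← zpow_mul, mul_comm, zpow_mul, zpow_natCast, om_pow_self hm, one_zpow]

theorem dil_dil {n : ℕ} (σ τ : ℂ) (a : Fin n → ℂ) : dil σ (dil τ a) = dil (σ * τ) a := by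
  funext i
  simp only [dil, mul_pow]
  ring

theorem dil_one {n : ℕ} (a : Fin n → ℂ) : dil 1 a = a := by
  funext i
  simp [dil]

/-- As τ^m = 1 the last entry is unchanged, so rotations act on a' and leave p alone. -/
theorem dil_full {m : ℕ} {τ : ℂ} (hτ : τ ^ m = 1) (a' : Fin (m - 1) → ℂ) (p : ℂ) :
    dil τ (full m a' p) = full m (dil τ a') p := by
  funext i
  simp only [dil, full]
  split_ifs with h
  · rfl
  · rw [show i.val + 1 = m by omega, hτ, one_mul]

theorem coef_dil {m : ℕ} (τ : ℂ) (a : Fin m → ℂ) (k : ℕ) :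
    coef (dil τ a) k = τ ^ k * coef a k := by
  cases k with
  | zero => simp [coef]
  | succ k =>
    simp only [coef]
    split_ifs with h
    · rfl
    · rw [mul_zero]

theorem sqrtCoef_dil {m : ℕ} (τ : ℂ) (a : Fin m → ℂ) (k : ℕ) :
    sqrtCoef (dil τ a) k = τ ^ k * sqrtCoef a k := by
  induction k using Nat.strong_induction_on with
  | _ k ih =>
    cases k with
    | zero => simp [sqrtCoef_zero]
    | succ k =>
      rw [sqrtCoef, sqrtCoef, coef_dil]
      have : ∑ j : Fin k, sqrtCoef (dil τ a) (j + 1) * sqrtCoef (dil τ a) (k - j)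
          = τ ^ (k + 1) * ∑ j : Fin k, sqrtCoef a (j + 1) * sqrtCoef a (k - j) := by
        rw [Finset.mul_sum]
        refine Finset.sum_congr rfl fun j _ => ?_
        have hj := j.2
        rw [ih _ (by omega), ih _ (by omega),
          show k + 1 = (j.val + 1) + (k - j) by omega, pow_add]
        ring
      rw [this]
      ring

theorem P_dil {m : ℕ} {τ : ℂ} (hτ : τ ^ m = 1) (a : Fin m → ℂ) (x : ℂ) :
    P (dil τ a) (τ * x) = P a x := by
  refine Finset.sum_congr rfl fun k hk => ?_
  rw [Finset.mem_range] at hk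
  have : τ ^ k * τ ^ (m - k) = 1 := by rw [← pow_add, show k + (m - k) = m by omega, hτ]
  rw [coef_dil, mul_pow]
  linear_combination (coef a k * x ^ (m - k)) * this

theorem deriv_comp_add (f : ℂ → ℂ) (c : ℂ) :
    deriv (fun t => f (t + c)) = fun t => deriv f (t + c) :=
  funext fun t => deriv_comp_add_const f c t

/-- Rotations map solutions to solutions. -/
theorem IsSolution.comp_rot {m : ℕ} (hm : 1 ≤ m) {a : Fin m → ℂ} {k : ℤ} {f : ℂ → ℂ}
    (hf : IsSolution (dil (om m ^ k) a) f) : IsSolution a (fun t => f (t + rot m * k)) := by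
  rw [isSolution_iff] at hf ⊢
  refine ⟨hf.1.comp (differentiable_id.add_const _), fun t => ?_⟩
  rw [deriv_comp_add, deriv_comp_add]
  simp only
  rw [hf.2, Complex.exp_add, ← om_zpow, mul_comm (Complex.exp t),
    P_dil (om_zpow_pow hm k)]

theorem wr_comp_add (f g : ℂ → ℂ) (c t : ℂ) :
    wr (fun t => f (t + c)) (fun t => g (t + c)) t = Complex.exp c * wr f g (t + c) := by
  simp only [wr, deriv_comp_add]
  rw [← mul_assoc, ← Complex.exp_add]
  congr 2
  ring

/-- Under the rotation x^{m/2-k} gains ω^{m/2-k} and b_{m/2-k} gains ω^k, in all ω^{m/2} = -1.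
Recessive and dominant exponentials are thus exchanged. -/
theorem S_rot {m : ℕ} (hm : 1 ≤ m) (a : Fin m → ℂ) (t : ℂ) :
    S (dil (om m) a) (t + rot m) = -S a t := by
  have hm' : (m : ℂ) ≠ 0 := by exact_mod_cast (by omega : m ≠ 0)
  rw [S, S, ← Finset.sum_neg_distrib]
  refine Finset.sum_congr rfl fun k _ => ?_
  have e1 : Complex.exp (((m : ℂ) / 2 - k) * (t + rot m)) * om m ^ k
      = -Complex.exp (((m : ℂ) / 2 - k) * t) := by
    rw [om_pow, ← Complex.exp_add, show ((m : ℂ) / 2 - k) * (t + rot m) + rot m * k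
      = ((m : ℂ) / 2 - k) * t + Real.pi * Complex.I by rw [rot]; field_simp; ring,
      Complex.exp_add, Complex.exp_pi_mul_I]
    ring
  rw [sqrtCoef_dil]
  linear_combination (sqrtCoef a k / ((m : ℂ) / 2 - k)) * e1

theorem dS_rot {m : ℕ} (hm : 1 ≤ m) (a : Fin m → ℂ) (t : ℂ) :
    dS (dil (om m) a) (t + rot m) = -dS a t := by
  have h1 := (hasDerivAt_S (dil (om m) a) (t + rot m)).comp_add_const t (rot m)
  have h2 : (fun t => S (dil (om m) a) (t + rot m)) = fun t => -S a t := funext (S_rot hm a)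
  rw [h2] at h1
  exact h1.unique (hasDerivAt_S a t).neg

theorem r_add_r_rot {m : ℕ} (hm : 1 ≤ m) (a : Fin m → ℂ) :
    r a + r (dil (om m) a) = 1 - (m : ℂ) / 2 := by
  have hm' : (m : ℂ) ≠ 0 := by exact_mod_cast (by omega : m ≠ 0)
  unfold r
  split_ifs with he
  · have e1 : om m ^ (m / 2) = -1 := by
      rw [om_pow, Nat.cast_div he.two_dvd (by norm_num), rot, Nat.cast_ofNat,
        show 2 * (Real.pi : ℂ) * Complex.I / m * (m / 2) = Real.pi * Complex.I by field_simp,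
        Complex.exp_pi_mul_I]
    rw [sqrtCoef_dil, e1]
    ring
  · ring

/-! ### The Wronskians of the solutions at infinity -/

theorem tendsto_recessive {m : ℕ} (hm : 1 ≤ m) (a : Fin m → ℂ) {τ : ℂ}
    (hτ : |τ.im| ≤ Real.pi / m) :
    Tendsto (fun x : ℝ => amp a (recessive hm a) (x + τ)) atTop (𝓝 1) ∧
      Tendsto (fun x : ℝ => deriv (amp a (recessive hm a)) (x + τ)) atTop (𝓝 0) := by
  have hm' : (0 : ℝ) < m := by exact_mod_cast hm
  obtain ⟨C, R, -, -, h⟩ := recessive_expansion hm (isCompact_singleton (x := a))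
    (θ := Real.pi / m) (by positivity) (by gcongr; linarith [Real.pi_pos]) 1
  have hq : Tendsto (fun x : ℝ => C * ‖qp 1 (x + τ)‖) atTop (𝓝 0) := by
    simpa using (tendsto_norm_qp le_rfl τ).const_mul C
  have hev : ∀ᶠ x : ℝ in atTop, R ≤ ((x : ℂ) + τ).re := by
    filter_upwards [eventually_ge_atTop (R - τ.re)] with x hx
    rw [Complex.add_re, Complex.ofReal_re]
    linarith
  have him : ∀ x : ℝ, |((x : ℂ) + τ).im| ≤ Real.pi / m := fun x => by simpa using hτ
  constructor
  · rw [tendsto_iff_norm_sub_tendsto_zero]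
    refine squeeze_zero' (Eventually.of_forall fun _ => norm_nonneg _) ?_ hq
    filter_upwards [hev] with x hx
    simpa only [ampSum_one] using (h a rfl _ hx (him x)).1
  · refine squeeze_zero_norm' ?_ hq
    filter_upwards [hev] with x hx
    simpa only [dAmpSum_one, sub_zero] using (h a rfl _ hx (him x)).2

theorem tendsto_fA {m : ℕ} (hm : 1 ≤ m) (a : Fin m → ℂ) (τ : ℂ) :
    Tendsto (fun x : ℝ => fA a (x + τ)) atTop (𝓝 1) := by
  obtain ⟨C, -, h⟩ := exists_bound_fA hm (isCompact_singleton (x := a))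
  have hq : Tendsto (fun x : ℝ => C * ‖qp 1 (x + τ)‖) atTop (𝓝 0) := by
    simpa using (tendsto_norm_qp le_rfl τ).const_mul C
  rw [tendsto_iff_norm_sub_tendsto_zero]
  refine squeeze_zero' (Eventually.of_forall fun _ => norm_nonneg _) ?_ hq
  filter_upwards [eventually_ge_atTop (-τ.re)] with x hx
  refine h a rfl _ ?_
  rw [Complex.add_re, Complex.ofReal_re]
  linarith

/-- The exponentials cancel by `S_rot` and the powers combine to x^{-m/2} by `r_add_r_rot`. What
survives at infinity is x^{-m/2}·2 dS/dt, which tends to 2, times the constant ω^{r(ω·a)}. -/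
theorem wr_recessive {m : ℕ} (hm : 1 ≤ m) (a : Fin m → ℂ) (t : ℂ) :
    wr (recessive hm a) (fun t => recessive hm (dil (om m) a) (t + rot m)) t
      = 2 * omPow m (r (dil (om m) a)) := by
  set b := dil (om m) a with hb
  have hm' : (0 : ℝ) < m := by exact_mod_cast hm
  have hm0 : (m : ℂ) ≠ 0 := by exact_mod_cast (by omega : m ≠ 0)
  have hu := isSolution_recessive hm a
  have hv := isSolution_recessive hm b
  have hv' : IsSolution a (fun t => recessive hm b (t + rot m)) := by
    have : IsSolution (dil (om m ^ (1 : ℤ)) a) (recessive hm b) := by rwa [zpow_one]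
    simpa using this.comp_rot hm
  have hform : ∀ t, wr (recessive hm a) (fun t => recessive hm b (t + rot m)) t
      = omPow m (r b) * (qp m t * (amp a (recessive hm a) t
        * deriv (amp b (recessive hm b)) (t + rot m)
        - deriv (amp a (recessive hm a)) t * amp b (recessive hm b) (t + rot m)
        + amp a (recessive hm a) t * amp b (recessive hm b) (t + rot m) * (r b - r a))
        + 2 * (amp a (recessive hm a) t * amp b (recessive hm b) (t + rot m)
          * (fA a t + (r a - 1 / 2) * qp m t))) := by
    intro t
    have e1 : dS a t * qp m t = fA a t + (r a - 1 / 2) * qp m t := by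
      have h1 := zz_mul_fA a t
      have h2 := zz_mul_qp m t
      linear_combination (-qp m t) * h1 + fA a t * h2
    have e2 : Complex.exp (-t) * Complex.exp (r a * t - S a t)
        * Complex.exp (r b * (t + rot m) - S b (t + rot m)) = omPow m (r b) * qp m t := by
      rw [S_rot hm, omPow_eq, qp, ← Complex.exp_add, ← Complex.exp_add, ← Complex.exp_add]
      congr 1
      linear_combination t * r_add_r_rot hm a
    rw [wr, deriv_comp_add]
    simp only
    rw [deriv_eq_amp a hu.1, deriv_eq_amp b hv.1, dS_rot hm, eq_amp_mul a (recessive hm a) t,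
      eq_amp_mul b (recessive hm b) (t + rot m), ← e1]
    linear_combination (amp a (recessive hm a) t
        * deriv (amp b (recessive hm b)) (t + rot m)
        - deriv (amp a (recessive hm a)) t * amp b (recessive hm b) (t + rot m)
        + amp a (recessive hm a) t * amp b (recessive hm b) (t + rot m) * (r b - r a)
        + 2 * (amp a (recessive hm a) t * amp b (recessive hm b) (t + rot m) * dS a t)) * e2
  -- On the ray arg x = -π/m both x and ωx stay within |arg| ≤ π/m, where both expansions hold.
  set τ : ℂ := -(rot m / 2) with hτ
  have hrot : rot m = ((2 * (Real.pi / m) : ℝ) : ℂ) * Complex.I := by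
    rw [rot]; push_cast; ring
  have him : (rot m).im = 2 * (Real.pi / m) := by
    rw [hrot, Complex.im_ofReal_mul, Complex.I_im, mul_one]
  have hτ1 : |τ.im| ≤ Real.pi / m := by
    have : τ.im = -(Real.pi / m) := by
      rw [hτ, Complex.neg_im, show rot m / 2 = ((Real.pi / m : ℝ) : ℂ) * Complex.I by
        rw [hrot]; push_cast; ring, Complex.im_ofReal_mul, Complex.I_im, mul_one]
    rw [this, abs_neg, abs_of_pos (by positivity)]
  have hτ2 : |(τ + rot m).im| ≤ Real.pi / m := by
    have : (τ + rot m) = -τ := by rw [hτ]; ring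
    rwa [this, Complex.neg_im, abs_neg]
  obtain ⟨u0, u1⟩ := tendsto_recessive hm a hτ1
  obtain ⟨v0, v1⟩ := tendsto_recessive hm b hτ2
  simp only [← add_assoc] at v0 v1
  have hq : Tendsto (fun x : ℝ => qp m (x + τ)) atTop (𝓝 0) :=
    tendsto_zero_iff_norm_tendsto_zero.2 (tendsto_norm_qp hm τ)
  have hlim := ((hq.mul (((u0.mul v1).sub (u1.mul v0)).add ((u0.mul v0).mul_const (r b - r a)))).add
    (((u0.mul v0).mul ((tendsto_fA hm a τ).add (hq.const_mul (r a - 1 / 2)))).const_mul 2)).const_mul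
    (omPow m (r b))
  have hconst : (fun x : ℝ => wr (recessive hm a) (fun t => recessive hm b (t + rot m)) (x + τ))
      = fun _ => wr (recessive hm a) (fun t => recessive hm b (t + rot m)) t :=
    funext fun x => wr_const hu hv' _ _
  simp only [← hform, hconst] at hlim
  have := tendsto_nhds_unique tendsto_const_nhds hlim
  rw [this]
  ring

theorem Phi_eq {m : ℕ} (hm : 1 ≤ m) (k : ℤ) (a : Fin m → ℂ) :
    (fun t => Phi m k t a) = fun t => recessive hm (dil (om m ^ k) a) (t + rot m * k) :=
  funext fun t => congrFun (phiZero_eq hm (dil (om m ^ k) a)) (t + rot m * k)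

theorem isSolution_Phi {m : ℕ} (hm : 1 ≤ m) (k : ℤ) (a : Fin m → ℂ) :
    IsSolution a (fun t => Phi m k t a) := by
  rw [Phi_eq hm]
  exact (isSolution_recessive hm _).comp_rot hm

theorem wr_Phi {m : ℕ} (hm : 1 ≤ m) (k : ℤ) (a : Fin m → ℂ) (t : ℂ) :
    wr (fun t => Phi m (k - 1) t a) (fun t => Phi m k t a) t
      = 2 * om m ^ (k - 1) * omPow m (r (dil (om m ^ k) a)) := by
  have hk : dil (om m ^ k) a = dil (om m) (dil (om m ^ (k - 1)) a) := by
    rw [dil_dil, ← zpow_one_add₀ (om_ne_zero m)]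
    congr 2
    ring
  have h1 : (fun t => Phi m k t a) = fun t => (fun t => recessive hm
      (dil (om m) (dil (om m ^ (k - 1)) a)) (t + rot m)) (t + rot m * (k - 1 : ℤ)) := by
    rw [Phi_eq hm, hk]
    funext t
    congr 1
    push_cast
    ring
  rw [h1, Phi_eq hm]
  refine (wr_comp_add (recessive hm (dil (om m ^ (k - 1)) a)) (fun t => recessive hm
      (dil (om m) (dil (om m ^ (k - 1)) a)) (t + rot m)) _ t).trans ?_
  rw [wr_recessive, ← om_zpow, ← hk]
  ring

/-! ### The Fuchs basis under rotations -/

theorem exp_s_mul_rot (m : ℕ) (k : ℤ) (p : ℂ) :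
    Complex.exp (s p * (rot m * k)) = omPow m (k * s p) := by
  rw [omPow_eq]; congr 1; ring

/-- The rotated data, suitably rescaled, satisfy the defining normalisations, so uniqueness
identifies them with the original basis. -/
theorem fuchs_rot {m : ℕ} (hm : 1 ≤ m) (k : ℤ) (a' : Fin (m - 1) → ℂ) {p : ℂ}
    (hp : p ∈ admissible) : fuchs m a' p
      = ⟨(fuchs m (dil (om m ^ k) a') p).lam * Complex.exp (p * (rot m * k)),
        fun x => (fuchs m (dil (om m ^ k) a') p).g₁ (om m ^ k * x),
        fun x => (fuchs m (dil (om m ^ k) a') p).g₂ (om m ^ k * x)⟩ := by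
  have hd := isFuchs_fuchs hm (dil (om m ^ k) a') hp
  set d := fuchs m (dil (om m ^ k) a') p
  obtain ⟨h1, h2, h3, h4, h5, h6, h7, h8⟩ := hd
  rw [← dil_full (om_zpow_pow hm k)] at h4 h5
  set c := rot m * k with hc
  have s1 : IsSolution (full m a' p) (fun t => d.f₁ p (t + c)) := h4.comp_rot hm
  have s2 : IsSolution (full m a' p) (fun t => d.f₂ p (t + c)) := h5.comp_rot hm
  refine fuchs_eq_of_isFuchs hm hp ⟨h1.comp (differentiable_id.const_mul _),
    h2.comp (differentiable_id.const_mul _), by simpa using h3, ?_, ?_, fun h => ?_,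
    fun n hn h => ?_, fun h => ?_⟩
  · convert! s1.const_mul (Complex.exp (-(s p * c))) using 1
    funext t
    simp only [FuchsData.f₁]
    have e1 : Complex.exp (-(s p * c)) * Complex.exp (s p * (t + c)) = Complex.exp (s p * t) := by
      rw [← Complex.exp_add]; congr 1; ring
    rw [Complex.exp_add t c, om_zpow, ← hc, mul_comm (Complex.exp c), ← mul_assoc, e1]
  -- The logarithm of the rotated point adds a multiple of f₁, which has to be subtracted to recover
  -- the normal form of f₂.
  · convert! s2.linear_comb s1 (Complex.exp (-(s (-p) * c)))
      (-(d.lam * Complex.exp (p * c) * c * Complex.exp (-(s p * c)))) using 1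
    funext t
    simp only [FuchsData.f₁, FuchsData.f₂]
    rw [Complex.exp_add t c, om_zpow, ← hc, mul_comm (Complex.exp c)]
    have e1 : Complex.exp (-(s p * c)) * Complex.exp (s p * (t + c)) = Complex.exp (s p * t) := by
      rw [← Complex.exp_add]; congr 1; ring
    have e2 : Complex.exp (-(s (-p) * c)) * Complex.exp (s (-p) * (t + c))
        = Complex.exp (s (-p) * t) := by
      rw [← Complex.exp_add]; congr 1; ring
    have e3 : Complex.exp (-(s (-p) * c)) = Complex.exp (p * c) * Complex.exp (-(s p * c)) := by
      rw [← Complex.exp_add]; congr 1; rw [s, s]; ring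
    rw [← e1, ← e2, e3]
    ring
  · exact ⟨by simp [(h6 h).1], by simpa using (h6 h).2⟩
  · refine ⟨by simpa using (h7 n hn h).1, ?_⟩
    simp only
    rw [iteratedDeriv_comp_const_mul h2.contDiff]
    simp [(h7 n hn h).2]
  · exact ⟨by simp [h, (h8 h).1], by simpa using (h8 h).2⟩

theorem f₁_rot {m : ℕ} (hm : 1 ≤ m) (k : ℤ) (a' : Fin (m - 1) → ℂ) {p : ℂ}
    (hp : p ∈ admissible) (t : ℂ) :
    f₁ m (t + rot m * k) (dil (om m ^ k) a') p = omPow m (k * s p) * f₁ m t a' p := by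
  simp only [f₁]
  rw [fuchs_rot hm k a' hp, ← exp_s_mul_rot]
  simp only [FuchsData.f₁]
  rw [mul_add, Complex.exp_add, Complex.exp_add, om_zpow]
  ring_nf

theorem f₂_rot {m : ℕ} (hm : 1 ≤ m) (k : ℤ) (a' : Fin (m - 1) → ℂ) {p : ℂ}
    (hp : p ∈ admissible) (t : ℂ) :
    f₂ m (t + rot m * k) (dil (om m ^ k) a') p = omPow m (k * s (-p)) *
      (f₂ m t a' p + lam m a' p * (rot m * k) * f₁ m t a' p) := by
  have h1 := f₁_rot hm k a' hp t
  simp only [f₁, f₂, lam] at h1 ⊢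
  rw [FuchsData.f₂, h1, fuchs_rot hm k a' hp, ← exp_s_mul_rot, ← exp_s_mul_rot, FuchsData.f₂]
  simp only
  have e3 : Complex.exp (s p * (rot m * k))
      = Complex.exp (s (-p) * (rot m * k)) * Complex.exp (p * (rot m * k)) := by
    rw [← Complex.exp_add]; congr 1; rw [s, s]; ring
  rw [e3, mul_add (s (-p)), Complex.exp_add, Complex.exp_add t, om_zpow]
  ring_nf

/-! ### The connection matrix -/

theorem isSolution_f₁ {m : ℕ} (hm : 1 ≤ m) (a' : Fin (m - 1) → ℂ) {p : ℂ} (hp : p ∈ admissible) :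
    IsSolution (full m a' p) (fun t => f₁ m t a' p) := (isFuchs_fuchs hm a' hp).2.2.2.1

theorem isSolution_f₂ {m : ℕ} (hm : 1 ≤ m) (a' : Fin (m - 1) → ℂ) {p : ℂ} (hp : p ∈ admissible) :
    IsSolution (full m a' p) (fun t => f₂ m t a' p) := (isFuchs_fuchs hm a' hp).2.2.2.2.1

theorem wr_f₁_f₂ {m : ℕ} (hm : 1 ≤ m) (a' : Fin (m - 1) → ℂ) {p : ℂ} (hp : p ∈ admissible)
    (t : ℂ) : wr (fun t => f₁ m t a' p) (fun t => f₂ m t a' p) t = if p = 0 then 1 else -p :=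
  (isFuchs_fuchs hm a' hp).wr_eq hp t

theorem wr_linear_comb {u v : ℂ → ℂ} (hu : Differentiable ℂ u) (hv : Differentiable ℂ v)
    (A B C D t : ℂ) : wr (fun t => A * u t + B * v t) (fun t => C * u t + D * v t) t
      = (A * D - B * C) * wr u v t := by
  have h : ∀ A B : ℂ, deriv (fun t => A * u t + B * v t) t = A * deriv u t + B * deriv v t :=
    fun A B => (((hu t).hasDerivAt.const_mul A).add ((hv t).hasDerivAt.const_mul B)).deriv
  simp only [wr, h]
  ring

theorem isConn_iff {m : ℕ} {k : ℤ} {a' : Fin (m - 1) → ℂ} {p : ℂ}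
    {N : Matrix (Fin 2) (Fin 2) ℂ} : IsConn m k a' p N ↔ ∀ t,
      Phi m (k - 1) t (full m a' p) = N 0 0 * f₁ m t a' p + N 0 1 * f₂ m t a' p ∧
      Phi m k t (full m a' p) = N 1 0 * f₁ m t a' p + N 1 1 * f₂ m t a' p := by
  refine forall_congr' fun t => ?_
  constructor
  · intro h
    exact ⟨by simpa [Matrix.mulVec, dotProduct, Fin.sum_univ_two] using congrFun h 0,
      by simpa [Matrix.mulVec, dotProduct, Fin.sum_univ_two] using congrFun h 1⟩
  · rintro ⟨h0, h1⟩
    funext i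
    fin_cases i
    · simpa [Matrix.mulVec, dotProduct, Fin.sum_univ_two] using h0
    · simpa [Matrix.mulVec, dotProduct, Fin.sum_univ_two] using h1

/-- Wronskians with f₂ and with f₁ extract the two coefficients. -/
theorem coeff_unique {m : ℕ} (hm : 1 ≤ m) {a' : Fin (m - 1) → ℂ} {p : ℂ} (hp : p ∈ admissible)
    {A B C D : ℂ} (h : ∀ t, A * f₁ m t a' p + B * f₂ m t a' p
      = C * f₁ m t a' p + D * f₂ m t a' p) : A = C ∧ B = D := by
  have hd1 := (isSolution_f₁ hm a' hp).1
  have hd2 := (isSolution_f₂ hm a' hp).1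
  have hW : wr (fun t => f₁ m t a' p) (fun t => f₂ m t a' p) 0 ≠ 0 := by
    rw [wr_f₁_f₂ hm a' hp]; exact wrFuchs_ne_zero p
  have hf := funext h
  have h1 := wr_linear_comb hd1 hd2 A B 0 1 0
  have h2 := wr_linear_comb hd1 hd2 C D 0 1 0
  have h3 := wr_linear_comb hd1 hd2 1 0 A B 0
  have h4 := wr_linear_comb hd1 hd2 1 0 C D 0
  rw [hf, h2] at h1
  rw [hf, h4] at h3
  have h5 := mul_right_cancel₀ hW h1
  have h6 := mul_right_cancel₀ hW h3
  exact ⟨by linear_combination -h5, by linear_combination -h6⟩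

theorem IsConn.unique {m : ℕ} (hm : 1 ≤ m) {k : ℤ} {a' : Fin (m - 1) → ℂ} {p : ℂ}
    (hp : p ∈ admissible) {N N' : Matrix (Fin 2) (Fin 2) ℂ} (h : IsConn m k a' p N)
    (h' : IsConn m k a' p N') : N = N' := by
  rw [isConn_iff] at h h'
  have e0 := coeff_unique hm hp fun t => (h t).1.symm.trans (h' t).1
  have e1 := coeff_unique hm hp fun t => (h t).2.symm.trans (h' t).2
  ext i j
  fin_cases i <;> fin_cases j
  exacts [e0.1, e0.2, e1.1, e1.2]

/-- The coefficients of a solution in the Fuchs basis. -/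
theorem eq_fuchs_comb {m : ℕ} (hm : 1 ≤ m) {a' : Fin (m - 1) → ℂ} {p : ℂ} (hp : p ∈ admissible)
    {f : ℂ → ℂ} (hf : IsSolution (full m a' p) f) (t : ℂ) :
    f t = wr f (fun t => f₂ m t a' p) 0 / (if p = 0 then 1 else -p) * f₁ m t a' p
      + wr (fun t => f₁ m t a' p) f 0 / (if p = 0 then 1 else -p) * f₂ m t a' p := by
  have hW := wr_f₁_f₂ hm a' hp 0
  rw [← hW]
  exact hf.eq_linear_comb (isSolution_f₁ hm a' hp) (isSolution_f₂ hm a' hp) 0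
    (by rw [hW]; exact wrFuchs_ne_zero p) t

theorem isConn_M {m : ℕ} (hm : 1 ≤ m) (k : ℤ) (a' : Fin (m - 1) → ℂ) {p : ℂ}
    (hp : p ∈ admissible) : IsConn m k a' p (M m k a' p) :=
  Classical.epsilon_spec ⟨!![_, _; _, _], isConn_iff.2 fun t =>
    ⟨eq_fuchs_comb hm hp (isSolution_Phi hm (k - 1) (full m a' p)) t,
      eq_fuchs_comb hm hp (isSolution_Phi hm k (full m a' p)) t⟩⟩

theorem isConn_iff_eq {m : ℕ} (hm : 1 ≤ m) (k : ℤ) (a' : Fin (m - 1) → ℂ) {p : ℂ}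
    (hp : p ∈ admissible) (N : Matrix (Fin 2) (Fin 2) ℂ) :
    IsConn m k a' p N ↔ N = M m k a' p :=
  ⟨fun h => h.unique hm hp (isConn_M hm k a' hp), fun h => h ▸ isConn_M hm k a' hp⟩

theorem M_apply_zero {m : ℕ} (hm : 1 ≤ m) (k : ℤ) (a' : Fin (m - 1) → ℂ) {p : ℂ}
    (hp : p ∈ admissible) :
    M m k a' p 0 0 = wr (fun t => Phi m (k - 1) t (full m a' p)) (fun t => f₂ m t a' p) 0
        / (if p = 0 then 1 else -p) ∧
      M m k a' p 0 1 = wr (fun t => f₁ m t a' p) (fun t => Phi m (k - 1) t (full m a' p)) 0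
        / (if p = 0 then 1 else -p) :=
  coeff_unique hm hp fun t => ((isConn_iff.1 (isConn_M hm k a' hp) t).1.symm).trans
    (eq_fuchs_comb hm hp (isSolution_Phi hm (k - 1) (full m a' p)) t)

/-- Both rows are the coefficients of the same solution Φ_k. -/
theorem M_succ_apply {m : ℕ} (hm : 1 ≤ m) (k : ℤ) (a' : Fin (m - 1) → ℂ) {p : ℂ}
    (hp : p ∈ admissible) :
    M m k a' p 1 0 = M m (k + 1) a' p 0 0 ∧ M m k a' p 1 1 = M m (k + 1) a' p 0 1 := by
  refine coeff_unique hm (a' := a') hp fun t => ?_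
  have h1 := (isConn_iff.1 (isConn_M hm k a' hp) t).2
  have h2 := (isConn_iff.1 (isConn_M hm (k + 1) a' hp) t).1
  rw [add_sub_cancel_right] at h2
  rw [← h1, ← h2]

/-- The matrix of the rotation `x ↦ ω^k x` in the Fuchs basis. -/
noncomputable def rotMatrix (m : ℕ) (k : ℤ) (a' : Fin (m - 1) → ℂ) (p : ℂ) :
    Matrix (Fin 2) (Fin 2) ℂ :=
  !![omPow m (k * s p), 0;
     2 * Real.pi * Complex.I * k / m * lam m a' p * omPow m (k * s (-p)), omPow m (k * s (-p))]

theorem Phi_rot (m : ℕ) (j k : ℤ) (t : ℂ) (a : Fin m → ℂ) :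
    Phi m j (t + rot m * k) (dil (om m ^ k) a) = Phi m (j + k) t a := by
  rw [Phi, Phi, dil_dil, ← zpow_add₀ (om_ne_zero m)]
  congr 1
  rw [← rot]
  push_cast
  ring

/-- The relation defining M_j is evaluated at the rotated point and parameter: Φ_j becomes Φ_{j+k}
and the Fuchs basis gains the matrix of the rotation. The case j = 0 is the reduction to M_0, and a
rotation by one step gives the second row. -/
theorem M_add {m : ℕ} (hm : 1 ≤ m) (j k : ℤ) (a' : Fin (m - 1) → ℂ) {p : ℂ}
    (hp : p ∈ admissible) :
    M m (j + k) a' p = M m j (dil (om m ^ k) a') p * rotMatrix m k a' p := by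
  refine (isConn_M hm (j + k) a' hp).unique hm hp (isConn_iff.2 fun t => ?_)
  obtain ⟨h1, h2⟩ := isConn_iff.1 (isConn_M hm j (dil (om m ^ k) a') hp) (t + rot m * k)
  rw [f₁_rot hm k a' hp, f₂_rot hm k a' hp, ← dil_full (om_zpow_pow hm k), Phi_rot] at h1 h2
  rw [show j - 1 + k = j + k - 1 by ring] at h1
  rw [h1, h2]
  simp only [rotMatrix, Matrix.mul_apply, Fin.sum_univ_two, rot]
  simp
  constructor <;> ring

theorem M_eq_zero_mul {m : ℕ} (hm : 1 ≤ m) (k : ℤ) (a' : Fin (m - 1) → ℂ) {p : ℂ}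
    (hp : p ∈ admissible) :
    M m k a' p = M m 0 (dil (om m ^ k) a') p * rotMatrix m k a' p := by
  simpa using M_add hm 0 k a' hp

theorem M_eq_form {m : ℕ} (hm : 1 ≤ m) (k : ℤ) (a' : Fin (m - 1) → ℂ) {p : ℂ}
    (hp : p ∈ admissible) : M m k a' p =
        !![L m k a' p, Lt m k a' p;
           omPow m (s p) * L m k (dil (om m) a') p
            + 2 * Real.pi * Complex.I / m * lam m a' p * omPow m (s (-p))
              * Lt m k (dil (om m) a') p,
           omPow m (s (-p)) * Lt m k (dil (om m) a') p] := by
  have h := M_add hm k 1 a' hp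
  obtain ⟨h0, h1⟩ := M_succ_apply hm k a' hp
  ext i j
  fin_cases i <;> fin_cases j
  · rfl
  · rfl
  · refine h0.trans ?_
    rw [h]
    simp [rotMatrix, Matrix.mul_apply, Fin.sum_univ_two, L, Lt]
    ring
  · refine h1.trans ?_
    rw [h]
    simp [rotMatrix, Matrix.mul_apply, Fin.sum_univ_two, L, Lt]
    ring

/-! ### Monodromy and determinant -/

theorem rotMatrix_self {m : ℕ} (hm : 1 ≤ m) (a' : Fin (m - 1) → ℂ) (p : ℂ) :
    rotMatrix m m a' p = monodromy m a' p := by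
  have hm' : (m : ℂ) ≠ 0 := by exact_mod_cast (by omega : m ≠ 0)
  have h : ∀ z, omPow m (((m : ℤ) : ℂ) * z) = Complex.exp (2 * Real.pi * Complex.I * z) := by
    intro z
    rw [omPow, Int.cast_natCast, ← mul_assoc, div_mul_cancel₀ _ hm']
  rw [rotMatrix, monodromy, h, h, Int.cast_natCast, mul_div_cancel_right₀ _ hm']

theorem M_self {m : ℕ} (hm : 1 ≤ m) (a' : Fin (m - 1) → ℂ) {p : ℂ} (hp : p ∈ admissible) :
    M m m a' p = M m 0 a' p * monodromy m a' p := by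
  rw [M_eq_zero_mul hm m a' hp, zpow_natCast, om_pow_self hm, dil_one, rotMatrix_self hm]

theorem monodromy_mulVec {m : ℕ} (hm : 1 ≤ m) (a' : Fin (m - 1) → ℂ) {p : ℂ}
    (hp : p ∈ admissible) (t : ℂ) :
    ![f₁ m (t + 2 * Real.pi * Complex.I) a' p, f₂ m (t + 2 * Real.pi * Complex.I) a' p]
      = (monodromy m a' p).mulVec ![f₁ m t a' p, f₂ m t a' p] := by
  have hm' : (m : ℂ) ≠ 0 := by exact_mod_cast (by omega : m ≠ 0)
  have h1 := f₁_rot hm m a' hp t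
  have h2 := f₂_rot hm m a' hp t
  rw [zpow_natCast, om_pow_self hm, dil_one, rot, Int.cast_natCast, div_mul_cancel₀ _ hm'] at h1 h2
  have h : ∀ z, omPow m ((m : ℂ) * z) = Complex.exp (2 * Real.pi * Complex.I * z) := by
    intro z
    rw [omPow, ← mul_assoc, div_mul_cancel₀ _ hm']
  rw [h] at h1 h2
  rw [h1, h2]
  funext i
  fin_cases i
  · simp [monodromy, Matrix.mulVec, dotProduct, Fin.sum_univ_two]
  · simp [monodromy, Matrix.mulVec, dotProduct, Fin.sum_univ_two]
    ring

theorem det_M_mul {m : ℕ} (hm : 1 ≤ m) (k : ℤ) (a' : Fin (m - 1) → ℂ) {p : ℂ}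
    (hp : p ∈ admissible) : (M m k a' p).det * (if p = 0 then 1 else -p)
      = 2 * om m ^ (k - 1) * omPow m (r (dil (om m ^ k) (full m a' p))) := by
  have h := isConn_iff.1 (isConn_M hm k a' hp)
  rw [← wr_Phi hm k (full m a' p) 0, funext fun t => (h t).1, funext fun t => (h t).2,
    wr_linear_comb (isSolution_f₁ hm a' hp).1 (isSolution_f₂ hm a' hp).1, wr_f₁_f₂ hm a' hp,
    Matrix.det_fin_two]

/-- The factor ω^{-(k-1)m/2} equals (-1)^{k-1} and cancels the sign. -/
theorem omPow_det {m : ℕ} (hm : 1 ≤ m) (k : ℤ) (z : ℂ) :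
    (-1) ^ (k - 1) * omPow m (((k : ℂ) - 1) * (1 - (m : ℂ) / 2) + z)
      = om m ^ (k - 1) * omPow m z := by
  have hm' : (m : ℂ) ≠ 0 := by exact_mod_cast (by omega : m ≠ 0)
  have e1 : ((-1 : ℂ)) ^ (k - 1) = Complex.exp (Real.pi * Complex.I * (k - 1)) := by
    rw [← Complex.exp_pi_mul_I, ← Complex.exp_int_mul]
    congr 1
    push_cast
    ring
  rw [e1, om_zpow, omPow_eq, omPow_eq, ← Complex.exp_add, ← Complex.exp_add]
  congr 1
  rw [rot]
  push_cast
  field_simp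
  ring

theorem det_M_of_ne_zero {m : ℕ} (hm : 1 ≤ m) (k : ℤ) (a' : Fin (m - 1) → ℂ) {p : ℂ}
    (hp : p ∈ admissible) (h0 : p ≠ 0) : (M m k a' p).det =
        2 * (-1) ^ k * omPow m (((k : ℂ) - 1) * (1 - (m : ℂ) / 2)
          + r (dil (om m ^ k) (full m a' p))) / p := by
  have h := det_M_mul hm k a' hp
  rw [if_neg h0, mul_assoc 2, ← omPow_det hm] at h
  rw [eq_div_iff h0, show ((-1 : ℂ)) ^ k = (-1) ^ (k - 1) * (-1) by
    rw [← zpow_add_one₀ (by norm_num), sub_add_cancel]]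
  linear_combination -h

theorem det_M_zero {m : ℕ} (hm : 1 ≤ m) (k : ℤ) (a' : Fin (m - 1) → ℂ) :
    (M m k a' 0).det =
        2 * (-1) ^ (k - 1) * omPow m (((k : ℂ) - 1) * (1 - (m : ℂ) / 2)
          + r (dil (om m ^ k) (full m a' 0))) := by
  have h := det_M_mul hm k a' (by simpa using natCast_mem_admissible 0)
  rw [if_pos rfl, mul_assoc 2, ← omPow_det hm] at h
  linear_combination h

/-! ### The parameter `-p` -/

theorem f₂_eq_f₁_neg {m : ℕ} (hm : 1 ≤ m) (a' : Fin (m - 1) → ℂ) {p : ℂ} (hp : ∀ n : ℤ, p ≠ n)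
    (t : ℂ) : f₂ m t a' p = f₁ m t a' (-p) := by
  rw [f₂, f₁, fuchs_eq_of_isFuchs hm (admissible_of_ne_int hp) (isFuchs_frobSeq hm a' hp),
    fuchs_eq_of_isFuchs hm (admissible_of_ne_int (neg_ne_int hp))
      (isFuchs_frobSeq hm a' (neg_ne_int hp)), full_neg]
  simp [FuchsData.f₂, FuchsData.f₁]

/-- The parameter a depends on p only through p², so p ↦ -p keeps the Φ_k and merely exchanges f₁
and f₂. -/
theorem Lt_eq_L_neg {m : ℕ} (hm : 1 ≤ m) (k : ℤ) (a' : Fin (m - 1) → ℂ) {p : ℂ}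
    (hp : ∀ n : ℤ, p ≠ n) : Lt m k a' p = L m k a' (-p) := by
  have hp1 := admissible_of_ne_int hp
  have hp2 := admissible_of_ne_int (neg_ne_int hp)
  have h := isConn_iff.1 (isConn_M hm k a' hp1)
  have h' := isConn_iff.1 (isConn_M hm k a' hp2)
  refine (coeff_unique hm (a' := a') hp1 (A := M m k a' p 0 0) (C := M m k a' (-p) 0 1)
    fun t => ((h t).1.symm.trans ?_)).2
  have e := (h' t).1
  rw [full_neg, f₂_eq_f₁_neg hm a' (neg_ne_int hp), neg_neg] at e
  rw [e, f₂_eq_f₁_neg hm a' hp, add_comm]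
  rfl

/-! ### Holomorphic dependence on the parameters -/

theorem differentiable_S_param {m : ℕ} (t : ℂ) : Differentiable ℂ fun a : Fin m → ℂ => S a t :=
  Differentiable.fun_sum fun k _ => ((isPoly_sqrtCoef k).div_const _).differentiable.mul_const _

theorem differentiable_dS_param {m : ℕ} (t : ℂ) : Differentiable ℂ fun a : Fin m → ℂ => dS a t :=
  Differentiable.fun_sum fun k _ => (isPoly_sqrtCoef k).differentiable.mul_const _

theorem differentiable_ampSum_param {m : ℕ} (N : ℕ) (t : ℂ) :
    Differentiable ℂ fun a : Fin m → ℂ => ampSum N a t :=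
  Differentiable.fun_sum fun k _ => (isPoly_ampCoef k).differentiable.mul_const _

theorem differentiable_dAmpSum_param {m : ℕ} (N : ℕ) (t : ℂ) :
    Differentiable ℂ fun a : Fin m → ℂ => dAmpSum N a t :=
  Differentiable.fun_sum fun k _ => (isPoly_ampCoef k).differentiable.mul_const _

theorem wr_eq_amp_right {m : ℕ} (a : Fin m → ℂ) (u : ℂ → ℂ) {f : ℂ → ℂ}
    (hf : Differentiable ℂ f) (t : ℂ) : wr u f t
      = Complex.exp (-t) * Complex.exp (r a * t - S a t)
        * (u t * (deriv (amp a f) t - (dS a t - r a) * amp a f t) - deriv u t * amp a f t) := by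
  rw [wr, deriv_eq_amp a hf, eq_amp_mul a f t]
  ring_nf

/-- Values at `t` of solutions with data `v_2` at a far point approximate the recessive solution,
uniformly in the parameters. -/
theorem exists_approx_recessive {m : ℕ} (hm : 1 ≤ m) {K : Set (Fin m → ℂ)} (hK : IsCompact K) :
    ∃ (t₀ : ℝ) (D : ℕ → ℝ), Tendsto D atTop (𝓝 0) ∧ ∀ᶠ n in atTop, ∀ a ∈ K, ∀ h, IsSolution a h →
      amp a h (farPoint m 0 n) = ampSum 2 a (farPoint m 0 n) →
      deriv (amp a h) (farPoint m 0 n) = dAmpSum 2 a (farPoint m 0 n) →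
      ‖amp a h t₀ - amp a (recessive hm a) t₀‖ ≤ D n ∧
      ‖deriv (amp a h) t₀ - deriv (amp a (recessive hm a)) t₀‖ ≤ D n := by
  have hm' : (0 : ℝ) < m := by exact_mod_cast hm
  obtain ⟨R, hR, hp⟩ := propagate_farPoint hm hK (half_pos Real.pi_pos)
    (half_lt_self Real.pi_pos) (β := 0) (by simp)
  obtain ⟨C, hC, hp⟩ := hp 1 le_rfl
  obtain ⟨C', R', hC', hR', hr⟩ := recessive_expansion hm hK (θ := Real.pi / m)
    (by positivity) (by gcongr; linarith [Real.pi_pos]) 2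
  have hfar : ∀ n, farPoint m 0 n = ((2 / m * Real.log (n + 1) : ℝ) : ℂ) := by
    intro n; rw [farPoint]; push_cast; ring
  have hlim : Tendsto (fun n : ℕ => 2 / m * Real.log (n + 1)) atTop atTop :=
    (Real.tendsto_log_atTop.comp (tendsto_atTop_add_const_right _ _
      tendsto_natCast_atTop_atTop)).const_mul_atTop (by positivity)
  have hq : Tendsto (fun n => C' * ‖qp 1 (farPoint m 0 n)‖) atTop (𝓝 0) := by
    have := ((tendsto_norm_qp le_rfl 0).comp hlim).const_mul C'
    rw [mul_zero] at this
    refine this.congr fun n => ?_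
    rw [hfar, Function.comp_apply, add_zero]
  refine ⟨R, fun n => C * (0 + C' * ‖qp 1 (farPoint m 0 n)‖) * ‖qp 1 (R : ℂ)‖, ?_, ?_⟩
  · simpa using ((hq.const_add 0).const_mul C).mul_const ‖qp 1 (R : ℂ)‖
  · filter_upwards [hp R (by simp) (by
      simp only [Complex.ofReal_im, mul_zero, sub_zero, abs_zero]; linarith [Real.pi_pos]),
      hlim.eventually_ge_atTop R'] with n hn hn' a ha h hh h0 h1
    have hrs := isSolution_recessive hm a
    have hdh := differentiable_amp a hh.1
    have hdr := differentiable_amp a hrs.1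
    -- Matching two terms of the series leaves an error of order x^{-1}; measured against the weight
    -- x^{-1/2} of the propagation, it still carries a factor tending to 0.
    have hq2 : ‖qp 2 (farPoint m 0 n)‖ = ‖qp 1 (farPoint m 0 n)‖ * ‖qp 1 (farPoint m 0 n)‖ := by
      rw [← norm_mul, qp_mul]
    have hbd := hr a ha (farPoint m 0 n) (by rw [hfar, Complex.ofReal_re]; exact hn') (by
      rw [hfar, Complex.ofReal_im, abs_zero]; positivity)
    rw [hq2, ← mul_assoc] at hbd
    refine hn a ha (fun t => amp a h t - amp a (recessive hm a) t)
      (fun t => deriv (amp a h) t - deriv (amp a (recessive hm a)) t) 0 0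
      (C' * ‖qp 1 (farPoint m 0 n)‖) le_rfl (by positivity)
      (fun t => (hdh t).hasDerivAt.sub (hdr t).hasDerivAt) (fun t => ?_) (by simp) ?_ ?_
    · refine ((differentiable_deriv hdh t).hasDerivAt.sub
        (differentiable_deriv hdr t).hasDerivAt).congr_deriv ?_
      rw [hh.deriv2_amp, hrs.deriv2_amp, Pi.zero_apply]
      ring
    · rw [h0, norm_sub_rev]
      exact hbd.1
    · rw [h1, norm_sub_rev]
      exact hbd.2

/-- The Wronskian of the recessive solution with a holomorphic family of solutions is
holomorphic in the parameters. -/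
theorem differentiableOn_wr_recessive {m : ℕ} (hm : 1 ≤ m) {E : Type*} [NormedAddCommGroup E]
    [NormedSpace ℂ E] [ProperSpace E] {U : Set E} (hU : IsOpen U) {α : E → Fin m → ℂ}
    (hα : Differentiable ℂ α) {u : E → ℂ → ℂ} (hu : ∀ q ∈ U, IsSolution (α q) (u q))
    (hd : ∀ t, DifferentiableOn ℂ (fun q => u q t) U)
    (hd' : ∀ t, DifferentiableOn ℂ (fun q => deriv (u q) t) U) (t : ℂ) :
    DifferentiableOn ℂ (fun q => wr (u q) (recessive hm (α q)) t) U := by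
  choose h hs h0 h1 using fun (n : ℕ) (q : E) => exists_solution_amp hm (α q) (farPoint m 0 n)
    (ampSum 2 (α q) (farPoint m 0 n)) (dAmpSum 2 (α q) (farPoint m 0 n))
  -- The approximating Wronskians are evaluated at the far point, where the Cauchy data of `h n q`
  -- are explicit holomorphic functions of q; no regularity of the choice of `h` is needed.
  refine differentiableOn_of_tendstoUniformlyOn_nhds hU
    (F := fun n q => wr (u q) (h n q) (farPoint m 0 n)) (fun n => ?_) (fun q₀ hq₀ => ?_)
  · have d1 := ((differentiable_ampSum_param 2 (farPoint m 0 n)).comp hα).differentiableOn (s := U)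
    have d2 := ((differentiable_dAmpSum_param 2 (farPoint m 0 n)).comp hα).differentiableOn
      (s := U)
    have d3 := ((differentiable_S_param (farPoint m 0 n)).comp hα).differentiableOn (s := U)
    have d4 := ((differentiable_dS_param (farPoint m 0 n)).comp hα).differentiableOn (s := U)
    have d5 := (isPoly_r.differentiable.comp hα).differentiableOn (s := U)
    refine ((((d5.mul_const (farPoint m 0 n)).sub d3).cexp.const_mul
      (Complex.exp (-farPoint m 0 n))).mul (((hd (farPoint m 0 n)).mul
      (d2.sub ((d4.sub d5).mul d1))).sub ((hd' (farPoint m 0 n)).mul d1))).congr fun q _ => ?_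
    rw [wr_eq_amp_right (α q) _ (hs n q).1, h0, h1]
    rfl
  · obtain ⟨V, hV, hVU, hVc⟩ := local_compact_nhds (hU.mem_nhds hq₀)
    refine ⟨V, hV, ?_⟩
    obtain ⟨t₀, D, hD, hev⟩ := exists_approx_recessive hm (hVc.image hα.continuous)
    -- Convergence is checked at t₀ instead, the Wronskians being constant in t; b collects the
    -- factors multiplying the error D n and is bounded on the compact V.
    set b : E → ℝ := fun q => ‖Complex.exp (-t₀) * Complex.exp (r (α q) * t₀ - S (α q) t₀)‖
      * (‖u q t₀‖ * (1 + ‖dS (α q) t₀ - r (α q)‖) + ‖deriv (u q) t₀‖) with hb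
    have hbc : ContinuousOn b V := by
      have c0 := ((hd t₀).mono hVU).continuousOn
      have c1 := ((hd' t₀).mono hVU).continuousOn
      have c2 := ((differentiable_S_param (t₀ : ℂ)).comp hα).continuous
      have c3 := ((differentiable_dS_param (t₀ : ℂ)).comp hα).continuous
      have c4 := (isPoly_r.differentiable.comp hα).continuous
      have c5 : Continuous fun q => ‖Complex.exp (-t₀)
          * Complex.exp (r (α q) * t₀ - S (α q) t₀)‖ :=
        (continuous_const.mul (Complex.continuous_exp.comp ((c4.mul_const _).sub c2))).norm
      have c6 : Continuous fun q => 1 + ‖dS (α q) t₀ - r (α q)‖ :=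
        continuous_const.add (c3.sub c4).norm
      exact c5.continuousOn.mul ((c0.norm.mul c6.continuousOn).add c1.norm)
    obtain ⟨B, hB⟩ := hVc.exists_bound_of_continuousOn hbc
    rw [Metric.tendstoUniformlyOn_iff]
    intro ε hε
    have hDB : Tendsto (fun n => B * D n) atTop (𝓝 0) := by simpa using hD.const_mul B
    filter_upwards [hev, hDB.eventually (gt_mem_nhds hε)] with n hn hnε q hq
    obtain ⟨e0, e1⟩ := hn (α q) (Set.mem_image_of_mem α hq) (h n q) (hs n q) (h0 n q) (h1 n q)
    have hqU := hVU hq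
    have hrs := isSolution_recessive hm (α q)
    rw [dist_comm, dist_eq_norm, wr_const (hu q hqU) (hs n q) _ (t₀ : ℂ),
      wr_const (hu q hqU) hrs _ (t₀ : ℂ), wr_eq_amp_right (α q) _ (hs n q).1,
      wr_eq_amp_right (α q) _ hrs.1, ← mul_sub, norm_mul]
    set w := amp (α q) (h n q) t₀ - amp (α q) (recessive hm (α q)) t₀ with hw
    set y := deriv (amp (α q) (h n q)) t₀ - deriv (amp (α q) (recessive hm (α q))) t₀ with hy
    have hform : u q t₀ * (deriv (amp (α q) (h n q)) t₀
          - (dS (α q) t₀ - r (α q)) * amp (α q) (h n q) t₀) - deriv (u q) t₀ * amp (α q) (h n q) t₀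
        - (u q t₀ * (deriv (amp (α q) (recessive hm (α q))) t₀
          - (dS (α q) t₀ - r (α q)) * amp (α q) (recessive hm (α q)) t₀)
          - deriv (u q) t₀ * amp (α q) (recessive hm (α q)) t₀)
        = u q t₀ * (y - (dS (α q) t₀ - r (α q)) * w) - deriv (u q) t₀ * w := by
      rw [hw, hy]; ring
    have hD0 : 0 ≤ D n := (norm_nonneg _).trans e0
    have hbn : ‖u q t₀ * (y - (dS (α q) t₀ - r (α q)) * w) - deriv (u q) t₀ * w‖
        ≤ (‖u q t₀‖ * (1 + ‖dS (α q) t₀ - r (α q)‖) + ‖deriv (u q) t₀‖) * D n := by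
      calc _ ≤ ‖u q t₀‖ * (D n + ‖dS (α q) t₀ - r (α q)‖ * D n) + ‖deriv (u q) t₀‖ * D n := by
            refine (norm_sub_le _ _).trans (add_le_add ?_ ?_)
            · rw [norm_mul]
              refine mul_le_mul_of_nonneg_left ((norm_sub_le _ _).trans (add_le_add e1 ?_))
                (norm_nonneg _)
              rw [norm_mul]
              exact mul_le_mul_of_nonneg_left e0 (norm_nonneg _)
            · rw [norm_mul]
              exact mul_le_mul_of_nonneg_left e0 (norm_nonneg _)
        _ = _ := by ring
    rw [hform]
    refine lt_of_le_of_lt ?_ hnε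
    refine (mul_le_mul_of_nonneg_left hbn (norm_nonneg _)).trans ?_
    rw [← mul_assoc]
    refine mul_le_mul_of_nonneg_right ?_ hD0
    exact (le_abs_self _).trans (hB q hq)

/-! #### The Fuchs basis -/

theorem fuchs_g₁ {m : ℕ} (hm : 1 ≤ m) (a' : Fin (m - 1) → ℂ) {p : ℂ} (hp : p ∈ admissible) :
    (fuchs m a' p).g₁ = PS (frobSeq (full m a' p) p) := by
  rcases admissible_cases hp with h | ⟨N, rfl⟩
  · rw [fuchs_eq_of_isFuchs hm hp (isFuchs_frobSeq hm a' h)]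
  · rw [fuchs_eq_of_isFuchs hm hp (isFuchs_logSeq hm a' N)]

theorem hasDerivAt_exp_mul_PS {X : ℕ → ℂ} (h : Rapid X) (ρ t : ℂ) :
    HasDerivAt (fun t => Complex.exp (ρ * t) * PS X (Complex.exp t))
      (ρ * Complex.exp (ρ * t) * PS X (Complex.exp t)
        + Complex.exp (ρ * t) * PS (fun n => n * X n) (Complex.exp t)) t :=
  (hasDerivAt_exp_const_mul ρ t).mul (h.hasDerivAt_exp t)

theorem differentiable_s : Differentiable ℂ s := by
  unfold s
  fun_prop

theorem f₁_eq {m : ℕ} (hm : 1 ≤ m) (a' : Fin (m - 1) → ℂ) {p : ℂ} (hp : p ∈ admissible) (t : ℂ) :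
    f₁ m t a' p = Complex.exp (s p * t) * PS (frobSeq (full m a' p) p) (Complex.exp t) := by
  rw [f₁, FuchsData.f₁, fuchs_g₁ hm a' hp]

/-- The Wronskian of `f_1` and `Φ_0`. -/
theorem differentiableOn_wr_f₁ {m : ℕ} (hm : 1 ≤ m) :
    DifferentiableOn ℂ (fun q : (Fin (m - 1) → ℂ) × ℂ =>
      wr (fun t => f₁ m t q.1 q.2) (recessive hm (full m q.1 q.2)) 0)
      {q | q.2 ∈ admissible} := by
  have hr := holRapid_frobSeq m
  have hU := isOpen_snd_admissible m
  have hexp : ∀ t : ℂ, Differentiable ℂ fun q : (Fin (m - 1) → ℂ) × ℂ => Complex.exp (s q.2 * t) :=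
    fun t => ((differentiable_s.comp differentiable_snd).mul_const t).cexp
  have hs2 : Differentiable ℂ fun q : (Fin (m - 1) → ℂ) × ℂ => s q.2 :=
    differentiable_s.comp differentiable_snd
  refine differentiableOn_wr_recessive hm hU (differentiable_full m)
    (u := fun q t => f₁ m t q.1 q.2) (fun q hq => isSolution_f₁ hm q.1 hq) (fun t => ?_)
    (fun t => ?_) 0
  · exact ((hexp t).differentiableOn.mul (hr.differentiableOn hU (Complex.exp t))).congr
      fun q hq => f₁_eq hm q.1 hq t
  · refine (((hs2.mul (hexp t)).differentiableOn.mul (hr.differentiableOn hU (Complex.exp t))).add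
      ((hexp t).differentiableOn.mul (hr.nat_mul.differentiableOn hU (Complex.exp t)))).congr
      fun q hq => ?_
    rw [funext (f₁_eq hm q.1 hq)]
    exact (hasDerivAt_exp_mul_PS (hr.rapid hq) _ t).deriv

theorem f₂_natCast {m : ℕ} (hm : 1 ≤ m) (a' : Fin (m - 1) → ℂ) (N : ℕ) (t : ℂ) :
    f₂ m t a' N = logCoef (full m a' N) N
      * (Complex.exp (s N * t) * PS (frobSeq (full m a' N) N) (Complex.exp t)) * t
      + Complex.exp (s (-N) * t) * PS (logSeq (full m a' N) N) (Complex.exp t) := by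
  rw [f₂, fuchs_eq_of_isFuchs hm (natCast_mem_admissible N) (isFuchs_logSeq hm a' N)]
  rfl

/-- At p = N the explicit series with logarithm is holomorphic in a' alone, which suffices for M_k
to be entire in a' at integer p. -/
theorem differentiable_wr_f₂_natCast {m : ℕ} (hm : 1 ≤ m) (N : ℕ) :
    Differentiable ℂ (fun a' : Fin (m - 1) → ℂ =>
      wr (fun t => f₂ m t a' N) (recessive hm (full m a' N)) 0) := by
  have hN := natCast_mem_admissible N
  have hr := holRapid_frobSeq_left m hN
  have hl := holRapid_logSeq m N
  have hlc := (differentiable_logCoef m N).differentiableOn (s := Set.univ)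
  have hr0 := fun t => hr.differentiableOn isOpen_univ (Complex.exp t)
  have hr1 := fun t => hr.nat_mul.differentiableOn isOpen_univ (Complex.exp t)
  have hl0 := fun t => hl.differentiableOn isOpen_univ (Complex.exp t)
  have hl1 := fun t => hl.nat_mul.differentiableOn isOpen_univ (Complex.exp t)
  rw [← differentiableOn_univ]
  refine differentiableOn_wr_recessive hm isOpen_univ (differentiable_full_left m N)
    (u := fun a' t => f₂ m t a' N) (fun a' _ => isSolution_f₂ hm a' hN) (fun t => ?_)
    (fun t => ?_) 0
  · simp only [f₂_natCast hm]
    exact ((hlc.mul ((hr0 t).const_mul _)).mul_const t).add ((hl0 t).const_mul _)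
  · have hder : ∀ a', deriv (fun t => f₂ m t a' N) t = logCoef (full m a' N) N
        * ((s N * Complex.exp (s N * t) * PS (frobSeq (full m a' N) N) (Complex.exp t)
          + Complex.exp (s N * t) * PS (fun n => n * frobSeq (full m a' N) N n) (Complex.exp t)) * t
          + Complex.exp (s N * t) * PS (frobSeq (full m a' N) N) (Complex.exp t))
        + (s (-N) * Complex.exp (s (-N) * t) * PS (logSeq (full m a' N) N) (Complex.exp t)
          + Complex.exp (s (-N) * t)
            * PS (fun n => n * logSeq (full m a' N) N n) (Complex.exp t)) := by
      intro a'
      rw [funext (f₂_natCast hm a' N)]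
      have h1 := ((hasDerivAt_exp_mul_PS (hr.rapid (Set.mem_univ a')) (s N) t).const_mul
        (logCoef (full m a' N) N)).mul (hasDerivAt_id' t)
      refine (h1.add (hasDerivAt_exp_mul_PS (hl.rapid (Set.mem_univ a'))
        (s (-N)) t)).deriv.trans ?_
      ring
    simp only [hder]
    exact (hlc.mul (((((hr0 t).const_mul _).add ((hr1 t).const_mul _)).mul_const t).add
      ((hr0 t).const_mul _))).add (((hl0 t).const_mul _).add ((hl1 t).const_mul _))

theorem differentiable_dil {n : ℕ} (τ : ℂ) : Differentiable ℂ (dil (n := n) τ) := by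
  rw [differentiable_pi]
  intro i
  exact (differentiable_apply i).const_mul _

/-- The first row of `M_1`, that is, the coefficients of `Φ_0`. -/
theorem M_one_zero {m : ℕ} (hm : 1 ≤ m) (a' : Fin (m - 1) → ℂ) {p : ℂ} (hp : p ∈ admissible) :
    M m 1 a' p 0 0 = wr (recessive hm (full m a' p)) (fun t => f₂ m t a' p) 0
        / (if p = 0 then 1 else -p) ∧
      M m 1 a' p 0 1 = wr (fun t => f₁ m t a' p) (recessive hm (full m a' p)) 0
        / (if p = 0 then 1 else -p) := by
  have h : (fun t => Phi m (1 - 1) t (full m a' p)) = recessive hm (full m a' p) := by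
    rw [sub_self, Phi_eq hm]
    simp [dil_one]
  rw [← h]
  exact M_apply_zero hm 1 a' hp

/-! ### Holomorphy of the entries of the connection matrix -/

theorem lam_of_ne_int {m : ℕ} (hm : 1 ≤ m) (a' : Fin (m - 1) → ℂ) {p : ℂ}
    (hp : ∀ n : ℤ, p ≠ n) : lam m a' p = 0 := by
  rw [lam, fuchs_eq_of_isFuchs hm (admissible_of_ne_int hp) (isFuchs_frobSeq hm a' hp)]

theorem differentiable_lam {m : ℕ} (hm : 1 ≤ m) {p : ℂ} (hp : p ∈ admissible) :
    Differentiable ℂ fun a' : Fin (m - 1) → ℂ => lam m a' p := by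
  rcases admissible_cases hp with h | ⟨N, rfl⟩
  · simp only [lam_of_ne_int hm _ h]
    exact differentiable_const _
  · have : (fun a' : Fin (m - 1) → ℂ => lam m a' N) = fun a' => logCoef (full m a' N) N := by
      funext a'
      rw [lam, fuchs_eq_of_isFuchs hm hp (isFuchs_logSeq hm a' N)]
    rw [this]
    exact differentiable_logCoef m N

theorem differentiable_wr_f₁_left {m : ℕ} (hm : 1 ≤ m) {p : ℂ} (hp : p ∈ admissible) :
    Differentiable ℂ fun a' : Fin (m - 1) → ℂ =>
      wr (fun t => f₁ m t a' p) (recessive hm (full m a' p)) 0 := by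
  rw [← differentiableOn_univ]
  exact (differentiableOn_wr_f₁ hm).comp (f := fun a' : Fin (m - 1) → ℂ => (a', p))
    (by fun_prop) fun _ _ => hp

theorem wr_recessive_f₂_of_ne_int {m : ℕ} (hm : 1 ≤ m) (a' : Fin (m - 1) → ℂ) {p : ℂ}
    (hp : ∀ n : ℤ, p ≠ n) : wr (recessive hm (full m a' p)) (fun t => f₂ m t a' p) 0
      = -wr (fun t => f₁ m t a' (-p)) (recessive hm (full m a' (-p))) 0 := by
  rw [wr_swap, full_neg, funext (f₂_eq_f₁_neg hm a' hp)]

theorem differentiable_wr_f₂ {m : ℕ} (hm : 1 ≤ m) {p : ℂ} (hp : p ∈ admissible) :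
    Differentiable ℂ fun a' : Fin (m - 1) → ℂ =>
      wr (recessive hm (full m a' p)) (fun t => f₂ m t a' p) 0 := by
  rcases admissible_cases hp with h | ⟨N, rfl⟩
  · simp only [wr_recessive_f₂_of_ne_int hm _ h]
    exact (differentiable_wr_f₁_left hm (admissible_of_ne_int (neg_ne_int h))).neg
  · simp only [wr_swap (recessive hm _)]
    exact (differentiable_wr_f₂_natCast hm N).neg

theorem differentiable_M_one {m : ℕ} (hm : 1 ≤ m) {p : ℂ} (hp : p ∈ admissible) (j : Fin 2) :
    Differentiable ℂ fun a' : Fin (m - 1) → ℂ => M m 1 a' p 0 j := by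
  have h : ∀ c : ℂ, ∀ f : (Fin (m - 1) → ℂ) → ℂ, Differentiable ℂ f →
      Differentiable ℂ fun a' => f a' / c := fun c f hf => by
    simp only [div_eq_mul_inv]
    exact hf.mul_const _
  fin_cases j
  · exact (funext fun a' => (M_one_zero hm a' hp).1) ▸ h _ _ (differentiable_wr_f₂ hm hp)
  · exact (funext fun a' => (M_one_zero hm a' hp).2) ▸ h _ _ (differentiable_wr_f₁_left hm hp)

/-- Every first row is reduced to that of M_1, whose entries are Wronskians with Φ₀. -/
theorem M_zero_apply_eq {m : ℕ} (hm : 1 ≤ m) (k : ℤ) (a' : Fin (m - 1) → ℂ) {p : ℂ}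
    (hp : p ∈ admissible) :
    M m k a' p 0 0 = M m 1 (dil (om m ^ (k - 1)) a') p 0 0 * omPow m ((k - 1 : ℤ) * s p)
        + M m 1 (dil (om m ^ (k - 1)) a') p 0 1 * (2 * Real.pi * Complex.I * (k - 1 : ℤ) / m
          * lam m a' p * omPow m ((k - 1 : ℤ) * s (-p))) ∧
      M m k a' p 0 1
        = M m 1 (dil (om m ^ (k - 1)) a') p 0 1 * omPow m ((k - 1 : ℤ) * s (-p)) := by
  have h := M_add hm 1 (k - 1) a' hp
  rw [add_sub_cancel] at h
  rw [h]
  constructor <;> simp [rotMatrix, Matrix.mul_apply, Fin.sum_univ_two]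

theorem differentiable_M {m : ℕ} (hm : 1 ≤ m) (k : ℤ) {p : ℂ} (hp : p ∈ admissible)
    (i j : Fin 2) : Differentiable ℂ fun a' : Fin (m - 1) → ℂ => M m k a' p i j := by
  have row : ∀ (k : ℤ) (j : Fin 2), Differentiable ℂ fun a' : Fin (m - 1) → ℂ => M m k a' p 0 j := by
    intro k j
    have h0 := (differentiable_M_one hm hp 0).comp (differentiable_dil (om m ^ (k - 1)))
    have h1 := (differentiable_M_one hm hp 1).comp (differentiable_dil (om m ^ (k - 1)))
    fin_cases j
    · exact (funext fun a' => (M_zero_apply_eq hm k a' hp).1) ▸ (h0.mul_const _).add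
        (h1.mul (((differentiable_lam hm hp).const_mul _).mul_const _))
    · exact (funext fun a' => (M_zero_apply_eq hm k a' hp).2) ▸ h1.mul_const _
  fin_cases i
  · exact row k j
  · fin_cases j
    · exact (funext fun a' => (M_succ_apply hm k a' hp).1) ▸ row (k + 1) 0
    · exact (funext fun a' => (M_succ_apply hm k a' hp).2) ▸ row (k + 1) 1

theorem differentiable_omPow (m : ℕ) : Differentiable ℂ (omPow m) := by
  unfold omPow
  fun_prop

theorem admissible_of_ne_neg {p : ℂ} (hp : ∀ n : ℕ, p ≠ -(n : ℂ)) : p ∈ admissible ∧ p ≠ 0 :=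
  ⟨fun n _ => hp n, by simpa using hp 0⟩

/-- Only the Wronskian of f₁ with Φ₀ and a division by -p enter. As f₁ is holomorphic at the
positive integers p as well, only p = 0 is lost from the admissible set. -/
theorem differentiableOn_Lt {m : ℕ} (hm : 1 ≤ m) (k : ℤ) :
    DifferentiableOn ℂ (fun q : (Fin (m - 1) → ℂ) × ℂ => Lt m k q.1 q.2)
      {q | ∀ n : ℕ, q.2 ≠ -(n : ℂ)} := by
  have h1 : DifferentiableOn ℂ (fun q : (Fin (m - 1) → ℂ) × ℂ =>
      wr (fun t => f₁ m t (dil (om m ^ (k - 1)) q.1) q.2)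
        (recessive hm (full m (dil (om m ^ (k - 1)) q.1) q.2)) 0)
      {q | ∀ n : ℕ, q.2 ≠ -(n : ℂ)} :=
    (differentiableOn_wr_f₁ hm).comp
      (f := fun q : (Fin (m - 1) → ℂ) × ℂ => (dil (om m ^ (k - 1)) q.1, q.2))
      (((differentiable_dil _).comp differentiable_fst).prodMk differentiable_snd).differentiableOn
      fun q hq => (admissible_of_ne_neg hq).1
  have h2 : Differentiable ℂ fun q : (Fin (m - 1) → ℂ) × ℂ =>
      omPow m ((k - 1 : ℤ) * s (-q.2)) :=
    (differentiable_omPow m).comp ((differentiable_s.comp differentiable_snd.neg).const_mul _)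
  have h3 : ∀ q ∈ {q : (Fin (m - 1) → ℂ) × ℂ | ∀ n : ℕ, q.2 ≠ -(n : ℂ)}, -q.2 ≠ 0 :=
    fun q hq => neg_ne_zero.2 (admissible_of_ne_neg hq).2
  have h4 : DifferentiableOn ℂ (fun q : (Fin (m - 1) → ℂ) × ℂ => (-q.2)⁻¹)
      {q | ∀ n : ℕ, q.2 ≠ -(n : ℂ)} := differentiable_snd.neg.differentiableOn.inv h3
  refine ((h1.mul h4).mul h2.differentiableOn).congr fun q hq => ?_
  obtain ⟨hp, h0⟩ := admissible_of_ne_neg hq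
  refine (M_zero_apply_eq hm k q.1 hp).2.trans ?_
  rw [(M_one_zero hm _ hp).2, if_neg h0]
  rfl

/-- Obtained from L̃ by the reflection p ↦ -p, so f₂ need not be examined. -/
theorem differentiableOn_L {m : ℕ} (hm : 1 ≤ m) (k : ℤ) :
    DifferentiableOn ℂ (fun q : (Fin (m - 1) → ℂ) × ℂ => L m k q.1 q.2)
      {q | ∀ n : ℤ, q.2 ≠ n} := by
  refine ((differentiableOn_Lt hm k).comp
    (f := fun q : (Fin (m - 1) → ℂ) × ℂ => (q.1, -q.2)) (s := {q | ∀ n : ℤ, q.2 ≠ n})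
    (differentiable_fst.prodMk differentiable_snd.neg).differentiableOn fun q hq n h => ?_).congr
    fun q hq => ?_
  · exact hq n (by simpa using h)
  · rw [Function.comp_apply, Lt_eq_L_neg hm k q.1 (neg_ne_int hq), neg_neg]

theorem differentiableOn_M {m : ℕ} (hm : 1 ≤ m) (k : ℤ) (i j : Fin 2) :
    DifferentiableOn ℂ (fun q : (Fin (m - 1) → ℂ) × ℂ => M m k q.1 q.2 i j)
      {q | ∀ n : ℤ, q.2 ≠ n} := by
  have row : ∀ (k : ℤ) (j : Fin 2), DifferentiableOn ℂ
      (fun q : (Fin (m - 1) → ℂ) × ℂ => M m k q.1 q.2 0 j) {q | ∀ n : ℤ, q.2 ≠ n} := by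
    intro k j
    fin_cases j
    · exact differentiableOn_L hm k
    · exact (differentiableOn_Lt hm k).mono fun q hq n h => hq (-n) (by rw [h]; push_cast; rfl)
  fin_cases i
  · exact row k j
  · fin_cases j
    · exact (row (k + 1) 0).congr fun q hq =>
        (M_succ_apply hm k q.1 (admissible_of_ne_int hq)).1
    · exact (row (k + 1) 1).congr fun q hq =>
        (M_succ_apply hm k q.1 (admissible_of_ne_int hq)).2

end ZeroInf

theorem theorem5p3 (m : ℕ) (hm : 1 ≤ m) :
    -- `M_k(a', p)` is the one and only matrix expressing `(Φ_{k-1}, Φ_k)` in terms of `(f_1, f_2)`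
    (∀ (k : ℤ) (a' : Fin (m - 1) → ℂ), ∀ p ∈ ZeroInf.admissible,
      ∀ N : Matrix (Fin 2) (Fin 2) ℂ,
        ZeroInf.IsConn m k a' p N ↔ N = ZeroInf.M m k a' p) ∧
    -- a) the determinant
    (∀ (k : ℤ) (a' : Fin (m - 1) → ℂ), ∀ p ∈ ZeroInf.admissible,
      (p ≠ 0 → (ZeroInf.M m k a' p).det =
        2 * (-1) ^ k * ZeroInf.omPow m (((k : ℂ) - 1) * (1 - (m : ℂ) / 2)
          + ZeroInf.r (ZeroInf.dil (ZeroInf.om m ^ k) (ZeroInf.full m a' p))) / p) ∧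
      (p = 0 → (ZeroInf.M m k a' p).det =
        2 * (-1) ^ (k - 1) * ZeroInf.omPow m (((k : ℂ) - 1) * (1 - (m : ℂ) / 2)
          + ZeroInf.r (ZeroInf.dil (ZeroInf.om m ^ k) (ZeroInf.full m a' p))))) ∧
    -- b) `M_k`, hence also `L_k` and `L̃_k`, is entire in `a'`, and has the following form
    (∀ k : ℤ, ∀ p ∈ ZeroInf.admissible, ∀ i j : Fin 2,
      Differentiable ℂ (fun a' : Fin (m - 1) → ℂ => ZeroInf.M m k a' p i j)) ∧
    (∀ (k : ℤ) (a' : Fin (m - 1) → ℂ), ∀ p ∈ ZeroInf.admissible,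
      ZeroInf.M m k a' p =
        !![ZeroInf.L m k a' p, ZeroInf.Lt m k a' p;
           ZeroInf.omPow m (ZeroInf.s p) * ZeroInf.L m k (ZeroInf.dil (ZeroInf.om m) a') p
            + 2 * Real.pi * Complex.I / m * ZeroInf.lam m a' p * ZeroInf.omPow m (ZeroInf.s (-p))
              * ZeroInf.Lt m k (ZeroInf.dil (ZeroInf.om m) a') p,
           ZeroInf.omPow m (ZeroInf.s (-p)) * ZeroInf.Lt m k (ZeroInf.dil (ZeroInf.om m) a') p]) ∧
    -- c) dependence on `p`
    (∀ (k : ℤ) (i j : Fin 2),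
      DifferentiableOn ℂ (fun q : (Fin (m - 1) → ℂ) × ℂ => ZeroInf.M m k q.1 q.2 i j)
        {q | ∀ n : ℤ, q.2 ≠ n}) ∧
    (∀ (k : ℤ) (a' : Fin (m - 1) → ℂ) (p : ℂ), (∀ n : ℤ, p ≠ n) →
      ZeroInf.Lt m k a' p = ZeroInf.L m k a' (-p)) ∧
    (∀ k : ℤ,
      DifferentiableOn ℂ (fun q : (Fin (m - 1) → ℂ) × ℂ => ZeroInf.Lt m k q.1 q.2)
        {q | ∀ n : ℕ, q.2 ≠ -(n : ℂ)}) ∧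
    -- d) reduction to `M_0`
    (∀ (k : ℤ) (a' : Fin (m - 1) → ℂ), ∀ p ∈ ZeroInf.admissible,
      ZeroInf.M m k a' p = ZeroInf.M m 0 (ZeroInf.dil (ZeroInf.om m ^ k) a') p *
        !![ZeroInf.omPow m (k * ZeroInf.s p), 0;
           2 * Real.pi * Complex.I * k / m * ZeroInf.lam m a' p
            * ZeroInf.omPow m (k * ZeroInf.s (-p)),
           ZeroInf.omPow m (k * ZeroInf.s (-p))]) ∧
    -- in particular `M_m = M_0 𝔐`, where `𝔐` is the monodromy of `(f_1, f_2)` at the origin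
    (∀ a' : Fin (m - 1) → ℂ, ∀ p ∈ ZeroInf.admissible,
      (∀ t : ℂ, ![ZeroInf.f₁ m (t + 2 * Real.pi * Complex.I) a' p,
          ZeroInf.f₂ m (t + 2 * Real.pi * Complex.I) a' p]
        = (ZeroInf.monodromy m a' p).mulVec ![ZeroInf.f₁ m t a' p, ZeroInf.f₂ m t a' p]) ∧
      ZeroInf.M m m a' p = ZeroInf.M m 0 a' p * ZeroInf.monodromy m a' p) := by
  refine ⟨fun k a' p hp N => ZeroInf.isConn_iff_eq hm k a' hp N,
    fun k a' p hp => ⟨fun h0 => ZeroInf.det_M_of_ne_zero hm k a' hp h0, fun h0 => ?_⟩,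
    fun k p hp i j => ZeroInf.differentiable_M hm k hp i j,
    fun k a' p hp => ZeroInf.M_eq_form hm k a' hp,
    fun k i j => ZeroInf.differentiableOn_M hm k i j,
    fun k a' p hp => ZeroInf.Lt_eq_L_neg hm k a' hp,
    fun k => ZeroInf.differentiableOn_Lt hm k,
    fun k a' p hp => ZeroInf.M_eq_zero_mul hm k a' hp,
    fun a' p hp => ⟨fun t => ZeroInf.monodromy_mulVec hm a' hp t, ZeroInf.M_self hm a' hp⟩⟩
  subst h0
  exact ZeroInf.det_M_zero hm k a'
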